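/- **Spectral determinant of the Dirac rose graph.** Let $B\ge 1$ and let the rose graph have one vertex and $B$ loops (bonds) of lengths $L_1,\dots,L_B>0$, each identified with $[0,L_b]$. For $b=1,\dots,B$ let $u_o^b,u_t^b\in \mathrm{SU}(2)$, and define $\theta_b$ by $\cos\theta_b=\tfrac12\operatorname{tr}\big(u_o^b(u_t^b)^{-1}\big)$. Let $\mathcal D=-\mathrm i\,A\,\frac{\mathrm d}{\mathrm dx}$ be the massless Dirac operator on $\bigoplus_b L^2([0,L_b])\otimes\mathbb C^4$, where $$A=\begin{pmatrix}0&0&0&-\mathrm i\\0&0&\mathrm i&0\\0&-\mathrm i&0&0\\\mathrm i&0&0&0\end{pmatrix},$$ with domain the $\psi=(\psi^b)_b$ whose components are in $H^1$ and which satisfy, with $v^b=(\psi^b_1,\psi^b_2)^T$ and $w^b=(-\psi^b_4,\psi^b_3)^T$, the matching conditions $$u_o^bv^b(0)=u_t^bv^b(L_b)=\xi\ \text{ for all } b\ (\text{for some }\xi\in\mathbb C^2),\qquad \sum_{b}u_o^bw^b(0)-\sum_b u_t^bw^b(L_b)=0 .$$ Assume $\sum_{b}\frac{\cos\theta_b-1}{L_b}\neq0$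 (equivalently, not all $\cos\theta_b$ equal $1$). Let $0<\alpha<2\pi$ with $\alpha\neq\pi$, and define powers $z^{-s}=\mathrm e^{-s\log z}$ by the branch of the logarithm that is cut along the ray at angle $\alpha$ to the positive real axis, with $\operatorname{Im}\log z\in(\alpha-2\pi,\alpha]$. Then the nonzero eigenvalues of $\mathcal D$ have finite multiplicity; the series $\zeta(s)=\sum k^{-s}$ over the nonzero eigenvalues $k$ of $\mathcal D$, counted with multiplicity, converges absolutely for $\operatorname{Re}s>1$ and has a (unique) analytic continuation to $\mathbb C$; and the zeta-regularized determinant $\det{}'(\mathcal D)=\exp(-\zeta'(0))$ is $$\det{}'(\mathcal D)=\frac{(-1)^{B+1}}{B^2}\left(\sum_{b=1}^B\frac{\cos\theta_b-1}{L_b}\right)^2\prod_{b=1}^B(2L_b)^2 .$$ In particular it does not depend on $\alpha$. -/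

import Mathlib

open MeasureTheory

noncomputable section

namespace DiracRose

/-- Four-component spinors. -/
abbrev Spinor : Type := EuclideanSpace ℂ (Fin 4)

/-- Lebesgue measure on the bond `[0, ℓ]`. -/
abbrev bondMeasure (ℓ : ℝ) : Measure ℝ := volume.restrict (Set.Icc 0 ℓ)

/-- The Hilbert space `⨁ b, L²([0, L b]) ⊗ ℂ⁴` of a graph with bond lengths `L`. -/
abbrev GraphSpace {B : ℕ} (L : Fin B → ℝ) : Type :=
  PiLp 2 fun b => Lp Spinor 2 (bondMeasure (L b))

/-- The matrix `α` of the Dirac algebra. -/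
def alphaMatrix : Matrix (Fin 4) (Fin 4) ℂ :=
  !![0, 0, 0, -Complex.I;
     0, 0, Complex.I, 0;
     0, -Complex.I, 0, 0;
     Complex.I, 0, 0, 0]

/-- The matrix `-i α`, acting on spinors: the massless Dirac operator is `-i α d/dx`. -/
def negIAlpha : Spinor →L[ℂ] Spinor :=
  Matrix.toEuclideanCLM (𝕜 := ℂ) (-Complex.I • alphaMatrix)

/-- `ψ` belongs to the Sobolev space `H¹` of the bond `[0, ℓ]`, its derivative is `dψ ∈ L²`,
and `g` is its (absolutely) continuous representative on `[0, ℓ]`. -/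
def IsSobolevRep {ℓ : ℝ} (ψ dψ : Lp Spinor 2 (bondMeasure ℓ)) (g : ℝ → Spinor) : Prop :=
  (ψ : ℝ → Spinor) =ᵐ[bondMeasure ℓ] g ∧
    ∀ x ∈ Set.Icc 0 ℓ, g x = g 0 + ∫ t in (0 : ℝ)..x, (dψ : ℝ → Spinor) t

/-- The components `v = (ψ₁, ψ₂)` of a spinor. -/
def vPart (ψ : Spinor) : Fin 2 → ℂ := ![ψ 0, ψ 1]

/-- The components `w = (-ψ₄, ψ₃)` of a spinor. -/
def wPart (ψ : Spinor) : Fin 2 → ℂ := ![-ψ 3, ψ 2]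

/-- The matching conditions at the vertex of the rose: `u_o^b v^b(0) = u_t^b v^b(L_b) = ξ` for all
`b`, with `ξ` not prescribed, and `∑ b, u_o^b w^b(0) - ∑ b, u_t^b w^b(L_b) = 0`. -/
def VertexConditions {B : ℕ} (L : Fin B → ℝ)
    (uo ut : Fin B → Matrix.specialUnitaryGroup (Fin 2) ℂ) (g : Fin B → ℝ → Spinor) : Prop :=
  (∃ ξ : Fin 2 → ℂ, ∀ b,
      (uo b : Matrix (Fin 2) (Fin 2) ℂ).mulVec (vPart (g b 0)) = ξ ∧
      (ut b : Matrix (Fin 2) (Fin 2) ℂ).mulVec (vPart (g b (L b))) = ξ) ∧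
    ∑ b, (uo b : Matrix (Fin 2) (Fin 2) ℂ).mulVec (wPart (g b 0)) -
      ∑ b, (ut b : Matrix (Fin 2) (Fin 2) ℂ).mulVec (wPart (g b (L b))) = 0

theorem vPart_add (x y : Spinor) : vPart (x + y) = vPart x + vPart y := by
  ext i; fin_cases i <;> simp [vPart]

theorem wPart_add (x y : Spinor) : wPart (x + y) = wPart x + wPart y := by
  ext i; fin_cases i <;> simp [wPart, add_comm]

theorem vPart_smul (c : ℂ) (x : Spinor) : vPart (c • x) = c • vPart x := by
  ext i; fin_cases i <;> simp [vPart]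

theorem wPart_smul (c : ℂ) (x : Spinor) : wPart (c • x) = c • wPart x := by
  ext i; fin_cases i <;> simp [wPart]

theorem intervalIntegrable_coe {ℓ x : ℝ} (hx : x ∈ Set.Icc 0 ℓ)
    (f : Lp Spinor 2 (bondMeasure ℓ)) :
    IntervalIntegrable (f : ℝ → Spinor) volume 0 x := by
  have h : Integrable (f : ℝ → Spinor) (bondMeasure ℓ) :=
    (Lp.memLp f).integrable (by norm_num)
  rw [intervalIntegrable_iff_integrableOn_Icc_of_le hx.1]
  exact IntegrableOn.mono_set h (Set.Icc_subset_Icc_right hx.2)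

theorem intervalIntegral_congr_coe {ℓ x : ℝ} (hx : x ∈ Set.Icc 0 ℓ) {f g : ℝ → Spinor}
    (h : f =ᵐ[bondMeasure ℓ] g) : ∫ t in (0 : ℝ)..x, f t = ∫ t in (0 : ℝ)..x, g t := by
  rw [intervalIntegral.integral_of_le hx.1, intervalIntegral.integral_of_le hx.1]
  apply integral_congr_ae
  exact ae_mono (Measure.restrict_mono
    (Set.Ioc_subset_Icc_self.trans (Set.Icc_subset_Icc_right hx.2)) le_rfl) h

theorem IsSobolevRep.add {ℓ : ℝ} {ψ dψ φ dφ : Lp Spinor 2 (bondMeasure ℓ)} {g h : ℝ → Spinor}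
    (h₁ : IsSobolevRep ψ dψ g) (h₂ : IsSobolevRep φ dφ h) :
    IsSobolevRep (ψ + φ) (dψ + dφ) (g + h) := by
  refine ⟨(Lp.coeFn_add ψ φ).trans (h₁.1.add h₂.1), fun x hx => ?_⟩
  rw [intervalIntegral_congr_coe hx (Lp.coeFn_add dψ dφ)]
  simp only [Pi.add_apply]
  rw [intervalIntegral.integral_add (intervalIntegrable_coe hx dψ) (intervalIntegrable_coe hx dφ),
    h₁.2 x hx, h₂.2 x hx]
  abel

theorem IsSobolevRep.smul {ℓ : ℝ} {ψ dψ : Lp Spinor 2 (bondMeasure ℓ)} {g : ℝ → Spinor} (c : ℂ)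
    (h₁ : IsSobolevRep ψ dψ g) : IsSobolevRep (c • ψ) (c • dψ) (c • g) := by
  refine ⟨(Lp.coeFn_smul c ψ).trans (h₁.1.const_smul c), fun x hx => ?_⟩
  rw [intervalIntegral_congr_coe hx (Lp.coeFn_smul c dψ)]
  simp only [Pi.smul_apply]
  rw [intervalIntegral.integral_smul, h₁.2 x hx, smul_add]

/-- The graph of the massless Dirac operator on the rose: the pairs `(ψ, -i α ψ')` where each `ψ^b`
lies in `H¹([0, L_b]) ⊗ ℂ⁴` and `ψ` satisfies the matching conditions at the vertex. -/
def diracGraph {B : ℕ} (L : Fin B → ℝ)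
    (uo ut : Fin B → Matrix.specialUnitaryGroup (Fin 2) ℂ) :
    Submodule ℂ (GraphSpace L × GraphSpace L) where
  carrier := {p | ∃ (dψ : GraphSpace L) (g : Fin B → ℝ → Spinor),
    (∀ b, IsSobolevRep (p.1 b) (dψ b) (g b)) ∧ VertexConditions L uo ut g ∧
      ∀ b, p.2 b = negIAlpha.compLp (dψ b)}
  zero_mem' := by
    refine ⟨0, 0, fun b => ⟨?_, fun x hx => ?_⟩, ⟨⟨0, fun b => ?_⟩, ?_⟩, fun b => ?_⟩
    · exact Lp.coeFn_zero _ _ _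
    · rw [show (0 : GraphSpace L) b = 0 from rfl,
        intervalIntegral_congr_coe hx (Lp.coeFn_zero Spinor 2 (bondMeasure (L b)))]
      simp
    · have : vPart 0 = 0 := by ext i; fin_cases i <;> simp [vPart]
      simp [this]
    · have : wPart 0 = 0 := by ext i; fin_cases i <;> simp [wPart]
      simp [this]
    · exact (map_zero (negIAlpha.compLpₗ 2 (bondMeasure (L b)))).symm
  add_mem' := by
    rintro p q ⟨d, g, hd, ⟨⟨ξ, hξ⟩, hw⟩, hp⟩ ⟨e, h, he, ⟨⟨η, hη⟩, hz⟩, hq⟩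
    refine ⟨d + e, g + h, fun b => (hd b).add (he b), ⟨⟨ξ + η, fun b => ⟨?_, ?_⟩⟩, ?_⟩,
      fun b => ?_⟩
    · simp only [Pi.add_apply, vPart_add, Matrix.mulVec_add, (hξ b).1, (hη b).1]
    · simp only [Pi.add_apply, vPart_add, Matrix.mulVec_add, (hξ b).2, (hη b).2]
    · simp only [Pi.add_apply, wPart_add, Matrix.mulVec_add, Finset.sum_add_distrib]
      rw [add_sub_add_comm, hw, hz, add_zero]
    · have := map_add (negIAlpha.compLpₗ 2 (bondMeasure (L b))) (d b) (e b)
      rw [show (p + q).2 b = p.2 b + q.2 b from rfl, hp b, hq b]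
      exact this.symm
  smul_mem' := by
    rintro c p ⟨d, g, hd, ⟨⟨ξ, hξ⟩, hw⟩, hp⟩
    refine ⟨c • d, c • g, fun b => (hd b).smul c, ⟨⟨c • ξ, fun b => ⟨?_, ?_⟩⟩, ?_⟩, fun b => ?_⟩
    · simp only [Pi.smul_apply, vPart_smul, Matrix.mulVec_smul, (hξ b).1]
    · simp only [Pi.smul_apply, vPart_smul, Matrix.mulVec_smul, (hξ b).2]
    · simp only [Pi.smul_apply, wPart_smul, Matrix.mulVec_smul, ← Finset.smul_sum]
      rw [← smul_sub, hw, smul_zero]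
    · have := map_smul (negIAlpha.compLpₗ 2 (bondMeasure (L b))) c (d b)
      rw [show (c • p).2 b = c • p.2 b from rfl, hp b]
      exact this.symm

/-- A function with vanishing `L²` class has vanishing `L²` derivative. -/
theorem IsSobolevRep.deriv_eq_zero {ℓ : ℝ} {ψ dψ : Lp Spinor 2 (bondMeasure ℓ)} {g : ℝ → Spinor}
    (h : IsSobolevRep ψ dψ g) (h0 : ψ = 0) : dψ = 0 := by
  rcases lt_or_ge 0 ℓ with hℓ | hℓ
  swap
  · have hμ : bondMeasure ℓ = 0 := by
      rw [bondMeasure, Measure.restrict_eq_zero, Real.volume_Icc]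
      simpa using hℓ
    apply Lp.ext
    have hbot : ae (bondMeasure ℓ) = ⊥ := ae_eq_bot.2 hμ
    rw [Filter.EventuallyEq, hbot]
    exact Filter.eventually_bot
  have hint : IntervalIntegrable (dψ : ℝ → Spinor) volume 0 ℓ :=
    intervalIntegrable_coe ⟨hℓ.le, le_rfl⟩ dψ
  have hcont : ContinuousOn g (Set.Icc 0 ℓ) := by
    have h1 : ContinuousOn (fun x => g 0 + ∫ t in (0 : ℝ)..x, (dψ : ℝ → Spinor) t)
        (Set.Icc 0 ℓ) := by
      have := intervalIntegral.continuousOn_primitive_interval'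
        hint (Set.left_mem_uIcc)
      rw [Set.uIcc_of_le hℓ.le] at this
      exact continuousOn_const.add this
    exact h1.congr h.2
  have hae : ∀ᵐ x ∂(volume : Measure ℝ), x ∈ Set.Icc 0 ℓ → g x = 0 := by
    rw [← ae_restrict_iff' measurableSet_Icc]
    have hz : (ψ : ℝ → Spinor) =ᵐ[bondMeasure ℓ] 0 := by
      rw [h0]; exact Lp.coeFn_zero _ _ _
    exact h.1.symm.trans hz
  have hg : Set.EqOn g 0 (Set.Icc 0 ℓ) := by
    refine Measure.eqOn_Icc_of_ae_eq volume hℓ.ne ?_ hcont continuousOn_const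
    exact (ae_restrict_iff' measurableSet_Icc).2 hae
  have hprim : ∀ x ∈ Set.Icc 0 ℓ, ∫ t in (0 : ℝ)..x, (dψ : ℝ → Spinor) t = 0 := by
    intro x hx
    have := h.2 x hx
    rw [hg hx, hg ⟨le_rfl, hℓ.le⟩] at this
    simpa using this.symm
  have hIoo : ∀ᵐ x ∂(volume : Measure ℝ), x ∈ Set.Ioo 0 ℓ → (dψ : ℝ → Spinor) x = 0 := by
    filter_upwards [hint.ae_hasDerivAt_integral] with x hx hx'
    have hd := hx (by rw [Set.uIcc_of_le hℓ.le]; exact Set.Ioo_subset_Icc_self hx') 0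
      Set.left_mem_uIcc
    have hc : (fun y => ∫ t in (0 : ℝ)..y, (dψ : ℝ → Spinor) t) =ᶠ[nhds x] fun _ => 0 := by
      filter_upwards [Ioo_mem_nhds hx'.1 hx'.2] with y hy
      exact hprim y (Set.Ioo_subset_Icc_self hy)
    exact hd.unique ((hasDerivAt_const x (0 : Spinor)).congr_of_eventuallyEq hc)
  apply Lp.ext
  refine Filter.EventuallyEq.trans ?_ (Lp.coeFn_zero _ _ _).symm
  have : (dψ : ℝ → Spinor) =ᵐ[volume.restrict (Set.Ioo 0 ℓ)] 0 :=
    (ae_restrict_iff' measurableSet_Ioo).2 hIoo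
  rwa [Measure.restrict_congr_set Ioo_ae_eq_Icc] at this

/-- The graph is single-valued. -/
theorem diracGraph_functional {B : ℕ} (L : Fin B → ℝ)
    (uo ut : Fin B → Matrix.specialUnitaryGroup (Fin 2) ℂ)
    (p : GraphSpace L × GraphSpace L) (hp : p ∈ diracGraph L uo ut) (h0 : p.1 = 0) : p.2 = 0 := by
  obtain ⟨d, g, hd, -, hp2⟩ := hp
  refine PiLp.ext fun b => ?_
  have hb : d b = 0 := (hd b).deriv_eq_zero (by rw [h0]; rfl)
  change p.2 b = 0
  rw [hp2 b, hb]
  exact map_zero (negIAlpha.compLpₗ 2 (bondMeasure (L b)))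

/-- The massless Dirac operator `-i α d/dx` on the rose graph with bond lengths `L` and spin
rotations `uo`, `ut`, as an unbounded operator on the Hilbert space of the graph. -/
def diracOperator {B : ℕ} (L : Fin B → ℝ)
    (uo ut : Fin B → Matrix.specialUnitaryGroup (Fin 2) ℂ) : GraphSpace L →ₗ.[ℂ] GraphSpace L :=
  (diracGraph L uo ut).toLinearPMap

theorem diracOperator_graph {B : ℕ} (L : Fin B → ℝ)
    (uo ut : Fin B → Matrix.specialUnitaryGroup (Fin 2) ℂ) :
    (diracOperator L uo ut).graph = diracGraph L uo ut :=
  Submodule.toLinearPMap_graph_eq _ (diracGraph_functional L uo ut)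

/-- The eigenspace `{x ∈ dom A | A x = k x}` of an unbounded operator. -/
def eigenspace {E : Type*} [AddCommGroup E] [Module ℂ E] (A : E →ₗ.[ℂ] E) (k : ℂ) :
    Submodule ℂ E :=
  A.graph.comap (LinearMap.prod LinearMap.id (k • LinearMap.id))

/-- The branch of the logarithm on `ℂ \ {0}` that is cut along the ray at angle `a` to the positive
real axis, with imaginary part in `(a - 2π, a]`. -/
def branchLog (a : ℝ) (z : ℂ) : ℂ :=
  Complex.log (z * Complex.exp ((Real.pi - a : ℝ) * Complex.I)) - (Real.pi - a : ℝ) * Complex.I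

/-- `ζ` is the spectral zeta function `∑' k, k ^ (-s)` of `A`: the sum is over the nonzero
eigenvalues counted with multiplicity, the power is taken with the branch of the logarithm cut at
angle `a`, the series converges absolutely to `ζ` for `Re s > 1`, and `ζ` is its analytic
continuation to the whole plane (unique by the identity theorem). -/
def IsSpectralZeta {E : Type*} [AddCommGroup E] [Module ℂ E] (A : E →ₗ.[ℂ] E) (a : ℝ)
    (ζ : ℂ → ℂ) : Prop :=
  Differentiable ℂ ζ ∧ ∀ s : ℂ, 1 < s.re →
    HasSum (fun k : {k : ℂ // k ≠ 0} =>
      (Module.finrank ℂ (eigenspace A k) : ℂ) * Complex.exp (-s * branchLog a k)) (ζ s)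

end DiracRose

end

/-! On a bond, an eigenfunction of `-i α d/dx` for `k` is determined by its value at the origin of
the bond. Write `N = -i α`. Since `N² = -1`, this eigenfunction is `cos (k x) p - sin (k x) N p`,
and the eigenvalue problem becomes linear algebra at the vertex. Because `U + U⁻¹ = 2 cos θ` in
`SU(2)`, the spin rotations enter only through `τ b = cos (θ b)`. For `k ≠ 0` the multiplicity of
`k` is twice the order of vanishing at `k` of the even entire function `f = secular`, which is `∑ b,
(cos (L b z) - τ b) ∏ c ≠ b, sin (L c z)` divided by `z ^ (B - 1)` (`finrank_eigenspace_ofReal`).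
All zeros of `f` are real, since each `(cos w - τ) / sin w` has negative imaginary part in the upper
half-plane. The hypothesis on `∑ b, (cos (θ b) - 1) / L b` says exactly that `f 0 ≠ 0`.

Let `n k` be the order of `f` at `k`. As `f` is even, of exponential type and has real zeros, its
Hadamard product gives `∑ k, n k log (1 + t² / k²) = H t := 2 log |f (i t) / f 0|`
(`hasSum_log_of_even`). A Mellin transform in `t` turns each logarithm into `|k| ^ (-s)` times an
elementary factor, so on `1 < Re s < 2` the series `∑ n k |k| ^ (-s)` is `(s sin (π s / 2) / π) ∫ t
^ (-s - 1) H t dt` (`hasSum_mellin`).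

On the imaginary axis `H t = α t - β log t + γ` up to an error smaller than every power of `t`, with
`α = 2 ∑ L b`, `β = 2 (B - 1)` and `γ = 2 (log B - B log 2 - log |f 0|)` (`log_secular_isBigO`).
Subtracting this expansion for `t > 1` continues the integral, with the explicit terms `α / (s - 1)
- β / s² + γ / s` (`exists_continuation`).

The spectrum is symmetric, so the zeta function is this series times `1 + exp (∓ i π s)`, the sign
depending on the branch. The factor vanishes at `s = 1` and removes the pole there. Expanding at `0`
gives `ζ' 0 = γ ± i π β / 2` (`exists_isSpectralZeta`). Hence `exp (-ζ' 0) = (2 ^ B |f 0| / B)² exp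
(∓ i π (B - 1))`, and the last factor is `(-1) ^ (B + 1)` for either sign. -/

noncomputable section

namespace DiracRose

open Filter Topology

/-! ### Hadamard product of even entire functions of exponential type with real zeros. -/

theorem differentiable_dslope {f : ℂ → ℂ} (hf : Differentiable ℂ f) (a : ℂ) :
    Differentiable ℂ (dslope f a) := by
  rw [← differentiableOn_univ] at hf ⊢
  exact (Complex.differentiableOn_dslope univ_mem).2 hf

theorem deriv_eq_zero_of_even {q : ℂ → ℂ} (hq : Differentiable ℂ q) (heven : ∀ z, q (-z) = q z) :
    deriv q 0 = 0 := by
  have h1 : HasDerivAt (fun z => q (-z)) (-deriv q 0) 0 := by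
    have := (hq (-0)).hasDerivAt.scomp (0 : ℂ) (hasDerivAt_neg (0 : ℂ))
    rw [neg_zero, neg_one_smul] at this
    exact this
  have h2 : (fun z => q (-z)) = q := funext heven
  rw [h2] at h1
  have := (hq 0).hasDerivAt.unique h1
  linear_combination (1 / 2) * this

/-- An entire function with a zero of order at least `n` at `a` is divisible by `(z - a) ^ n`. -/
theorem exists_eq_pow_mul_of_le_analyticOrderAt (a : ℂ) (n : ℕ) :
    ∀ f : ℂ → ℂ, Differentiable ℂ f → (n : ℕ∞) ≤ analyticOrderAt f a →
      ∃ g : ℂ → ℂ, Differentiable ℂ g ∧ ∀ z, f z = (z - a) ^ n * g z := by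
  induction n with
  | zero => exact fun f hf _ => ⟨f, hf, by simp⟩
  | succ n ih =>
    intro f hf hn
    have hfa : f a = 0 := by
      apply apply_eq_zero_of_analyticOrderAt_ne_zero
      intro h0
      rw [h0] at hn
      simp at hn
    have hd : Differentiable ℂ (dslope f a) := differentiable_dslope hf a
    have hfe : f = (fun z => z - a) * dslope f a := by
      ext z
      have := sub_smul_dslope f a z
      rw [hfa, sub_zero, smul_eq_mul] at this
      exact this.symm
    have ho : analyticOrderAt f a = 1 + analyticOrderAt (dslope f a) a := by
      conv_lhs => rw [hfe]
      rw [analyticOrderAt_mul (by fun_prop) (hd.analyticAt a), analyticOrderAt_id_sub_const_self]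
    obtain ⟨g, hg, hfg⟩ := ih (dslope f a) hd (by
      rw [ho] at hn
      push_cast at hn
      rw [add_comm] at hn
      exact (ENat.add_le_add_iff_left ENat.one_ne_top).1 hn)
    refine ⟨g, hg, fun z => ?_⟩
    rw [hfe, Pi.mul_apply, hfg z]
    ring

theorem analyticOrderAt_ne_top_of_entire {f : ℂ → ℂ} (hf : Differentiable ℂ f) (h0 : f 0 ≠ 0)
    (a : ℂ) : analyticOrderAt f a ≠ ⊤ := by
  refine (hf.differentiableOn.analyticOnNhd isOpen_univ
    ).analyticOrderAt_ne_top_of_isPreconnected isPreconnected_univ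
    (Set.mem_univ 0) (Set.mem_univ a) ?_
  rw [(hf.analyticAt 0).analyticOrderAt_eq_zero.2 h0]
  simp

/-- Finitely many zeros can be divided out of an entire function. -/
theorem exists_eq_prod_mul {f : ℂ → ℂ} (hf : Differentiable ℂ f) (h0 : f 0 ≠ 0) (T : Finset ℂ)
    (hT : (0 : ℂ) ∉ T) : ∃ g : ℂ → ℂ, Differentiable ℂ g ∧
      (∀ z, f z = (∏ k ∈ T, (1 - z / k) ^ analyticOrderNatAt f k) * g z) ∧ ∀ k ∈ T, g k ≠ 0 := by
  classical
  induction T using Finset.induction_on with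
  | empty => exact ⟨f, hf, by simp, by simp⟩
  | insert a T haT ih =>
    rw [Finset.mem_insert, not_or] at hT
    obtain ⟨g, hg, hfg, hgT⟩ := ih hT.2
    have ha : a ≠ 0 := fun h => hT.1 h.symm
    set P : ℂ → ℂ := fun z => ∏ k ∈ T, (1 - z / k) ^ analyticOrderNatAt f k with hP
    have hPd : Differentiable ℂ P := by
      rw [hP]
      fun_prop
    have hPa : P a ≠ 0 := by
      refine Finset.prod_ne_zero_iff.2 fun k hk => pow_ne_zero _ ?_
      have hk0 : k ≠ 0 := fun h => hT.2 (h ▸ hk)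
      rw [sub_ne_zero, ne_comm, Ne, div_eq_one_iff_eq hk0]
      rintro rfl
      exact haT hk
    have ho : analyticOrderAt f a = analyticOrderAt g a := by
      have : f = P * g := funext hfg
      rw [this, analyticOrderAt_mul (hPd.analyticAt a) (hg.analyticAt a),
        (hPd.analyticAt a).analyticOrderAt_eq_zero.2 hPa, zero_add]
    have hnt := analyticOrderAt_ne_top_of_entire hf h0 a
    obtain ⟨h, hh, hgh⟩ := exists_eq_pow_mul_of_le_analyticOrderAt a (analyticOrderNatAt f a) g hg
      (by rw [Nat.cast_analyticOrderNatAt hnt, ho])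
    -- A further zero of `h` at `a` would make the order of `g` at `a`, which is that of `f`, too
    -- large.
    have hha : h a ≠ 0 := by
      rw [← (hh.analyticAt a).analyticOrderAt_eq_zero]
      have h1 : g = (fun z => z - a) ^ (analyticOrderNatAt f a) * h := by
        ext z; simp [hgh z]
      have h2 : analyticOrderAt g a = analyticOrderNatAt f a + analyticOrderAt h a := by
        conv_lhs => rw [h1]
        rw [analyticOrderAt_mul (by fun_prop) (hh.analyticAt a),
          analyticOrderAt_pow (by fun_prop), analyticOrderAt_id_sub_const_self]
        simp
      rw [← ho, Nat.cast_analyticOrderNatAt hnt] at h2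
      lift analyticOrderAt f a to ℕ using hnt with m
      by_contra hne
      have : (m : ℕ∞) < m + analyticOrderAt h a := by
        refine lt_of_lt_of_le ?_ (add_le_add_right (Order.one_le_iff_ne_zero.2 hne) _)
        exact_mod_cast Nat.lt_succ_self m
      exact absurd h2 this.ne
    -- The power of `-a` turns `(z - a) ^ m` into the normalized factor `(1 - z / a) ^ m`.
    refine ⟨fun z => (-a) ^ analyticOrderNatAt f a * h z, by fun_prop, fun z => ?_, ?_⟩
    · rw [hfg z, hgh z, Finset.prod_insert haT]
      have : (1 - z / a) * (-a) = z - a := by field_simp; ring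
      rw [← this, mul_pow]
      ring
    · intro k hk
      rcases Finset.mem_insert.1 hk with rfl | hk
      · exact mul_ne_zero (pow_ne_zero _ (neg_ne_zero.2 ha)) hha
      · refine mul_ne_zero (pow_ne_zero _ (neg_ne_zero.2 ha)) fun h0 => hgT k hk ?_
        rw [hgh, h0, mul_zero]

/-- A zero-free even function on a disk is the exponential of a function that vanishes to second
order at the origin, with a quantitative bound. -/
theorem exists_exp_of_even_of_ne_zero {q : ℂ → ℂ} {R A : ℝ} (hq : Differentiable ℂ q)
    (heven : ∀ z, q (-z) = q z) (hR : 0 < R) (hA : 0 < A) (h0 : ∀ z ∈ Metric.ball (0 : ℂ) R, q z ≠ 0)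
    (hb : ∀ z ∈ Metric.ball (0 : ℂ) R, ‖q z‖ ≤ Real.exp A * ‖q 0‖) {z : ℂ} (hz : ‖z‖ < R / 2) :
    ∃ l : ℂ, q z = q 0 * Complex.exp l ∧ ‖l‖ ≤ 8 * A / R ^ 2 * ‖z‖ ^ 2 := by
  have hd : DifferentiableOn ℂ (fun z => deriv q z / q z) (Metric.ball 0 R) := by
    refine DifferentiableOn.div ?_ hq.differentiableOn h0
    exact hq.differentiableOn.deriv Metric.isOpen_ball
  -- `l` is the primitive of the logarithmic derivative on the disk with `l 0 = 0`, that is, a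
  -- logarithm of `q / q 0`.
  obtain ⟨l, hl0, hl⟩ := hd.isExactOn_ball.with_val_at 0 0
  have hm0 : (0 : ℂ) ∈ Metric.ball (0 : ℂ) R := Metric.mem_ball_self hR
  have hexp : ∀ z ∈ Metric.ball (0 : ℂ) R, q z = q 0 * Complex.exp (l z) := by
    intro z hz
    have hconst : ∀ x ∈ Metric.ball (0 : ℂ) R,
        HasDerivAt (fun z => q z * Complex.exp (-l z)) 0 x := by
      intro x hx
      have h1 := (hq x).hasDerivAt.mul ((hl x hx).neg.cexp)
      have h2 : deriv q x * Complex.exp ((-l) x) +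
          q x * (Complex.exp ((-l) x) * -(deriv q x / q x)) = 0 := by
        have := h0 x hx
        field_simp
        ring
      rw [h2] at h1
      exact h1
    have h2 := (convex_ball (0 : ℂ) R).is_const_of_fderivWithin_eq_zero (𝕜 := ℂ)
      (f := fun z => q z * Complex.exp (-l z))
      (fun x hx => (hconst x hx).differentiableAt.differentiableWithinAt) (fun x hx => by
        rw [fderivWithin_of_isOpen Metric.isOpen_ball hx]
        ext
        simp [(hconst x hx).deriv]) hz hm0
    simp only [hl0, neg_zero, Complex.exp_zero, mul_one] at h2
    rw [← h2, mul_assoc, ← Complex.exp_add]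
    simp
  have hld : DifferentiableOn ℂ l (Metric.ball 0 R) := fun z hz =>
    (hl z hz).differentiableAt.differentiableWithinAt
  -- The bound on `|q|` is one-sided for `l`: it controls `Re l` from above, which is what
  -- Borel–Carathéodory needs.
  have hre : Set.MapsTo l (Metric.ball 0 R) {z | z.re ≤ A} := by
    intro z hz
    have h1 := hb z hz
    rw [hexp z hz, norm_mul, Complex.norm_exp, mul_comm] at h1
    exact Real.exp_le_exp.1 (le_of_mul_le_mul_right h1 (norm_pos_iff.2 (h0 0 hm0)))
  have hbc : ∀ z ∈ Metric.ball (0 : ℂ) (R / 2), ‖l z‖ ≤ 4 * A / R * ‖z‖ := by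
    intro z hz
    have hz' : ‖z‖ < R / 2 := by simpa using hz
    refine (Complex.borelCaratheodory_zero hA hld hre hR
      (Metric.ball_subset_ball (by linarith) hz) hl0).trans ?_
    rw [div_le_iff₀ (by linarith)]
    have : 2 * A * ‖z‖ = 4 * A / R * ‖z‖ * (R / 2) := by field_simp; ring
    rw [this]
    gcongr
    linarith
  -- Evenness enters here: `l` vanishes to second order, so its slope at `0` vanishes at `0`, and
  -- the Schwarz lemma applied to the slope yields the second factor `‖z‖ / R`.
  have hdl : deriv l 0 = 0 := by rw [(hl 0 hm0).deriv, deriv_eq_zero_of_even hq heven, zero_div]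
  have hsd : DifferentiableOn ℂ (dslope l 0) (Metric.ball 0 (R / 2)) :=
    (Complex.differentiableOn_dslope (Metric.ball_mem_nhds _ (by linarith))).2
      (hld.mono (Metric.ball_subset_ball (by linarith)))
  have hsm : Set.MapsTo (dslope l 0) (Metric.ball 0 (R / 2))
      (Metric.closedBall (dslope l 0 0) (4 * A / R)) := by
    intro z hz
    rw [dslope_same, hdl, mem_closedBall_zero_iff]
    rcases eq_or_ne z 0 with rfl | hz0
    · rw [dslope_same, hdl, norm_zero]; positivity
    · rw [dslope_of_ne _ hz0, slope_def_field, hl0, sub_zero, sub_zero, norm_div,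
        div_le_iff₀ (norm_pos_iff.2 hz0)]
      exact hbc z hz
  have hzb : z ∈ Metric.ball (0 : ℂ) (R / 2) := by simpa using hz
  have hfin := Complex.dist_le_div_mul_dist_of_mapsTo_ball hsd hsm hzb
  rw [dslope_same, hdl, dist_zero_right, dist_zero_right] at hfin
  refine ⟨l z, hexp z (Metric.ball_subset_ball (by linarith) hzb), ?_⟩
  have := sub_smul_dslope l 0 z
  rw [hl0, sub_zero, sub_zero, smul_eq_mul] at this
  rw [← this, norm_mul]
  calc ‖z‖ * ‖dslope l 0 z‖ ≤ ‖z‖ * (4 * A / R / (R / 2) * ‖z‖) := by gcongr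
    _ = 8 * A / R ^ 2 * ‖z‖ ^ 2 := by field_simp; ring

/-- The zeros of an entire function in a disk form a finite set. -/
theorem finite_zeros_inter_closedBall {f : ℂ → ℂ} (hf : Differentiable ℂ f) (h0 : f 0 ≠ 0)
    (R : ℝ) : {z | f z = 0 ∧ ‖z‖ ≤ R}.Finite := by
  by_contra hinf
  obtain ⟨x, -, hx⟩ := Set.Infinite.exists_accPt_of_subset_isCompact hinf
    (isCompact_closedBall (0 : ℂ) R) (fun z hz => by simpa using hz.2)
  have hfr : ∃ᶠ z in 𝓝[≠] x, f z = 0 := by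
    rw [accPt_iff_frequently_nhdsNE] at hx
    exact hx.mono fun z hz => hz.1
  have := (hf.differentiableOn.analyticOnNhd isOpen_univ).eqOn_zero_of_preconnected_of_frequently_eq_zero
    isPreconnected_univ (Set.mem_univ x) hfr
  exact h0 (this (Set.mem_univ 0))

/-- A truncated Hadamard product with explicit error. After the zeros in `|z| ≤ R` are divided out,
the remaining factor has a logarithm of size `O(R)` vanishing to second order at `0`, hence of size
`O(R · t² / R²)` at `i t`, which tends to `0`. -/
theorem exists_finset_log_sum {f : ℂ → ℂ} (hf : Differentiable ℂ f) (heven : ∀ z, f (-z) = f z)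
    (h0 : f 0 ≠ 0) (hreal : ∀ z, f z = 0 → z.im = 0) {C : ℝ} (hC : 0 < C)
    (hb : ∀ z : ℂ, 1 ≤ ‖z‖ → ‖f z‖ ≤ C * Real.exp (C * ‖z‖)) (t : ℝ) {R : ℝ} (hR : 1 ≤ R)
    (hRt : |t| < R / 2) :
    ∃ T : Finset ℝ, (∀ k : ℝ, |k| ≤ R → analyticOrderNatAt f k ≠ 0 → k ∈ T) ∧
      |∑ k ∈ T, (analyticOrderNatAt f k : ℝ) * Real.log (1 + t ^ 2 / k ^ 2) -
        2 * Real.log (‖f (t * Complex.I)‖ / ‖f 0‖)| ≤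
        8 * (8 * C * R + (|Real.log (C ^ 2 / ‖f 0‖ ^ 2)| + 1)) / R ^ 2 * t ^ 2 := by
  have hf0 : 0 < ‖f 0‖ := norm_pos_iff.2 h0
  have hfin : {k : ℝ | f k = 0 ∧ |k| ≤ R}.Finite := by
    refine Set.Finite.of_finite_image (f := ((↑) : ℝ → ℂ)) ?_ Complex.ofReal_injective.injOn
    refine (finite_zeros_inter_closedBall hf h0 R).subset ?_
    rintro _ ⟨k, hk, rfl⟩
    exact ⟨hk.1, by simpa using hk.2⟩
  set T := hfin.toFinset with hT
  have hTk : ∀ k ∈ T, f k = 0 ∧ |k| ≤ R ∧ k ≠ 0 := by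
    intro k hk
    rw [hT, Set.Finite.mem_toFinset] at hk
    refine ⟨hk.1, hk.2, ?_⟩
    rintro rfl
    exact h0 (by simpa using hk.1)
  refine ⟨T, fun k hk hn => ?_, ?_⟩
  · rw [hT, Set.Finite.mem_toFinset]
    exact ⟨apply_eq_zero_of_analyticOrderNatAt_ne_zero hn, hk⟩
  obtain ⟨g, hg, hfg, hgT⟩ := exists_eq_prod_mul hf h0 (T.map ⟨_, Complex.ofReal_injective⟩) (by
    intro h
    obtain ⟨k, hk, hk0⟩ := Finset.mem_map.1 h
    exact (hTk k hk).2.2 (by simpa using hk0))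
  simp only [Finset.prod_map, Function.Embedding.coeFn_mk, Finset.mem_map,
    forall_exists_index, and_imp, forall_apply_eq_imp_iff₂] at hfg hgT
  have hg0 : g 0 = f 0 := by simpa using (hfg 0).symm
  have hgne : ∀ z : ℂ, ‖z‖ ≤ R → g z ≠ 0 := by
    intro z hz hgz
    have hfz : f z = 0 := by rw [hfg, hgz, mul_zero]
    have him := hreal z hfz
    have hzr : ((z.re : ℝ) : ℂ) = z := Complex.ext rfl (by simp [him])
    refine hgT z.re ?_ (by rw [hzr, hgz])
    rw [hT, Set.Finite.mem_toFinset]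
    refine ⟨by rw [hzr, hfz], ?_⟩
    rw [← Real.norm_eq_abs, ← Complex.norm_real, hzr]
    exact hz
  -- On the circle of radius `4 R` each factor satisfies `|1 - w / k| ≥ 3`, so `|g| ≤ |f|` there.
  -- The maximum principle carries the bound inside.
  have hgb : ∀ z : ℂ, ‖z‖ ≤ R → ‖g z‖ ≤ C * Real.exp (4 * C * R) := by
    intro z hz
    refine Complex.norm_le_of_forall_mem_frontier_norm_le (U := Metric.ball 0 (4 * R))
      Metric.isBounded_ball hg.diffContOnCl ?_ ?_
    · intro w hw
      rw [frontier_ball _ (by positivity), mem_sphere_zero_iff_norm] at hw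
      have h1 : ‖f w‖ ≤ C * Real.exp (4 * C * R) := by
        have := hb w (by rw [hw]; linarith)
        rwa [hw, show C * (4 * R) = 4 * C * R by ring] at this
      refine le_trans ?_ h1
      rw [hfg w, norm_mul, norm_prod]
      refine le_mul_of_one_le_left (norm_nonneg _) (Finset.prod_induction _ (1 ≤ ·)
        (fun _ _ => one_le_mul_of_one_le_of_one_le) le_rfl fun k hk => ?_)
      rw [norm_pow]
      refine one_le_pow₀ ?_
      have hk0 : 0 < |k| := abs_pos.2 (hTk k hk).2.2
      have h2 : (4 : ℝ) ≤ ‖w / (k : ℂ)‖ := by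
        rw [norm_div, Complex.norm_real, Real.norm_eq_abs, le_div_iff₀ hk0, hw]
        linarith [(hTk k hk).2.1]
      have h3 := norm_sub_norm_le (w / (k : ℂ)) 1
      rw [norm_sub_rev, norm_one] at h3
      linarith
    · refine subset_closure ?_
      rw [mem_ball_zero_iff]
      linarith
  set K : ℝ := |Real.log (C ^ 2 / ‖f 0‖ ^ 2)| + 1 with hK
  have hK0 : 0 < K := by positivity
  -- The product `g z * g (-z)` is even without any argument on the symmetry of the zeros. It
  -- suffices because `|f (i t)|² = |f (i t) f (-i t)|`.
  obtain ⟨l, hl, hlb⟩ := exists_exp_of_even_of_ne_zero (q := fun z => g z * g (-z)) (R := R)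
    (A := 8 * C * R + K) (by fun_prop) (fun z => by rw [neg_neg, mul_comm]) (by linarith)
    (by positivity) (fun z hz => by
      rw [mem_ball_zero_iff] at hz
      exact mul_ne_zero (hgne z hz.le) (hgne _ (by rw [norm_neg]; exact hz.le))) (fun z hz => by
      rw [mem_ball_zero_iff] at hz
      rw [neg_zero, hg0, norm_mul, norm_mul]
      calc ‖g z‖ * ‖g (-z)‖ ≤ (C * Real.exp (4 * C * R)) * (C * Real.exp (4 * C * R)) := by
            gcongr
            · exact hgb z hz.le
            · exact hgb _ (by rw [norm_neg]; exact hz.le)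
        _ = Real.exp (8 * C * R) * (C ^ 2 / ‖f 0‖ ^ 2) * (‖f 0‖ * ‖f 0‖) := by
            rw [show 8 * C * R = 4 * C * R + 4 * C * R by ring, Real.exp_add]
            field_simp
        _ ≤ Real.exp (8 * C * R) * Real.exp K * (‖f 0‖ * ‖f 0‖) := by
            gcongr
            rw [← Real.log_le_iff_le_exp (by positivity)]
            linarith [le_abs_self (Real.log (C ^ 2 / ‖f 0‖ ^ 2))]
        _ = _ := by rw [← Real.exp_add]) (z := t * Complex.I) (by simpa using hRt)
  have hprod : ‖f (t * Complex.I)‖ ^ 2 =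
      (∏ k ∈ T, (1 + t ^ 2 / k ^ 2) ^ analyticOrderNatAt f k) * (‖f 0‖ ^ 2 * Real.exp l.re) := by
    have h1 : ‖f (t * Complex.I)‖ ^ 2 = ‖f (t * Complex.I) * f (-(t * Complex.I))‖ := by
      rw [heven, norm_mul, sq]
    rw [h1, hfg (t * Complex.I), hfg (-(t * Complex.I)), mul_mul_mul_comm, hl, neg_zero, hg0,
      ← Finset.prod_mul_distrib, norm_mul, norm_mul, norm_mul, Complex.norm_exp, norm_prod, sq ‖f 0‖]
    congr 1
    refine Finset.prod_congr rfl fun k hk => ?_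
    rw [← mul_pow, norm_pow]
    congr 1
    have hk0 : (k : ℂ) ≠ 0 := by exact_mod_cast (hTk k hk).2.2
    have h2 : (1 - t * Complex.I / k) * (1 - -(t * Complex.I) / k) =
        ((1 + t ^ 2 / k ^ 2 : ℝ) : ℂ) := by
      push_cast
      field_simp
      linear_combination (-(t : ℂ) ^ 2) * Complex.I_sq
    rw [h2, Complex.norm_real, Real.norm_of_nonneg (by positivity)]
  have hpos : ∀ k : ℝ, 0 < 1 + t ^ 2 / k ^ 2 := fun k => by positivity
  have hlog : 2 * Real.log (‖f (t * Complex.I)‖ / ‖f 0‖) =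
      ∑ k ∈ T, (analyticOrderNatAt f k : ℝ) * Real.log (1 + t ^ 2 / k ^ 2) + l.re := by
    have h1 : 2 * Real.log (‖f (t * Complex.I)‖ / ‖f 0‖) =
        Real.log (‖f (t * Complex.I)‖ ^ 2 / ‖f 0‖ ^ 2) := by
      rw [← div_pow, Real.log_pow]
      norm_num
    rw [h1, hprod, ← mul_assoc, mul_right_comm, mul_div_cancel_right₀ _ (by positivity),
      Real.log_mul (Finset.prod_ne_zero_iff.2 fun k _ => pow_ne_zero _ (hpos k).ne')
        (Real.exp_ne_zero _), Real.log_exp, Real.log_prod (fun k _ => pow_ne_zero _ (hpos k).ne')]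
    simp only [Real.log_pow]
  rw [hlog, sub_add_cancel_left, abs_neg]
  refine (Complex.abs_re_le_norm l).trans (hlb.trans_eq ?_)
  rw [norm_mul, Complex.norm_I, mul_one, Complex.norm_real, Real.norm_eq_abs, sq_abs]

/-- The logarithmic form of the Hadamard product of an even entire function of exponential type with
real zeros, on the imaginary axis. -/
theorem hasSum_log_of_even {f : ℂ → ℂ} (hf : Differentiable ℂ f) (heven : ∀ z, f (-z) = f z)
    (h0 : f 0 ≠ 0) (hreal : ∀ z, f z = 0 → z.im = 0) {C : ℝ} (hC : 0 < C)
    (hb : ∀ z : ℂ, 1 ≤ ‖z‖ → ‖f z‖ ≤ C * Real.exp (C * ‖z‖)) (t : ℝ) :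
    HasSum (fun k : ℝ => (analyticOrderNatAt f k : ℝ) * Real.log (1 + t ^ 2 / k ^ 2))
      (2 * Real.log (‖f (t * Complex.I)‖ / ‖f 0‖)) := by
  set S := 2 * Real.log (‖f (t * Complex.I)‖ / ‖f 0‖) with hS
  set F : ℝ → ℝ := fun k => (analyticOrderNatAt f k : ℝ) * Real.log (1 + t ^ 2 / k ^ 2) with hF
  have hF0 : ∀ k, 0 ≤ F k := fun k =>
    mul_nonneg (Nat.cast_nonneg _) (Real.log_nonneg (by linarith [show 0 ≤ t ^ 2 / k ^ 2 by positivity]))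
  set K : ℝ := |Real.log (C ^ 2 / ‖f 0‖ ^ 2)| + 1 with hK
  have hlim : Tendsto (fun R : ℝ => 8 * (8 * C * R + K) / R ^ 2 * t ^ 2) atTop (𝓝 0) := by
    have h1 : Tendsto (fun R : ℝ => R⁻¹) atTop (𝓝 0) := tendsto_inv_atTop_zero
    have h2 : Tendsto (fun R : ℝ => 8 * (8 * C * R⁻¹ + K * R⁻¹ ^ 2) * t ^ 2) atTop (𝓝 0) := by
      have := ((((h1.const_mul (8 * C)).add ((h1.pow 2).const_mul K)).const_mul 8).mul_const (t ^ 2))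
      simpa using this
    refine h2.congr' ?_
    filter_upwards [eventually_gt_atTop 0] with R hR
    field_simp
  -- The terms are nonnegative, so it is enough that `S` is the supremum of the finite sums. For `R`
  -- large the zeros in `u` all lie among those divided out, and the truncation error is below any
  -- `ε`.
  have hub : ∀ u : Finset ℝ, ∑ k ∈ u, F k ≤ S := by
    intro u
    refine le_of_forall_pos_le_add fun ε hε => ?_
    have hev : ∀ᶠ R : ℝ in atTop, ∀ k ∈ u, |k| ≤ R :=
      (Finset.eventually_all u).2 fun k _ => eventually_ge_atTop _
    obtain ⟨R, hR1, hR2, hR3, hR4⟩ := (hev.and ((eventually_ge_atTop 1).and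
      ((eventually_gt_atTop (2 * |t|)).and (hlim.eventually (gt_mem_nhds hε))))).exists
    obtain ⟨T, hT, hTS⟩ := exists_finset_log_sum hf heven h0 hreal hC hb t hR2 (by linarith)
    have h1 : ∑ k ∈ u, F k ≤ ∑ k ∈ T, F k := by
      rw [← Finset.sum_filter_ne_zero]
      refine Finset.sum_le_sum_of_subset_of_nonneg (fun k hk => ?_) fun k _ _ => hF0 k
      obtain ⟨hk, hne⟩ := Finset.mem_filter.1 hk
      refine hT k (hR1 k hk) fun h => hne ?_
      simp [hF, h]
    linarith [(abs_le.1 hTS).2]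
  refine hasSum_of_isLUB_of_nonneg _ hF0 ⟨?_, fun b hb' => ?_⟩
  · rintro _ ⟨u, rfl⟩
    exact hub u
  · refine le_of_forall_pos_le_add fun ε hε => ?_
    obtain ⟨R, hR2, hR3, hR4⟩ := ((eventually_ge_atTop 1).and
      ((eventually_gt_atTop (2 * |t|)).and (hlim.eventually (gt_mem_nhds hε)))).exists
    obtain ⟨T, hT, hTS⟩ := exists_finset_log_sum hf heven h0 hreal hC hb t hR2 (by linarith)
    have := hb' ⟨T, rfl⟩
    simp only at this
    linarith [(abs_le.1 hTS).1]

end DiracRose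

end


/-! ### Mellin transform of `log (1 + t)`. -/

noncomputable section

namespace DiracRose

open Filter Topology Set Asymptotics

theorem image_div_one_add_Ioi : (fun t : ℝ => t / (1 + t)) '' Ioi 0 = Ioo 0 1 := by
  ext x
  constructor
  · rintro ⟨t, ht, rfl⟩
    have ht : (0 : ℝ) < t := ht
    exact ⟨by positivity, by rw [div_lt_one (by positivity)]; linarith⟩
  · rintro ⟨h0, h1⟩
    have : (0 : ℝ) < 1 - x := by linarith
    refine ⟨x / (1 - x), div_pos h0 this, ?_⟩
    field_simp
    ring

/-- The substitution `x = t / (1 + t)` turns the Beta integral `B(a, 1 - a) = Γ(a) Γ(1 - a)` into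
this Mellin integral. The value is Euler's reflection formula. -/
theorem mellin_inv_one_add {a : ℂ} (h0 : 0 < a.re) (h1 : a.re < 1) :
    mellin (fun t : ℝ => ((1 + t)⁻¹ : ℂ)) a = Real.pi / Complex.sin (Real.pi * a) := by
  have hG := Complex.Gamma_mul_Gamma_eq_betaIntegral (s := a) (t := 1 - a) h0 (by simpa using h1)
  rw [Complex.Gamma_mul_Gamma_one_sub, add_sub_cancel, Complex.Gamma_one, one_mul,
    Complex.betaIntegral, intervalIntegral.integral_of_le zero_le_one, integral_Ioc_eq_integral_Ioo,
    ← image_div_one_add_Ioi, integral_image_eq_integral_abs_deriv_smul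
      (f' := fun t => ((1 + t) ^ 2)⁻¹) measurableSet_Ioi] at hG
  · rw [hG, mellin]
    refine setIntegral_congr_fun measurableSet_Ioi fun t ht => ?_
    have ht : (0 : ℝ) < t := ht
    have ht1 : (0 : ℝ) < 1 + t := by linarith
    have h2 : (1 : ℂ) - ((t / (1 + t) : ℝ) : ℂ) = (((1 + t)⁻¹ : ℝ) : ℂ) := by
      push_cast
      have : (1 + t : ℂ) ≠ 0 := by exact_mod_cast ht1.ne'
      field_simp
      ring
    rw [h2, smul_eq_mul, Complex.real_smul, abs_of_pos (by positivity), div_eq_mul_inv,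
      Complex.ofReal_mul, Complex.mul_cpow_ofReal_nonneg ht.le (by positivity), mul_assoc,
      mul_left_comm]
    congr 1
    rw [← Complex.cpow_add _ _ (by exact_mod_cast (inv_pos.2 ht1).ne')]
    have h3 : a - 1 + (1 - a - 1) = ((-1 : ℤ) : ℂ) := by push_cast; ring
    rw [h3, Complex.cpow_intCast]
    push_cast
    have : (1 + t : ℂ) ≠ 0 := by exact_mod_cast ht1.ne'
    simp only [zpow_neg, zpow_one, inv_inv]
    field_simp
  · intro t ht
    have ht : (0 : ℝ) < t := ht
    have ht1 : (1 + t) ≠ 0 := by linarith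
    have := ((hasDerivAt_id t).div ((hasDerivAt_id t).const_add 1) ht1).hasDerivWithinAt (s := Ioi 0)
    refine this.congr_deriv ?_
    simp only [id, div_eq_mul_inv]
    ring
  · intro x hx y hy hxy
    have hx : (0 : ℝ) < x := hx
    have hy : (0 : ℝ) < y := hy
    simp only at hxy
    rw [div_eq_div_iff (by positivity) (by positivity)] at hxy
    linarith

theorem log_one_add_isBigO_zero :
    (fun t : ℝ => ((Real.log (1 + t) : ℝ) : ℂ)) =O[𝓝[>] 0] fun t : ℝ => t ^ (-(-1 : ℝ)) := by
  refine IsBigO.of_bound 1 ?_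
  filter_upwards [self_mem_nhdsWithin] with t ht
  have ht : (0 : ℝ) < t := ht
  rw [neg_neg, Real.rpow_one, one_mul, Complex.norm_real, Real.norm_of_nonneg
    (Real.log_nonneg (by linarith)), Real.norm_of_nonneg ht.le]
  linarith [Real.log_le_sub_one_of_pos (show 0 < 1 + t by linarith)]

theorem log_one_add_isBigO_top {r : ℝ} (hr : 0 < r) :
    (fun t : ℝ => ((Real.log (1 + t) : ℝ) : ℂ)) =O[atTop] fun t : ℝ => t ^ r := by
  refine IsBigO.of_bound (2 ^ r / r) ?_
  filter_upwards [eventually_ge_atTop 1] with t ht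
  rw [Complex.norm_real, Real.norm_of_nonneg (Real.log_nonneg (by linarith)),
    Real.norm_of_nonneg (by positivity), div_mul_eq_mul_div, ← Real.mul_rpow (by norm_num)
    (by linarith)]
  refine (Real.log_le_rpow_div (by linarith) hr).trans ?_
  gcongr
  linarith

theorem locallyIntegrableOn_log_one_add :
    LocallyIntegrableOn (fun t : ℝ => ((Real.log (1 + t) : ℝ) : ℂ)) (Ioi 0) := by
  refine ContinuousOn.locallyIntegrableOn (fun t ht => ?_) measurableSet_Ioi
  have ht : (0 : ℝ) < t := ht
  refine ContinuousAt.continuousWithinAt ?_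
  exact Complex.continuous_ofReal.continuousAt.comp
    (ContinuousAt.log (by fun_prop) (by linarith))

theorem mellinConvergent_log_one_add {a : ℂ} (h0 : 0 < a.re) (h1 : a.re < 1) :
    MellinConvergent (fun t : ℝ => ((Real.log (1 + t) : ℝ) : ℂ)) (-a) := by
  refine mellinConvergent_of_isBigO_rpow (a := -(a.re / 2)) (b := -1)
    locallyIntegrableOn_log_one_add ?_ ?_ log_one_add_isBigO_zero ?_
  · rw [neg_neg]
    exact log_one_add_isBigO_top (by linarith)
  · rw [Complex.neg_re]; linarith
  · rw [Complex.neg_re]; linarith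

/-- Integration by parts reduces this to `mellin_inv_one_add` at `1 - a`. The boundary terms vanish
at `0` because `Re a < 1` and at `∞` because `Re a > 0`. -/
theorem mellin_log_one_add {a : ℂ} (h0 : 0 < a.re) (h1 : a.re < 1) :
    mellin (fun t : ℝ => ((Real.log (1 + t) : ℝ) : ℂ)) (-a) =
      Real.pi / (a * Complex.sin (Real.pi * a)) := by
  have ha : a ≠ 0 := by rintro rfl; simp at h0
  have hconv : MellinConvergent (fun t : ℝ => ((1 + t)⁻¹ : ℂ)) (1 - a) := by
    refine mellinConvergent_of_isBigO_rpow (a := 1) (b := 0) ?_ ?_ ?_ ?_ ?_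
    · refine ContinuousOn.locallyIntegrableOn (fun t ht => ?_) measurableSet_Ioi
      have ht : (0 : ℝ) < t := ht
      refine ContinuousAt.continuousWithinAt (ContinuousAt.inv₀ (by fun_prop) ?_)
      exact_mod_cast (show (1 + t) ≠ 0 by linarith)
    · refine IsBigO.of_bound 1 ?_
      filter_upwards [eventually_gt_atTop 0] with t ht
      have : (1 + t : ℂ) = ((1 + t : ℝ) : ℂ) := by push_cast; rfl
      rw [this, norm_inv, Complex.norm_real, Real.norm_of_nonneg (by linarith), one_mul,
        Real.rpow_neg_one, Real.norm_of_nonneg (by positivity)]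
      gcongr
      linarith
    · simpa using h0
    · refine IsBigO.of_bound 1 ?_
      filter_upwards [self_mem_nhdsWithin] with t ht
      have ht : (0 : ℝ) < t := ht
      have : (1 + t : ℂ) = ((1 + t : ℝ) : ℂ) := by push_cast; rfl
      rw [this, norm_inv, Complex.norm_real, Real.norm_of_nonneg (by linarith), neg_zero,
        Real.rpow_zero, norm_one, one_mul]
      exact inv_le_one_of_one_le₀ (by linarith)
    · simpa using h1
  have hnorm : ∀ t : ℝ, 0 < t → ‖(Real.log (1 + t) : ℂ) * ((t : ℂ) ^ (-a) / (-a))‖ =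
      ‖(Real.log (1 + t) : ℂ)‖ * t ^ (-a.re) * ‖a‖⁻¹ := by
    intro t ht
    rw [norm_mul, norm_div, Complex.norm_cpow_eq_rpow_re_of_pos ht, norm_neg, Complex.neg_re]
    ring
  have key := integral_Ioi_mul_deriv_eq_deriv_mul (a := (0 : ℝ)) (a' := (0 : ℂ)) (b' := (0 : ℂ))
    (u := fun t : ℝ => (Real.log (1 + t) : ℂ)) (u' := fun t : ℝ => ((1 + t)⁻¹ : ℂ))
    (v := fun t : ℝ => (t : ℂ) ^ (-a) / (-a)) (v' := fun t : ℝ => (t : ℂ) ^ (-a - 1))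
    (fun t ht => by
      have ht : (0 : ℝ) < t := ht
      have h2 := (((hasDerivAt_id t).const_add 1).log (by simp; linarith)).ofReal_comp
      simpa using h2)
    (fun t ht => by
      have ht : (0 : ℝ) < t := ht
      have := hasDerivAt_ofReal_cpow_const' ht.ne' (r := -a - 1) (by
        intro h
        exact ha (by linear_combination -h))
      rwa [sub_add_cancel] at this)
    (by
      have := mellinConvergent_log_one_add h0 h1
      refine this.congr_fun (fun t _ => ?_) measurableSet_Ioi
      simp [mul_comm])
    (by
      have : IntegrableOn _ _ volume := hconv.div_const (-a)
      refine this.congr_fun (fun t _ => ?_) measurableSet_Ioi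
      simp only [smul_eq_mul, Pi.mul_apply]
      rw [show (1 : ℂ) - a - 1 = -a by ring]
      ring)
    (by
      rw [tendsto_zero_iff_norm_tendsto_zero]
      have h2 : Tendsto (fun t : ℝ => t ^ (1 - a.re) * ‖a‖⁻¹) (𝓝[>] 0) (𝓝 0) := by
        have h3 : Tendsto (fun t : ℝ => t ^ (1 - a.re)) (𝓝[>] 0) (𝓝 0) := by
          have := (Real.continuousAt_rpow_const 0 (1 - a.re) (Or.inr (by linarith))).tendsto
          rw [Real.zero_rpow (by linarith)] at this
          exact this.mono_left nhdsWithin_le_nhds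
        simpa using h3.mul_const ‖a‖⁻¹
      refine squeeze_zero' (Eventually.of_forall fun _ => norm_nonneg _) ?_ h2
      filter_upwards [self_mem_nhdsWithin] with t ht
      have ht : (0 : ℝ) < t := ht
      rw [Pi.mul_apply, hnorm t ht, Complex.norm_real, Real.norm_of_nonneg
        (Real.log_nonneg (by linarith)), sub_eq_add_neg, Real.rpow_add ht, Real.rpow_one]
      gcongr
      linarith [Real.log_le_sub_one_of_pos (show 0 < 1 + t by linarith)])
    (by
      rw [tendsto_zero_iff_norm_tendsto_zero]
      have h2 := ((log_one_add_isBigO_top (r := a.re / 2) (by linarith)).mul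
        (isBigO_refl (fun t : ℝ => (t : ℂ) ^ (-a) / (-a)) atTop).norm_right)
      refine (IsBigO.trans_tendsto (g'' := fun t : ℝ => t ^ (-(a.re / 2))) ?_
        (tendsto_rpow_neg_atTop (by linarith))).norm.trans (by simp)
      refine h2.trans (IsBigO.of_bound ‖a‖⁻¹ ?_)
      filter_upwards [eventually_gt_atTop 0] with t ht
      rw [norm_mul, norm_norm, norm_div, Complex.norm_cpow_eq_rpow_re_of_pos ht, norm_neg, Complex.neg_re,
        Real.norm_of_nonneg (by positivity), Real.norm_of_nonneg (by positivity)]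
      rw [show -(a.re / 2) = a.re / 2 + -a.re by ring, Real.rpow_add ht]
      exact le_of_eq (by ring))
  rw [mellin]
  have h3 : ∫ t in Ioi (0 : ℝ), ((1 + t)⁻¹ : ℂ) * ((t : ℂ) ^ (-a) / (-a)) =
      mellin (fun t : ℝ => ((1 + t)⁻¹ : ℂ)) (1 - a) / (-a) := by
    rw [← mellin_div_const, mellin]
    refine setIntegral_congr_fun measurableSet_Ioi fun t _ => ?_
    simp only [smul_eq_mul]
    rw [show (1 : ℂ) - a - 1 = -a by ring]
    ring
  rw [h3, mellin_inv_one_add (by simpa using h1) (by simpa using h0)] at key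
  simp only [smul_eq_mul]
  have h4 : ∫ t in Ioi (0 : ℝ), (t : ℂ) ^ (-a - 1) * (Real.log (1 + t) : ℂ) =
    ∫ t in Ioi (0 : ℝ), (Real.log (1 + t) : ℂ) * (t : ℂ) ^ (-a - 1) := by
    simp only [mul_comm]
  rw [h4, key, show (Real.pi : ℂ) * (1 - a) = Real.pi - Real.pi * a by ring, Complex.sin_pi_sub]
  rw [div_div, mul_neg, div_neg, mul_comm a]
  ring

end DiracRose

end


/-! ### Mellin transforms of the single logarithms and of the asymptotic terms. -/

noncomputable section

namespace DiracRose

open Filter Topology Set Asymptotics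

/-- Rescaling `t` by `|k|` produces the power `|k| ^ (-s)`, and the substitution `t ↦ t ^ 2` halves
the argument. The range `0 < Re s < 2` is thus that of `0 < Re (s / 2) < 1`. -/
theorem hasMellin_log_one_add_sq_div {k : ℝ} (hk : k ≠ 0) {s : ℂ} (h0 : 0 < s.re)
    (h2 : s.re < 2) :
    HasMellin (fun t : ℝ => ((Real.log (1 + t ^ 2 / k ^ 2) : ℝ) : ℂ)) (-s)
      (((|k| : ℝ) : ℂ) ^ (-s) * (Real.pi / (s * Complex.sin (Real.pi * s / 2)))) := by
  have hk' : 0 < |k|⁻¹ := inv_pos.2 (abs_pos.2 hk)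
  have hfun : (fun t : ℝ => ((Real.log (1 + t ^ 2 / k ^ 2) : ℝ) : ℂ)) = fun t : ℝ =>
      (fun x : ℝ => (fun y : ℝ => ((Real.log (1 + y) : ℝ) : ℂ)) (x ^ (2 : ℝ))) (|k|⁻¹ * t) := by
    ext t
    simp only [Real.rpow_two, mul_pow, inv_pow, sq_abs]
    rw [div_eq_mul_inv, mul_comm]
  have hs0 : 0 < (s / 2).re := by simpa using h0
  have hs1 : (s / 2).re < 1 := by
    have : (s / 2).re = s.re / 2 := by simp
    rw [this]; linarith
  have hns : -s / ((2 : ℝ) : ℂ) = -(s / 2) := by push_cast; ring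
  have hcomp := mellin_comp_rpow (fun y : ℝ => ((Real.log (1 + y) : ℝ) : ℂ)) (-s) 2
  have hconv := MellinConvergent.comp_rpow (f := fun y : ℝ => ((Real.log (1 + y) : ℝ) : ℂ))
    (s := -s) (two_ne_zero (α := ℝ))
  rw [hns] at hcomp hconv
  rw [hfun]
  constructor
  · rw [MellinConvergent.comp_mul_left (f := fun x : ℝ =>
      (fun y : ℝ => ((Real.log (1 + y) : ℝ) : ℂ)) (x ^ (2 : ℝ))) hk']
    exact hconv.2 (mellinConvergent_log_one_add hs0 hs1)
  · rw [mellin_comp_mul_left (fun x : ℝ =>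
      (fun y : ℝ => ((Real.log (1 + y) : ℝ) : ℂ)) (x ^ (2 : ℝ))) _ hk', hcomp,
      mellin_log_one_add hs0 hs1, neg_neg, smul_eq_mul, Complex.ofReal_inv,
      Complex.inv_cpow _ _ (by rw [Complex.arg_ofReal_of_nonneg (abs_nonneg k)]; exact Real.pi_pos.ne),
      Complex.cpow_neg, Complex.real_smul, mul_div_assoc]
    congr 1
    rw [abs_of_pos two_pos]
    push_cast
    rw [inv_mul_eq_div, div_div]
    congr 1
    ring

/-- For nonnegative functions the absolute integral is again a Mellin transform, at `Re s`. The
closed forms therefore also provide the bounds needed to exchange sum and integral. -/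
theorem ofReal_integral_norm_mellin {F : ℝ → ℝ} (hF : ∀ t, 0 < t → 0 ≤ F t) (s : ℂ) :
    ((∫ t in Ioi (0 : ℝ), ‖(t : ℂ) ^ (s - 1) • (F t : ℂ)‖ : ℝ) : ℂ) =
      mellin (fun t => (F t : ℂ)) (s.re : ℂ) := by
  rw [← integral_complex_ofReal, mellin]
  refine setIntegral_congr_fun measurableSet_Ioi fun t ht => ?_
  have ht : (0 : ℝ) < t := ht
  rw [norm_smul, Complex.norm_cpow_eq_rpow_re_of_pos ht, Complex.norm_real,
    Real.norm_of_nonneg (hF t ht), Complex.ofReal_mul, Complex.ofReal_cpow ht.le, smul_eq_mul]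
  simp

/-- The indicator function of `(1, ∞)`. -/
def tailIndicator : ℝ → ℂ := indicator (Ioi 1) fun _ => 1

theorem hasMellin_tailIndicator {s : ℂ} (hs : s.re < 0) :
    HasMellin tailIndicator s (-1 / s) := by
  simp_rw [tailIndicator, HasMellin, mellin, MellinConvergent, ← indicator_smul, IntegrableOn,
    integrable_indicator_iff measurableSet_Ioi, smul_eq_mul, integral_indicator measurableSet_Ioi,
    mul_one, IntegrableOn,
    Measure.restrict_restrict_of_subset (Ioi_subset_Ioi (zero_le_one (α := ℝ)))]
  have h1 : (s - 1).re < -1 := by rw [Complex.sub_re, Complex.one_re]; linarith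
  refine ⟨integrableOn_Ioi_cpow_of_lt h1 one_pos, ?_⟩
  rw [integral_Ioi_cpow_of_lt h1 one_pos, Complex.ofReal_one, Complex.one_cpow, sub_add_cancel]

theorem tailIndicator_eventuallyEq_zero : tailIndicator =ᶠ[𝓝[>] 0] 0 := by
  filter_upwards [mem_nhdsWithin_of_mem_nhds (Iio_mem_nhds (show (0 : ℝ) < 1 by norm_num))]
    with t ht
  exact indicator_of_notMem (by simpa using (le_of_lt ht)) _

theorem tailIndicator_eventuallyEq_one : tailIndicator =ᶠ[atTop] 1 := by
  filter_upwards [eventually_gt_atTop 1] with t ht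
  exact indicator_of_mem (by simpa using ht) _

theorem locallyIntegrable_tailIndicator : LocallyIntegrable tailIndicator :=
  (locallyIntegrable_const 1).indicator measurableSet_Ioi

/-- Inserting `log t` differentiates the transform in `s`, so the value is the derivative of `-1 /
s`. -/
theorem hasMellin_log_tailIndicator {s : ℂ} (hs : s.re < 0) :
    HasMellin (fun t => Real.log t • tailIndicator t) s (1 / s ^ 2) := by
  have h := mellin_hasDerivAt_of_isBigO_rpow (a := 0) (b := s.re - 1) (f := tailIndicator) (s := s)
    (locallyIntegrable_tailIndicator.locallyIntegrableOn _)
    (by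
      refine (tailIndicator_eventuallyEq_one.isBigO).trans ?_
      simp only [neg_zero, Real.rpow_zero]
      exact isBigO_const_const _ one_ne_zero _) hs
    ((tailIndicator_eventuallyEq_zero.isBigO).trans (isBigO_zero _ _)) (by linarith)
  refine ⟨h.1, ?_⟩
  have hs0 : s ≠ 0 := by rintro rfl; simp at hs
  have h2 : HasDerivAt (fun z : ℂ => -1 / z) (1 / s ^ 2) s := by
    have := (hasDerivAt_inv hs0).neg
    refine (this.congr_deriv (by simp)).congr_of_eventuallyEq (Eventually.of_forall fun z => ?_)
    simp [div_eq_mul_inv]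
  have h3 : mellin tailIndicator =ᶠ[𝓝 s] fun z => -1 / z := by
    filter_upwards [(isOpen_Iio.preimage Complex.continuous_re).mem_nhds hs] with z hz
    exact (hasMellin_tailIndicator hz).2
  exact h.2.unique (h2.congr_of_eventuallyEq h3)

theorem hasMellin_affine_log_tailIndicator (α β γ : ℝ) {s : ℂ} (hs : 1 < s.re) :
    HasMellin (fun t : ℝ => ((α * t - β * Real.log t + γ : ℝ) : ℂ) * tailIndicator t) (-s)
      (α / (s - 1) - β / s ^ 2 + γ / s) := by
  have hs0 : (-s).re < 0 := by rw [Complex.neg_re]; linarith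
  have hs1 : (-s + 1).re < 0 := by rw [Complex.add_re, Complex.neg_re, Complex.one_re]; linarith
  have e1 : MellinConvergent (fun t : ℝ => (t : ℂ) ^ (1 : ℂ) • tailIndicator t) (-s) :=
    MellinConvergent.cpow_smul.2 (hasMellin_tailIndicator hs1).1
  have a1 := hasMellin_const_smul e1 (α : ℂ)
  have a2 := hasMellin_const_smul (hasMellin_log_tailIndicator hs0).1 (β : ℂ)
  have a3 := hasMellin_const_smul (hasMellin_tailIndicator hs0).1 (γ : ℂ)
  have h := hasMellin_add (hasMellin_sub a1.1 a2.1).1 a3.1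
  have hf : (fun t : ℝ => ((α * t - β * Real.log t + γ : ℝ) : ℂ) * tailIndicator t) = fun t : ℝ =>
      (α : ℂ) • ((t : ℂ) ^ (1 : ℂ) • tailIndicator t) -
        (β : ℂ) • (Real.log t • tailIndicator t) + (γ : ℂ) • tailIndicator t := by
    ext t
    simp only [smul_eq_mul, Complex.cpow_one, Complex.real_smul]
    push_cast
    ring
  rw [hf]
  refine ⟨h.1, h.2.trans ?_⟩
  rw [(hasMellin_sub a1.1 a2.1).2, a1.2, a2.2, a3.2, mellin_cpow_smul,
    (hasMellin_tailIndicator hs1).2, (hasMellin_tailIndicator hs0).2,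
    (hasMellin_log_tailIndicator hs0).2]
  have h1 : s - 1 ≠ 0 := by
    intro h; rw [sub_eq_zero.1 h] at hs; simp at hs
  have h2 : s ≠ 0 := by rintro rfl; simp at hs; linarith
  have h3 : -s + 1 = -(s - 1) := by ring
  rw [h3]
  simp only [smul_eq_mul]
  field_simp

end DiracRose

end


/-! ### Continuation of `∑ n k |k| ^ (-s)` by a Mellin transform. -/

noncomputable section

namespace DiracRose

open Filter Topology Set Asymptotics

/-- `n` counts points `k ≠ 0` of the real line with multiplicity, `H` is the logarithm of
`∏ k, (1 + t² / k²) ^ n k`, and `α t - β log t + γ` is the asymptotic expansion of `H` at `∞`. -/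
structure IsZeroCounting (n : ℝ → ℕ) (H : ℝ → ℝ) (α β γ : ℝ) : Prop where
  zero : n 0 = 0
  exists_gap : ∃ δ : ℝ, 0 < δ ∧ ∀ k, n k ≠ 0 → δ ≤ |k|
  hasSum : ∀ t : ℝ, HasSum (fun k : ℝ => (n k : ℝ) * Real.log (1 + t ^ 2 / k ^ 2)) (H t)
  continuousOn : ContinuousOn H (Ioi 0)
  isBigO : ∀ N : ℝ, (fun t => H t - (α * t - β * Real.log t + γ)) =O[atTop] fun t => t ^ (-N)

namespace IsZeroCounting

variable {n : ℝ → ℕ} {H : ℝ → ℝ} {α β γ : ℝ}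

theorem log_nonneg (t k : ℝ) : 0 ≤ Real.log (1 + t ^ 2 / k ^ 2) :=
  Real.log_nonneg (by linarith [show 0 ≤ t ^ 2 / k ^ 2 by positivity])

theorem nonneg (h : IsZeroCounting n H α β γ) (t : ℝ) : 0 ≤ H t :=
  (h.hasSum t).nonneg fun k => mul_nonneg (Nat.cast_nonneg _) (log_nonneg t k)

/-- The gap around `0` gives `log (1 + t² / k²) ≤ (1 + δ⁻²) t² log (1 + 1 / k²)` for every counted
`k`. Summation bounds `H t` by a multiple of `t² H 1`. -/
theorem isBigO_zero (h : IsZeroCounting n H α β γ) :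
    (fun t => (H t : ℂ)) =O[𝓝[>] 0] fun t : ℝ => t ^ (-(-2 : ℝ)) := by
  obtain ⟨δ, hδ, hgap⟩ := h.exists_gap
  refine IsBigO.of_bound ((1 + (δ ^ 2)⁻¹) * H 1) (Eventually.of_forall fun t => ?_)
  rw [neg_neg, Real.rpow_two, Complex.norm_real, Real.norm_of_nonneg (h.nonneg t), norm_pow,
    Real.norm_eq_abs, sq_abs]
  have h1 := (h.hasSum 1).mul_left ((1 + (δ ^ 2)⁻¹) * t ^ 2)
  refine (hasSum_le (fun k => ?_) (h.hasSum t) h1).trans_eq (by ring)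
  by_cases hn : n k = 0
  · simp [hn]
  have hk : δ ≤ |k| := hgap k hn
  have hk2 : δ ^ 2 ≤ k ^ 2 := by
    rw [← sq_abs k]; gcongr
  have hk0 : 0 < k ^ 2 := lt_of_lt_of_le (by positivity) hk2
  rw [mul_left_comm]
  gcongr
  set x : ℝ := (k ^ 2)⁻¹ with hx
  have hx0 : 0 < x := inv_pos.2 hk0
  have hxX : x ≤ (δ ^ 2)⁻¹ := inv_anti₀ (by positivity) hk2
  have e1 : Real.log (1 + t ^ 2 / k ^ 2) ≤ t ^ 2 * x := by
    rw [div_eq_mul_inv]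
    linarith [Real.log_le_sub_one_of_pos (show 0 < 1 + t ^ 2 * (k ^ 2)⁻¹ by positivity)]
  have e2 : x / (1 + x) ≤ Real.log (1 + 1 ^ 2 / k ^ 2) := by
    rw [one_pow, one_div]
    have := Real.one_sub_inv_le_log_of_pos (show 0 < 1 + x by positivity)
    refine le_trans (le_of_eq ?_) this
    field_simp
    ring
  have e3 : x ≤ (1 + (δ ^ 2)⁻¹) * Real.log (1 + 1 ^ 2 / k ^ 2) := by
    calc x = (1 + x) * (x / (1 + x)) := by field_simp
      _ ≤ (1 + (δ ^ 2)⁻¹) * Real.log (1 + 1 ^ 2 / k ^ 2) := by gcongr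
  calc _ ≤ t ^ 2 * x := e1
    _ ≤ t ^ 2 * ((1 + (δ ^ 2)⁻¹) * Real.log (1 + 1 ^ 2 / k ^ 2)) := by gcongr
    _ = _ := by ring

theorem isBigO_top (h : IsZeroCounting n H α β γ) :
    (fun t => (H t : ℂ)) =O[atTop] fun t : ℝ => t ^ (-(-1 : ℝ)) := by
  rw [neg_neg]
  have h1 : (fun t : ℝ => α * t - β * Real.log t + γ) =O[atTop] fun t : ℝ => t ^ (1 : ℝ) := by
    refine IsBigO.add (IsBigO.sub ?_ ?_) ?_
    · simp only [Real.rpow_one]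
      exact isBigO_const_mul_self α _ _
    · exact ((isLittleO_log_rpow_atTop one_pos).isBigO).const_mul_left β
    · refine (isLittleO_const_left.2 (Or.inr ?_)).isBigO
      simp only [Real.rpow_one]
      exact tendsto_norm_atTop_atTop
  have h2 := (h.isBigO (-1)).add (by simpa using h1)
  simp only [sub_add_cancel, neg_neg] at h2
  exact (Complex.isBigO_ofReal_left (f := H)).2 h2

theorem locallyIntegrableOn (h : IsZeroCounting n H α β γ) :
    LocallyIntegrableOn (fun t => (H t : ℂ)) (Ioi 0) :=
  (Complex.continuous_ofReal.comp_continuousOn h.continuousOn).locallyIntegrableOn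
    measurableSet_Ioi

theorem mellinConvergent (h : IsZeroCounting n H α β γ) {s : ℂ} (h1 : 1 < s.re) (h2 : s.re < 2) :
    MellinConvergent (fun t => (H t : ℂ)) (-s) :=
  mellinConvergent_of_isBigO_rpow h.locallyIntegrableOn h.isBigO_top
    (by rw [Complex.neg_re]; linarith) h.isBigO_zero (by rw [Complex.neg_re]; linarith)

theorem ne_zero (h : IsZeroCounting n H α β γ) {k : ℝ} (hk : n k ≠ 0) : k ≠ 0 := by
  rintro rfl; exact hk h.zero

/-- The summands of `H`, as complex functions. -/
theorem hasMellin_term (h : IsZeroCounting n H α β γ) (k : ℝ) {s : ℂ} (h0 : 0 < s.re)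
    (h2 : s.re < 2) :
    HasMellin (fun t : ℝ => (((n k : ℝ) * Real.log (1 + t ^ 2 / k ^ 2) : ℝ) : ℂ)) (-s)
      (n k * ((|k| : ℝ) : ℂ) ^ (-s) * (Real.pi / (s * Complex.sin (Real.pi * s / 2)))) := by
  by_cases hn : n k = 0
  · simp [hn, HasMellin, MellinConvergent, mellin]
  · have h3 := hasMellin_log_one_add_sq_div (h.ne_zero hn) h0 h2
    have := hasMellin_const_smul h3.1 (n k : ℂ)
    rw [h3.2, smul_eq_mul, ← mul_assoc] at this
    convert this using 3
    simp

theorem sin_pos {σ : ℝ} (h0 : 0 < σ) (h2 : σ < 2) : 0 < Real.sin (Real.pi * σ / 2) :=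
  Real.sin_pos_of_pos_of_lt_pi (by positivity) (by nlinarith [Real.pi_pos])

/-- The Mellin integral of a summand of `H`. -/
theorem integral_norm_term (h : IsZeroCounting n H α β γ) (k : ℝ) {s : ℂ} (h0 : 0 < s.re)
    (h2 : s.re < 2) :
    ∫ t in Ioi (0 : ℝ),
      ‖(t : ℂ) ^ (-s - 1) • (((n k : ℝ) * Real.log (1 + t ^ 2 / k ^ 2) : ℝ) : ℂ)‖ =
      n k * |k| ^ (-s.re) * (Real.pi / (s.re * Real.sin (Real.pi * s.re / 2))) := by
  apply Complex.ofReal_injective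
  rw [ofReal_integral_norm_mellin fun t _ => mul_nonneg (Nat.cast_nonneg _) (log_nonneg t k),
    Complex.neg_re, Complex.ofReal_neg, (h.hasMellin_term k (s := (s.re : ℂ)) (by simpa) (by simpa)).2]
  push_cast
  rw [Complex.ofReal_cpow (abs_nonneg k)]
  simp

/-- Up to the constant `c > 0`, the term of `k` is the absolute Mellin integral of its summand in
`H`. Finite sums of nonnegative summands lie below `H`, so their integrals are bounded by the
convergent integral of `H`. -/
theorem summable_of_lt_two (h : IsZeroCounting n H α β γ) {σ : ℝ} (h1 : 1 < σ) (h2 : σ < 2) :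
    Summable fun k : ℝ => (n k : ℝ) * |k| ^ (-σ) := by
  set c : ℝ := Real.pi / (σ * Real.sin (Real.pi * σ / 2)) with hc
  have hc0 : 0 < c := by
    have := sin_pos (by linarith : 0 < σ) h2
    have := Real.pi_pos
    positivity
  have key : Summable fun k : ℝ => (n k : ℝ) * |k| ^ (-σ) * c := by
    refine summable_of_sum_le (c := ∫ t in Ioi (0 : ℝ), ‖(t : ℂ) ^ (-(σ : ℂ) - 1) • (H t : ℂ)‖)
      (fun k => by positivity) fun u => ?_
    have hterm : ∀ k : ℝ, (n k : ℝ) * |k| ^ (-σ) * c = ∫ t in Ioi (0 : ℝ),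
        ‖(t : ℂ) ^ (-(σ : ℂ) - 1) • (((n k : ℝ) * Real.log (1 + t ^ 2 / k ^ 2) : ℝ) : ℂ)‖ := by
      intro k
      rw [h.integral_norm_term k (by simpa using by linarith) (by simpa using h2)]
      simp [hc]
    simp_rw [hterm]
    have hint : ∀ k : ℝ, IntegrableOn (fun t : ℝ =>
        (t : ℂ) ^ (-(σ : ℂ) - 1) • (((n k : ℝ) * Real.log (1 + t ^ 2 / k ^ 2) : ℝ) : ℂ)) (Ioi 0) :=
      fun k => (h.hasMellin_term k (by simpa using by linarith) (by simpa using h2)).1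
    rw [← integral_finsetSum _ fun k _ => (hint k).norm]
    refine integral_mono (integrable_finsetSum _ fun k _ => (hint k).norm)
      (h.mellinConvergent (by simpa using h1) (by simpa using h2)).norm fun t => ?_
    simp only [norm_smul, ← Finset.mul_sum]
    gcongr
    rw [Complex.norm_real, Real.norm_of_nonneg (h.nonneg t)]
    refine le_trans (le_of_eq ?_) (sum_le_hasSum u (fun k _ =>
      mul_nonneg (Nat.cast_nonneg _) (log_nonneg t k)) (h.hasSum t))
    refine Finset.sum_congr rfl fun k _ => ?_
    rw [Complex.norm_real, Real.norm_of_nonneg (mul_nonneg (Nat.cast_nonneg _) (log_nonneg t k))]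
  exact (summable_mul_right_iff hc0.ne').1 key

theorem summable (h : IsZeroCounting n H α β γ) {σ : ℝ} (h1 : 1 < σ) :
    Summable fun k : ℝ => (n k : ℝ) * |k| ^ (-σ) := by
  obtain ⟨δ, hδ, hgap⟩ := h.exists_gap
  -- For larger exponents the gap allows comparison with some `τ < 2`: `|k| ^ (-σ) ≤ δ ^ (-(σ - τ))
  -- |k| ^ (-τ)`.
  obtain ⟨τ, hτ1, hτ⟩ := exists_between (lt_min h1 one_lt_two)
  refine Summable.of_nonneg_of_le (fun k => by positivity) (fun k => ?_)
    ((h.summable_of_lt_two hτ1 (hτ.trans_le (min_le_right _ _))).mul_left (δ ^ (-(σ - τ))))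
  by_cases hn : n k = 0
  · simp [hn]
  have hk := hgap k hn
  have hk0 : 0 < |k| := hδ.trans_le hk
  rw [mul_left_comm]
  gcongr
  rw [show -σ = -(σ - τ) + -τ by ring, Real.rpow_add hk0]
  gcongr ?_ * _
  refine Real.rpow_le_rpow_of_nonpos hδ hk ?_
  linarith [hτ.trans_le (min_le_left _ _)]

theorem hasSum_mellin (h : IsZeroCounting n H α β γ) {s : ℂ} (h1 : 1 < s.re) (h2 : s.re < 2) :
    HasSum (fun k : ℝ => (n k : ℂ) * ((|k| : ℝ) : ℂ) ^ (-s))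
      (s * Complex.sin (Real.pi * s / 2) / Real.pi * mellin (fun t => (H t : ℂ)) (-s)) := by
  have h0 : 0 < s.re := by linarith
  -- Interchanging sum and integral requires a countable index set. The counted points form one,
  -- being contained in the support of the summable family for `H 1`.
  set S : Set ℝ := {k | n k ≠ 0} with hS
  have hScount : S.Countable := by
    refine (h.hasSum 1).summable.countable_support.mono fun k hk => ?_
    refine mul_ne_zero (Nat.cast_ne_zero.2 hk) (Real.log_pos ?_).ne'
    have := sq_pos_of_ne_zero (h.ne_zero hk)
    rw [lt_add_iff_pos_right]
    positivity
  have : Countable S := hScount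
  set F : ℝ → ℝ → ℂ := fun k t =>
    (t : ℂ) ^ (-s - 1) • (((n k : ℝ) * Real.log (1 + t ^ 2 / k ^ 2) : ℝ) : ℂ) with hF
  have key := hasSum_integral_of_summable_integral_norm (μ := volume.restrict (Ioi (0 : ℝ)))
    (F := fun k : S => F k) (fun k => (h.hasMellin_term k h0 h2).1) (by
      simp_rw [hF, h.integral_norm_term _ h0 h2]
      exact ((h.summable_of_lt_two h1 h2).comp_injective Subtype.val_injective).mul_right _)
  have hsum : ∫ t in Ioi (0 : ℝ), ∑' k : S, F k t = mellin (fun t => (H t : ℂ)) (-s) := by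
    rw [mellin]
    refine setIntegral_congr_fun measurableSet_Ioi fun t _ => ?_
    have h3 : HasSum (fun k : ℝ => F k t) ((t : ℂ) ^ (-s - 1) • (H t : ℂ)) :=
      (Complex.hasSum_ofReal.2 (h.hasSum t)).const_smul _
    refine ((hasSum_subtype_iff_of_support_subset ?_).2 h3).tsum_eq
    intro k hk hn
    exact hk (by simp [hF, hn])
  rw [hsum] at key
  have hval : ∀ k : ℝ, ∫ t in Ioi (0 : ℝ), F k t =
      n k * ((|k| : ℝ) : ℂ) ^ (-s) * (Real.pi / (s * Complex.sin (Real.pi * s / 2))) :=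
    fun k => (h.hasMellin_term k h0 h2).2
  simp_rw [hval] at key
  have key2 := (hasSum_subtype_iff_of_support_subset (f := fun k : ℝ =>
    n k * ((|k| : ℝ) : ℂ) ^ (-s) * (Real.pi / (s * Complex.sin (Real.pi * s / 2)))) (by
      intro k hk hn
      exact hk (by simp [hn]))).1 key
  -- The zeros of this sine are the even integers, none of which has real part strictly between `1`
  -- and `2`.
  have hsin : Complex.sin (Real.pi * s / 2) ≠ 0 := by
    rw [Complex.sin_ne_zero_iff]
    intro m hm
    have h3 : s = ((2 * m : ℝ) : ℂ) := by
      have : (Real.pi : ℂ) ≠ 0 := by exact_mod_cast Real.pi_ne_zero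
      push_cast
      field_simp at hm
      linear_combination hm
    rw [h3, Complex.ofReal_re] at h1 h2
    have h4 : 0 < (m : ℝ) := by linarith
    have h5 : (m : ℝ) < 1 := by linarith
    norm_cast at h4 h5
    omega
  have hs0 : s ≠ 0 := by rintro rfl; simp at h0
  have hpi : (Real.pi : ℂ) ≠ 0 := by exact_mod_cast Real.pi_ne_zero
  have key3 := key2.mul_left (s * Complex.sin (Real.pi * s / 2) / Real.pi)
  refine key3.congr_fun fun k => ?_
  generalize Complex.sin (Real.pi * s / 2) = c at hsin ⊢
  field_simp

/-- The analytic continuation of the zeta function of the counted points to `Re s < 2`. -/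
theorem exists_continuation (h : IsZeroCounting n H α β γ) :
    ∃ M : ℂ → ℂ, (∀ s, s.re < 2 → DifferentiableAt ℂ M s) ∧ ∀ s : ℂ, 1 < s.re → s.re < 2 →
      HasSum (fun k : ℝ => (n k : ℂ) * ((|k| : ℝ) : ℂ) ^ (-s))
        (s * Complex.sin (Real.pi * s / 2) / Real.pi *
          (M s + (α / (s - 1) - β / s ^ 2 + γ / s))) := by
  -- The expansion is removed only for `t > 1`. The difference `r` is still `O(t²)` at `0` and
  -- decays faster than every power at `∞`, so its transform at `-s` is holomorphic for `Re s < 2`.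
  set P : ℝ → ℂ := fun t => ((α * t - β * Real.log t + γ : ℝ) : ℂ) * tailIndicator t with hP
  set r : ℝ → ℂ := fun t => (H t : ℂ) - P t with hr
  have hr0 : r =O[𝓝[>] 0] fun t : ℝ => t ^ (-(-2 : ℝ)) := by
    refine h.isBigO_zero.congr' ?_ EventuallyEq.rfl
    filter_upwards [tailIndicator_eventuallyEq_zero] with t ht
    simp [hr, hP, ht]
  have hrtop : ∀ N : ℝ, r =O[atTop] fun t : ℝ => t ^ (-N) := by
    intro N
    refine ((Complex.isBigO_ofReal_left).2 (h.isBigO N)).congr' ?_ EventuallyEq.rfl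
    filter_upwards [tailIndicator_eventuallyEq_one] with t ht
    simp [hr, hP, ht]
  have hPint : LocallyIntegrableOn P (Ioi 0) := by
    have h1 : (fun t : ℝ => ((α * t - β * Real.log t + γ : ℝ) : ℂ) * tailIndicator t) =
        (Ioi 1).indicator fun t : ℝ => ((α * t - β * Real.log t + γ : ℝ) : ℂ) := by
      ext t
      by_cases ht : t ∈ Ioi (1 : ℝ) <;> simp [tailIndicator, ht]
    rw [hP, h1]
    have h2 : ContinuousOn (fun t : ℝ => ((α * t - β * Real.log t + γ : ℝ) : ℂ)) (Ioi 0) := by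
      intro t ht
      have ht : (0 : ℝ) < t := ht
      refine ContinuousAt.continuousWithinAt (Complex.continuous_ofReal.continuousAt.comp ?_)
      have := Real.continuousAt_log ht.ne'
      fun_prop
    intro x hx
    obtain ⟨U, hU, hUi⟩ := h2.locallyIntegrableOn (μ := volume) measurableSet_Ioi x hx
    exact ⟨U, hU, hUi.indicator measurableSet_Ioi⟩
  have hrint : LocallyIntegrableOn r (Ioi 0) := h.locallyIntegrableOn.sub hPint
  refine ⟨fun s => mellin r (-s), fun s hs => ?_, fun s h1 h2 => ?_⟩
  · have hd : DifferentiableAt ℂ (mellin r) (-s) :=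
      mellin_differentiableAt_of_isBigO_rpow hrint (hrtop ((-s).re + 1)) (by linarith) hr0
        (by rw [Complex.neg_re]; linarith)
    exact hd.comp s differentiableAt_id.neg
  · have hm := hasMellin_affine_log_tailIndicator α β γ h1
    have hd := hasMellin_sub (h.mellinConvergent h1 h2) hm.1
    have h3 : mellin r (-s) + (α / (s - 1) - β / s ^ 2 + γ / s) =
        mellin (fun t => (H t : ℂ)) (-s) := by
      rw [hr, hP, hd.2, hm.2]
      ring
    simp only [h3]
    exact h.hasSum_mellin h1 h2

end IsZeroCounting

end DiracRose

end


/-! ### Branches of the power, and the spectral zeta function with its derivative at `0`. -/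

noncomputable section

namespace DiracRose

open Filter Topology Set Asymptotics

theorem branchLog_ofReal_mul_exp {a r θ φ : ℝ} (hr : 0 < r) (hφ : ∃ m : ℤ, φ = θ + m * (2 * Real.pi))
    (h1 : a - 2 * Real.pi < φ) (h2 : φ ≤ a) :
    branchLog a (r * Complex.exp (θ * Complex.I)) = Real.log r + φ * Complex.I := by
  obtain ⟨m, rfl⟩ := hφ
  have h3 : (r : ℂ) * Complex.exp (θ * Complex.I) * Complex.exp ((Real.pi - a : ℝ) * Complex.I) =
      Complex.exp (Real.log r + ((θ + m * (2 * Real.pi) + (Real.pi - a) : ℝ) : ℂ) * Complex.I) := by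
    rw [Complex.exp_add, ← Complex.ofReal_exp, Real.exp_log hr, mul_assoc, ← Complex.exp_add]
    congr 1
    rw [Complex.exp_eq_exp_iff_exists_int]
    refine ⟨-m, ?_⟩
    push_cast
    ring
  have him : ((Real.log r : ℂ) +
      ((θ + m * (2 * Real.pi) + (Real.pi - a) : ℝ) : ℂ) * Complex.I).im =
      θ + m * (2 * Real.pi) + (Real.pi - a) := by
    simp
  rw [branchLog, h3, Complex.log_exp (by rw [him]; linarith) (by rw [him]; linarith)]
  push_cast
  ring

/-- The sign of the imaginary part of the branch of the logarithm on the negative half-axis. -/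
def branchSign (a : ℝ) : ℝ := if Real.pi < a then 1 else -1

theorem branchLog_of_pos {a k : ℝ} (ha0 : 0 < a) (ha2 : a < 2 * Real.pi) (hk : 0 < k) :
    branchLog a k = Real.log k := by
  have := branchLog_ofReal_mul_exp (a := a) (θ := 0) (φ := 0) hk ⟨0, by simp⟩ (by linarith) ha0.le
  simpa using this

theorem branchLog_of_neg {a k : ℝ} (ha0 : 0 < a) (ha2 : a < 2 * Real.pi) (ha : a ≠ Real.pi)
    (hk : k < 0) :
    branchLog a k = Real.log |k| + (branchSign a * Real.pi : ℝ) * Complex.I := by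
  have h1 : (k : ℂ) = ((|k| : ℝ) : ℂ) * Complex.exp ((Real.pi : ℝ) * Complex.I) := by
    rw [Complex.exp_pi_mul_I, abs_of_neg hk]
    simp
  rw [h1, branchLog_ofReal_mul_exp (φ := branchSign a * Real.pi) (abs_pos.2 hk.ne)]
  · rw [branchSign]
    split_ifs
    · exact ⟨0, by simp⟩
    · exact ⟨-1, by push_cast; ring⟩
  · rw [branchSign]
    split_ifs with h
    · linarith
    · have := lt_of_le_of_ne (not_lt.1 h) ha
      linarith
  · rw [branchSign]
    split_ifs with h
    · linarith
    · linarith [Real.pi_pos]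

/-- The factor by which the powers of negative numbers differ from those of their absolute values. -/
def negFactor (a : ℝ) (s : ℂ) : ℂ := Complex.exp (-s * ((branchSign a * Real.pi : ℝ) * Complex.I))

theorem differentiable_negFactor (a : ℝ) : Differentiable ℂ (negFactor a) := by
  unfold negFactor
  fun_prop

/-- Either sign gives `exp (∓ i π) = -1`. Hence `1 + negFactor a` cancels the pole at `s = 1` for
every admissible branch. -/
theorem negFactor_one (a : ℝ) : negFactor a 1 = -1 := by
  rw [negFactor, branchSign]
  split_ifs
  · rw [show (-1 : ℂ) * (((1 : ℝ) * Real.pi : ℝ) * Complex.I) = -(Real.pi * Complex.I) by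
      push_cast; ring, Complex.exp_neg, Complex.exp_pi_mul_I]
    norm_num
  · rw [show (-1 : ℂ) * (((-1 : ℝ) * Real.pi : ℝ) * Complex.I) = Real.pi * Complex.I by
      push_cast; ring, Complex.exp_pi_mul_I]

theorem exp_neg_mul_branchLog {a k : ℝ} (ha0 : 0 < a) (ha2 : a < 2 * Real.pi) (ha : a ≠ Real.pi)
    (hk : k ≠ 0) (s : ℂ) :
    Complex.exp (-s * branchLog a k) =
      ((|k| : ℝ) : ℂ) ^ (-s) * (if 0 < k then 1 else negFactor a s) := by
  have hk' : ((|k| : ℝ) : ℂ) ≠ 0 := by exact_mod_cast (abs_pos.2 hk).ne'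
  rw [Complex.cpow_def_of_ne_zero hk', ← Complex.ofReal_log (abs_nonneg k)]
  split_ifs with h
  · rw [branchLog_of_pos ha0 ha2 h, abs_of_pos h, mul_one, mul_comm]
  · rw [branchLog_of_neg ha0 ha2 ha (lt_of_le_of_ne (not_lt.1 h) hk), negFactor, ← Complex.exp_add]
    congr 1
    ring

namespace IsZeroCounting

variable {n : ℝ → ℕ} {H : ℝ → ℝ} {α β γ : ℝ}

theorem norm_term (h : IsZeroCounting n H α β γ) (k : ℝ) (s : ℂ) :
    ‖(n k : ℂ) * ((|k| : ℝ) : ℂ) ^ (-s)‖ = n k * |k| ^ (-s.re) := by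
  by_cases hn : n k = 0
  · simp [hn]
  rw [norm_mul, Complex.norm_natCast, Complex.norm_cpow_eq_rpow_re_of_pos
    (abs_pos.2 (h.ne_zero hn)), Complex.neg_re]

theorem summable_complex (h : IsZeroCounting n H α β γ) {s : ℂ} (h1 : 1 < s.re) :
    Summable fun k : ℝ => (n k : ℂ) * ((|k| : ℝ) : ℂ) ^ (-s) := by
  refine Summable.of_norm ?_
  simp_rw [h.norm_term]
  exact h.summable h1

theorem differentiableAt_tsum (h : IsZeroCounting n H α β γ) {s : ℂ} (h1 : 1 < s.re) :
    DifferentiableAt ℂ (fun s : ℂ => ∑' k : ℝ, (n k : ℂ) * ((|k| : ℝ) : ℂ) ^ (-s)) s := by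
  obtain ⟨δ, hδ, hgap⟩ := h.exists_gap
  obtain ⟨σ, hσ1, hσ⟩ := exists_between h1
  -- A gap at most `1` makes `δ' ^ x` decreasing in `x`, which gives one majorant for the whole
  -- strip `U`.
  set δ' := min δ 1 with hδ'
  have hδ0 : 0 < δ' := lt_min hδ one_pos
  set U : Set ℂ := {w | σ < w.re ∧ w.re < s.re + 1} with hU
  have hUo : IsOpen U := (isOpen_lt continuous_const Complex.continuous_re).inter
    (isOpen_lt Complex.continuous_re continuous_const)
  have hd := Complex.differentiableOn_tsum_of_summable_norm (U := U)
    (u := fun k : ℝ => δ' ^ (-(s.re + 1 - σ)) * ((n k : ℝ) * |k| ^ (-σ)))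
    (F := fun (k : ℝ) (w : ℂ) => (n k : ℂ) * ((|k| : ℝ) : ℂ) ^ (-w))
    ((h.summable hσ1).mul_left _) (fun k => ?_) hUo (fun k w hw => ?_)
  · exact hd.differentiableAt (hUo.mem_nhds ⟨hσ, by linarith⟩)
  · by_cases hn : n k = 0
    · simp [hn]
    · have hk : ((|k| : ℝ) : ℂ) ≠ 0 := by exact_mod_cast (abs_pos.2 (h.ne_zero hn)).ne'
      refine DifferentiableOn.const_mul ?_ _
      exact (differentiableOn_id.neg).const_cpow (Or.inl hk)
  · rw [h.norm_term]
    by_cases hn : n k = 0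
    · simp [hn]
    have hk0 : 0 < |k| := abs_pos.2 (h.ne_zero hn)
    have hk1 : δ' ≤ |k| := (min_le_left _ _).trans (hgap k hn)
    rw [mul_left_comm]
    gcongr
    rw [show -w.re = -(w.re - σ) + -σ by ring, Real.rpow_add hk0]
    gcongr ?_ * _
    refine (Real.rpow_le_rpow_of_nonpos hδ0 hk1 (by linarith [hw.1])).trans ?_
    exact Real.rpow_le_rpow_of_exponent_ge hδ0 (min_le_right _ _) (by linarith [hw.2])

/-- The sum over the counted points, with negative points weighted by `W`. -/
theorem hasSum_weighted (h : IsZeroCounting n H α β γ) (hn : ∀ k, n (-k) = n k) {s Z : ℂ} (W : ℂ)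
    (hs : 1 < s.re) (hZ : HasSum (fun k : ℝ => (n k : ℂ) * ((|k| : ℝ) : ℂ) ^ (-s)) Z) :
    HasSum (fun k : ℝ => 2 * (n k : ℂ) * (((|k| : ℝ) : ℂ) ^ (-s) * (if 0 < k then 1 else W)))
      ((1 + W) * Z) := by
  set F : ℝ → ℂ := fun k =>
    2 * (n k : ℂ) * (((|k| : ℝ) : ℂ) ^ (-s) * (if 0 < k then 1 else W)) with hF
  have hsum : Summable F := by
    refine Summable.of_norm_bounded ((h.summable hs).mul_left (2 * (1 + ‖W‖))) fun k => ?_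
    have : F k = 2 * (if 0 < k then 1 else W) * ((n k : ℂ) * ((|k| : ℝ) : ℂ) ^ (-s)) := by
      rw [hF]; ring
    rw [this, norm_mul, h.norm_term, norm_mul, Complex.norm_ofNat]
    gcongr
    split_ifs <;> simp
  have h1 := hsum.hasSum
  -- Adding the reflected sum removes the dependence on the sign of `k`: for `k ≠ 0` each pair
  -- contributes `2 (1 + W) n k |k| ^ (-s)`, and the total is counted twice.
  have h2 : HasSum (fun k => F (-k)) (∑' k, F k) := (Equiv.neg ℝ).hasSum_iff.2 h1
  have h3 := h1.add h2
  have h4 : HasSum (fun k => F k + F (-k)) (2 * (1 + W) * Z) := by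
    refine (hZ.mul_left (2 * (1 + W))).congr_fun fun k => ?_
    rcases eq_or_ne k 0 with rfl | hk
    · simp [hF, h.zero]
    · rcases lt_or_gt_of_ne hk with hk | hk
      · have e1 : ¬ 0 < k := not_lt.2 hk.le
        have e2 : 0 < -k := neg_pos.2 hk
        simp only [hF, hn, abs_neg, e1, e2, if_true, if_false]
        ring
      · have e2 : ¬ 0 < -k := by simp [hk.le]
        simp only [hF, hn, abs_neg, hk, e2, if_true, if_false]
        ring
  have h5 := h3.unique h4
  have h6 : ∑' k, F k = (1 + W) * Z := by linear_combination h5 / 2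
  rw [← h6]
  exact h1

end IsZeroCounting

/-- A holomorphic function `q` with `s * q s = sin (π s / 2) / π`. -/
def sinQuotient : ℂ → ℂ := dslope (fun s => Complex.sin (Real.pi * s / 2) / Real.pi) 0

theorem differentiable_sinQuotient : Differentiable ℂ sinQuotient :=
  differentiable_dslope (by fun_prop) 0

theorem mul_sinQuotient (s : ℂ) : s * sinQuotient s = Complex.sin (Real.pi * s / 2) / Real.pi := by
  have := sub_smul_dslope (fun s => Complex.sin (Real.pi * s / 2) / Real.pi) 0 s
  simpa [sinQuotient] using this

theorem sinQuotient_zero : sinQuotient 0 = 1 / 2 := by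
  rw [sinQuotient, dslope_same]
  have hpi : (Real.pi : ℂ) ≠ 0 := by exact_mod_cast Real.pi_ne_zero
  have h1 : HasDerivAt (fun s : ℂ => Real.pi * s / 2) (Real.pi / 2) 0 := by
    simpa using ((hasDerivAt_id (0 : ℂ)).const_mul (Real.pi : ℂ)).div_const 2
  have h2 := (h1.csin.div_const (Real.pi : ℂ)).deriv
  rw [h2]
  simp
  field_simp

theorem sinQuotient_neg (s : ℂ) : sinQuotient (-s) = sinQuotient s := by
  rcases eq_or_ne s 0 with rfl | hs
  · simp
  · have h1 := mul_sinQuotient s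
    have h2 := mul_sinQuotient (-s)
    rw [show (Real.pi : ℂ) * -s / 2 = -(Real.pi * s / 2) by ring, Complex.sin_neg] at h2
    refine mul_left_cancel₀ hs ?_
    rw [h1]
    linear_combination -h2

theorem hasSum_eigenvalues {E : Type*} [AddCommGroup E] [Module ℂ E] {A : E →ₗ.[ℂ] E}
    {n : ℝ → ℕ} (h0 : n 0 = 0)
    (hm : ∀ k : ℝ, k ≠ 0 → Module.finrank ℂ (eigenspace A k) = 2 * n k)
    (hm' : ∀ k : ℂ, k.im ≠ 0 → Module.finrank ℂ (eigenspace A k) = 0)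
    {a : ℝ} (ha0 : 0 < a) (ha2 : a < 2 * Real.pi) (ha : a ≠ Real.pi) {s Z : ℂ}
    (hZ : HasSum (fun k : ℝ => 2 * (n k : ℂ) *
      (((|k| : ℝ) : ℂ) ^ (-s) * (if 0 < k then 1 else negFactor a s))) Z) :
    HasSum (fun k : {k : ℂ // k ≠ 0} =>
      (Module.finrank ℂ (eigenspace A k) : ℂ) * Complex.exp (-s * branchLog a k)) Z := by
  have h1 := (hasSum_subtype_iff_of_support_subset (s := {k : ℝ | k ≠ 0}) (by
    intro k hk hk0
    have hk0 : k = 0 := by simpa using hk0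
    exact hk (by simp [hk0, h0]))).2 hZ
  let i : {k : ℝ | k ≠ 0} → {k : ℂ // k ≠ 0} := fun k => ⟨(k : ℝ), by exact_mod_cast k.2⟩
  have hi : Function.Injective i := fun x y hxy =>
    Subtype.ext (Complex.ofReal_injective (congrArg Subtype.val hxy))
  refine (hi.hasSum_iff ?_).1 (h1.congr_fun fun k => ?_)
  · intro k hk
    by_cases him : (k : ℂ).im = 0
    · exfalso
      have hre : (((k : ℂ).re : ℝ) : ℂ) = k := Complex.ext rfl (by simp [him])
      refine hk ⟨⟨(k : ℂ).re, fun h => k.2 ?_⟩, Subtype.ext hre⟩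
      rw [← hre, h, Complex.ofReal_zero]
    · simp [hm' k him]
  · have hk : (k : ℝ) ≠ 0 := k.2
    simp only [Function.comp_apply, i, hm k hk, exp_neg_mul_branchLog ha0 ha2 ha hk]
    push_cast
    ring

theorem IsSpectralZeta.unique {E : Type*} [AddCommGroup E] [Module ℂ E] {A : E →ₗ.[ℂ] E} {a : ℝ}
    {ζ ξ : ℂ → ℂ} (h1 : IsSpectralZeta A a ζ) (h2 : IsSpectralZeta A a ξ) : ζ = ξ := by
  refine AnalyticOnNhd.eq_of_eventuallyEq (𝕜 := ℂ) (z₀ := 2)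
    (h1.1.differentiableOn.analyticOnNhd isOpen_univ)
    (h2.1.differentiableOn.analyticOnNhd isOpen_univ) ?_
  filter_upwards [(isOpen_Ioi.preimage Complex.continuous_re).mem_nhds
    (show (2 : ℂ) ∈ Complex.re ⁻¹' Ioi 1 by simp)] with s hs
  exact (h1.2 s hs).unique (h2.2 s hs)

/-- The zeta function of an operator whose eigenvalues are counted by `2 n`. -/
theorem exists_isSpectralZeta {E : Type*} [AddCommGroup E] [Module ℂ E] {A : E →ₗ.[ℂ] E}
    {n : ℝ → ℕ} {H : ℝ → ℝ} {α β γ : ℝ} (h : IsZeroCounting n H α β γ) (hn : ∀ k, n (-k) = n k)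
    (hm : ∀ k : ℝ, k ≠ 0 → Module.finrank ℂ (eigenspace A k) = 2 * n k)
    (hm' : ∀ k : ℂ, k.im ≠ 0 → Module.finrank ℂ (eigenspace A k) = 0)
    {a : ℝ} (ha0 : 0 < a) (ha2 : a < 2 * Real.pi) (ha : a ≠ Real.pi) :
    ∃ ζ : ℂ → ℂ, IsSpectralZeta A a ζ ∧
      deriv ζ 0 = γ + branchSign a * Real.pi * Complex.I * (β / 2) := by
  obtain ⟨M, hM, hMsum⟩ := h.exists_continuation
  set W := negFactor a with hW
  have hWd : Differentiable ℂ W := differentiable_negFactor a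
  -- The entire function `(1 + W s) / (s - 1)`, in which the pole at `1` has been cancelled.
  set e : ℂ → ℂ := dslope (fun s => 1 + W s) 1 with he
  have hed : Differentiable ℂ e := differentiable_dslope (hWd.const_add 1) 1
  have hes : ∀ s, (s - 1) * e s = 1 + W s := by
    intro s
    have := sub_smul_dslope (fun s => 1 + W s) 1 s
    rw [hW, negFactor_one, add_neg_cancel, sub_zero, smul_eq_mul] at this
    exact this
  -- The prefactor `s sin (π s / 2) / π` equals `s² * sinQuotient s`. Absorbing `s²` into the
  -- bracket clears the poles at `0`, and `e` absorbs the one at `1`.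
  set G : ℂ → ℂ := fun s => (1 + W s) * (s ^ 2 * M s - β + γ * s) + α * s ^ 2 * e s with hG
  set Zs : ℂ → ℂ := fun s => ∑' k : ℝ, (n k : ℂ) * ((|k| : ℝ) : ℂ) ^ (-s) with hZs
  -- The continued expression and the series are glued at `Re s = 2`. They agree on `1 < Re s < 2`,
  -- so the result is entire.
  set ζ : ℂ → ℂ := fun s => if s.re < 2 then sinQuotient s * G s else (1 + W s) * Zs s with hζ
  have hagree : ∀ s : ℂ, 1 < s.re → ζ s = (1 + W s) * Zs s := by
    intro s hs
    by_cases h2 : s.re < 2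
    · have e1 : Zs s = _ := (hMsum s hs h2).tsum_eq
      have hs0 : s ≠ 0 := by rintro rfl; simp at hs; linarith
      have hs1 : s - 1 ≠ 0 := by
        intro h; rw [sub_eq_zero.1 h] at hs; simp at hs
      have e2 : e s = (1 + W s) / (s - 1) := by
        rw [← hes s, mul_div_cancel_left₀ _ hs1]
      rw [hζ]
      simp only [h2, if_true]
      rw [e1, mul_div_assoc, ← mul_sinQuotient, hG]
      simp only [e2]
      field_simp
      ring
    · rw [hζ]
      simp only [h2, if_false]
  have hGd : ∀ s : ℂ, s.re < 2 → DifferentiableAt ℂ G s := by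
    intro s hs
    have h1 := hM s hs
    have h2 := hWd s
    have h3 := hed s
    rw [hG]
    fun_prop
  have hnear : ∀ s : ℂ, s.re < 2 → ζ =ᶠ[𝓝 s] fun s => sinQuotient s * G s := by
    intro s hs
    filter_upwards [(isOpen_Iio.preimage Complex.continuous_re).mem_nhds
      (show s ∈ Complex.re ⁻¹' Iio 2 from hs)] with w hw
    have hw : w.re < 2 := hw
    rw [hζ]
    simp only [hw, if_true]
  refine ⟨ζ, ⟨fun s => ?_, fun s hs => ?_⟩, ?_⟩
  · rcases lt_or_ge s.re 2 with hs | hs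
    · exact ((differentiable_sinQuotient s).mul (hGd s hs)).congr_of_eventuallyEq (hnear s hs)
    · have hs1 : 1 < s.re := by linarith
      refine (((hWd s).const_add 1).mul (h.differentiableAt_tsum hs1)).congr_of_eventuallyEq ?_
      filter_upwards [(isOpen_Ioi.preimage Complex.continuous_re).mem_nhds
        (show s ∈ Complex.re ⁻¹' Ioi 1 from hs1)] with w hw
      exact hagree w hw
  · rw [hagree s hs]
    exact hasSum_eigenvalues h.zero hm hm' ha0 ha2 ha
      (h.hasSum_weighted hn _ hs (h.summable_complex hs).hasSum)
  · rw [(hnear 0 (by simp)).deriv_eq]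
    -- `sinQuotient` is even, so near `0` only its value `1 / 2` matters and `ζ' 0 = G' 0 / 2`.
    have hq : HasDerivAt sinQuotient 0 0 := by
      have := (differentiable_sinQuotient 0).hasDerivAt
      rwa [deriv_eq_zero_of_even differentiable_sinQuotient sinQuotient_neg] at this
    have hW0 : W 0 = 1 := by simp [hW, negFactor]
    have hW' : HasDerivAt W (-(branchSign a * Real.pi * Complex.I)) 0 := by
      have h1 : HasDerivAt (fun s : ℂ => -s * ((branchSign a * Real.pi : ℝ) * Complex.I))
          (-1 * ((branchSign a * Real.pi : ℝ) * Complex.I)) 0 :=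
        (hasDerivAt_neg (0 : ℂ)).mul_const _
      refine h1.cexp.congr_deriv ?_
      simp
    have hG' : HasDerivAt G
        (-(branchSign a * Real.pi * Complex.I) * (-β) + 2 * γ) 0 := by
      have h1 : HasDerivAt (fun s : ℂ => s ^ 2) 0 0 := by
        simpa using hasDerivAt_pow 2 (0 : ℂ)
      have h2 : HasDerivAt (fun s : ℂ => s ^ 2 * M s - β + γ * s) γ 0 := by
        have := ((h1.mul (hM 0 (by simp)).hasDerivAt).sub_const (β : ℂ)).add
          ((hasDerivAt_id (0 : ℂ)).const_mul (γ : ℂ))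
        refine this.congr_deriv ?_
        simp
      have h3 := ((hW'.const_add 1).mul h2).add ((h1.const_mul (α : ℂ)).mul (hed 0).hasDerivAt)
      refine h3.congr_deriv ?_
      rw [hW0]
      ring
    refine (hq.mul hG').deriv.trans ?_
    rw [sinQuotient_zero]
    simp only [zero_mul, zero_add]
    ring

end DiracRose

end


/-! ### The secular function: real zeros, growth and asymptotics on the imaginary axis. -/

noncomputable section

namespace DiracRose

open Filter Topology Set Asymptotics

/-- The entire function `sin (ℓ z) / z`. -/
def sineQuot (ℓ : ℝ) : ℂ → ℂ := dslope (fun z => Complex.sin (ℓ * z)) 0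

theorem mul_sineQuot (ℓ : ℝ) (z : ℂ) : z * sineQuot ℓ z = Complex.sin (ℓ * z) := by
  have := sub_smul_dslope (fun z => Complex.sin (ℓ * z)) 0 z
  simpa [sineQuot] using this

theorem sineQuot_zero (ℓ : ℝ) : sineQuot ℓ 0 = ℓ := by
  rw [sineQuot, dslope_same]
  have h1 : HasDerivAt (fun s : ℂ => (ℓ : ℂ) * s) ℓ 0 := by
    simpa using ((hasDerivAt_id (0 : ℂ)).const_mul (ℓ : ℂ))
  rw [h1.csin.deriv]
  simp

theorem sineQuot_of_ne_zero (ℓ : ℝ) {z : ℂ} (hz : z ≠ 0) :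
    sineQuot ℓ z = Complex.sin (ℓ * z) / z := by
  rw [← mul_sineQuot, mul_div_cancel_left₀ _ hz]

theorem differentiable_sineQuot (ℓ : ℝ) : Differentiable ℂ (sineQuot ℓ) :=
  differentiable_dslope (by fun_prop) 0

theorem sineQuot_neg (ℓ : ℝ) (z : ℂ) : sineQuot ℓ (-z) = sineQuot ℓ z := by
  rcases eq_or_ne z 0 with rfl | hz
  · simp
  · rw [sineQuot_of_ne_zero _ hz, sineQuot_of_ne_zero _ (neg_ne_zero.2 hz), mul_neg,
      Complex.sin_neg, neg_div_neg_eq]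

variable {B : ℕ}

/-- The secular function of the rose, divided by its trivial zero at the origin. -/
def secular (L τ : Fin B → ℝ) (z : ℂ) : ℂ :=
  ∑ b, (Complex.cos (L b * z) - τ b) * ∏ c ∈ Finset.univ.erase b, sineQuot (L c) z

/-- The secular function of the rose. -/
def fullSecular (L τ : Fin B → ℝ) (z : ℂ) : ℂ :=
  ∑ b, (Complex.cos (L b * z) - τ b) * ∏ c ∈ Finset.univ.erase b, Complex.sin (L c * z)

/-- The secular function divided by the product of the sines. -/
def secularRatio (L τ : Fin B → ℝ) (z : ℂ) : ℂ :=
  ∑ b, (Complex.cos (L b * z) - τ b) / Complex.sin (L b * z)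

theorem differentiable_secular (L τ : Fin B → ℝ) : Differentiable ℂ (secular L τ) := by
  unfold secular
  have := differentiable_sineQuot
  fun_prop

theorem secular_neg (L τ : Fin B → ℝ) (z : ℂ) : secular L τ (-z) = secular L τ z := by
  simp only [secular, sineQuot_neg, mul_neg, Complex.cos_neg]

theorem secular_zero {L : Fin B → ℝ} (hL : ∀ b, 0 < L b) (τ : Fin B → ℝ) :
    secular L τ 0 = ((-(∑ b, (τ b - 1) / L b) * ∏ b, L b : ℝ) : ℂ) := by
  simp only [secular, sineQuot_zero, mul_zero, Complex.cos_zero, ← Finset.sum_neg_distrib,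
    Finset.sum_mul]
  push_cast
  refine Finset.sum_congr rfl fun b _ => ?_
  rw [← Finset.mul_prod_erase _ _ (Finset.mem_univ b)]
  have : (L b : ℂ) ≠ 0 := by exact_mod_cast (hL b).ne'
  field_simp
  ring

theorem fullSecular_eq (L τ : Fin B → ℝ) (z : ℂ) :
    fullSecular L τ z = z ^ (B - 1) * secular L τ z := by
  simp only [fullSecular, secular, ← mul_sineQuot, Finset.prod_mul_distrib, Finset.prod_const,
    Finset.mul_sum]
  refine Finset.sum_congr rfl fun b _ => ?_
  rw [Finset.card_erase_of_mem (Finset.mem_univ b), Finset.card_univ, Fintype.card_fin]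
  ring

theorem fullSecular_eq_prod_mul (L τ : Fin B → ℝ) {z : ℂ}
    (hz : ∀ b, Complex.sin (L b * z) ≠ 0) :
    fullSecular L τ z = (∏ b, Complex.sin (L b * z)) * secularRatio L τ z := by
  rw [fullSecular, secularRatio, Finset.mul_sum]
  refine Finset.sum_congr rfl fun b _ => ?_
  rw [← Finset.mul_prod_erase _ _ (Finset.mem_univ b)]
  have := hz b
  field_simp

theorem sin_ne_zero_of_im_ne_zero {w : ℂ} (hw : w.im ≠ 0) : Complex.sin w ≠ 0 := by
  rw [Complex.sin_ne_zero_iff]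
  rintro k rfl
  apply hw
  simp

/-- With `w = x + i y`, the imaginary part of `(cos w - τ)` times the conjugate of `sin w` is `-sinh
y (cosh y - τ cos x)`, and `cosh y > 1 ≥ τ cos x`. -/
theorem im_cos_sub_div_sin_neg {w : ℂ} (hw : 0 < w.im) {τ : ℝ} (hτ : |τ| ≤ 1) :
    ((Complex.cos w - τ) / Complex.sin w).im < 0 := by
  have hs := sin_ne_zero_of_im_ne_zero hw.ne'
  have hN : 0 < Complex.normSq (Complex.sin w) := Complex.normSq_pos.2 hs
  rw [Complex.div_im, ← sub_div]
  refine div_neg_of_neg_of_pos ?_ hN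
  rw [Complex.cos_eq w, Complex.sin_eq w]
  simp only [Complex.sub_im, Complex.sub_re, Complex.add_re, Complex.add_im, Complex.mul_re,
    Complex.mul_im, Complex.ofReal_im, Complex.ofReal_re, Complex.I_re, Complex.I_im,
    ← Complex.ofReal_cos, ← Complex.ofReal_sin, ← Complex.ofReal_cosh, ← Complex.ofReal_sinh]
  have h1 : 0 < Real.sinh w.im := Real.sinh_pos_iff.2 hw
  have h2 : 1 < Real.cosh w.im := Real.one_lt_cosh.2 hw.ne'
  have h3 : τ * Real.cos w.re ≤ 1 := by
    refine (le_abs_self _).trans ?_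
    rw [abs_mul]
    exact mul_le_one₀ hτ (abs_nonneg _) (Real.abs_cos_le_one _)
  have h4 := Real.sin_sq_add_cos_sq w.re
  have h5 : 0 < Real.sinh w.im * (Real.cosh w.im - τ * Real.cos w.re) :=
    mul_pos h1 (by linarith)
  linear_combination h5 - Real.sinh w.im * Real.cosh w.im * h4

theorem secularRatio_neg (L τ : Fin B → ℝ) (z : ℂ) :
    secularRatio L τ (-z) = -secularRatio L τ z := by
  simp only [secularRatio, mul_neg, Complex.cos_neg, Complex.sin_neg, div_neg,
    Finset.sum_neg_distrib]

/-- All summands have imaginary part of the same strict sign in the upper half-plane, so they cannot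
cancel. Oddness covers the lower half-plane. -/
theorem secularRatio_ne_zero [NeZero B] {L τ : Fin B → ℝ} (hL : ∀ b, 0 < L b) (hτ : ∀ b, |τ b| ≤ 1)
    {z : ℂ} (hz : z.im ≠ 0) : secularRatio L τ z ≠ 0 := by
  have key : ∀ w : ℂ, 0 < w.im → secularRatio L τ w ≠ 0 := by
    intro w hw h
    have h1 : (secularRatio L τ w).im < 0 := by
      rw [secularRatio, Complex.im_sum]
      refine Finset.sum_neg (fun b _ => im_cos_sub_div_sin_neg ?_ (hτ b)) Finset.univ_nonempty
      rw [Complex.im_ofReal_mul]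
      exact mul_pos (hL b) hw
    rw [h] at h1
    simp at h1
  rcases lt_or_gt_of_ne hz with h | h
  · have := key (-z) (by simpa using h)
    rwa [secularRatio_neg, neg_ne_zero] at this
  · exact key z h

theorem sin_ne_zero_bond {L : Fin B → ℝ} (hL : ∀ b, 0 < L b) {z : ℂ} (hz : z.im ≠ 0) (b : Fin B) :
    Complex.sin (L b * z) ≠ 0 :=
  sin_ne_zero_of_im_ne_zero (by simpa using ⟨(hL b).ne', hz⟩)

theorem im_eq_zero_of_secular_eq_zero [NeZero B] {L τ : Fin B → ℝ} (hL : ∀ b, 0 < L b)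
    (hτ : ∀ b, |τ b| ≤ 1) {z : ℂ} (h : secular L τ z = 0) : z.im = 0 := by
  by_contra hz
  have h1 := fullSecular_eq_prod_mul L τ (sin_ne_zero_bond hL hz)
  rw [fullSecular_eq, h, mul_zero] at h1
  exact mul_ne_zero (Finset.prod_ne_zero_iff.2 fun b _ => sin_ne_zero_bond hL hz b)
    (secularRatio_ne_zero hL hτ hz) h1.symm

theorem norm_cos_le (w : ℂ) : ‖Complex.cos w‖ ≤ Real.exp ‖w‖ := by
  rw [Complex.cos, norm_div, Complex.norm_ofNat]
  have h1 : ‖Complex.exp (w * Complex.I)‖ ≤ Real.exp ‖w‖ := by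
    simpa using Complex.norm_exp_le_exp_norm (w * Complex.I)
  have h2 : ‖Complex.exp (-w * Complex.I)‖ ≤ Real.exp ‖w‖ := by
    simpa using Complex.norm_exp_le_exp_norm (-w * Complex.I)
  have := norm_add_le (Complex.exp (w * Complex.I)) (Complex.exp (-w * Complex.I))
  rw [div_le_iff₀ two_pos]
  linarith

theorem norm_sin_le (w : ℂ) : ‖Complex.sin w‖ ≤ Real.exp ‖w‖ := by
  rw [Complex.sin, norm_div, norm_mul, Complex.norm_I, Complex.norm_ofNat, mul_one]
  have h1 : ‖Complex.exp (w * Complex.I)‖ ≤ Real.exp ‖w‖ := by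
    simpa using Complex.norm_exp_le_exp_norm (w * Complex.I)
  have h2 : ‖Complex.exp (-w * Complex.I)‖ ≤ Real.exp ‖w‖ := by
    simpa using Complex.norm_exp_le_exp_norm (-w * Complex.I)
  have := norm_sub_le (Complex.exp (-w * Complex.I)) (Complex.exp (w * Complex.I))
  rw [div_le_iff₀ two_pos]
  linarith

theorem norm_secular_le {L τ : Fin B → ℝ} (hL : ∀ b, 0 < L b) (hτ : ∀ b, |τ b| ≤ 1) {z : ℂ}
    (hz : 1 ≤ ‖z‖) : ‖secular L τ z‖ ≤ 2 * B * Real.exp ((∑ b, L b) * ‖z‖) := by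
  have hnorm : ∀ b, ‖(L b : ℂ) * z‖ = L b * ‖z‖ := fun b => by
    rw [norm_mul, Complex.norm_real, Real.norm_of_nonneg (hL b).le]
  have hz0 : z ≠ 0 := by rintro rfl; simp at hz; linarith
  have hterm : ∀ b ∈ Finset.univ, ‖(Complex.cos (L b * z) - τ b) *
      ∏ c ∈ Finset.univ.erase b, sineQuot (L c) z‖ ≤ 2 * Real.exp ((∑ b, L b) * ‖z‖) := by
    intro b _
    rw [norm_mul, norm_prod]
    have h1 : ‖Complex.cos (L b * z) - τ b‖ ≤ 2 * Real.exp (L b * ‖z‖) := by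
      have e1 := norm_sub_le (Complex.cos (L b * z)) (τ b : ℂ)
      have e2 := norm_cos_le (L b * z)
      rw [hnorm] at e2
      have e3 : ‖(τ b : ℂ)‖ ≤ 1 := by rw [Complex.norm_real]; exact hτ b
      have e4 : 1 ≤ Real.exp (L b * ‖z‖) :=
        Real.one_le_exp (mul_nonneg (hL b).le (norm_nonneg _))
      linarith
    have h2 : ∏ c ∈ Finset.univ.erase b, ‖sineQuot (L c) z‖ ≤
        ∏ c ∈ Finset.univ.erase b, Real.exp (L c * ‖z‖) := by
      refine Finset.prod_le_prod (fun _ _ => norm_nonneg _) fun c _ => ?_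
      rw [sineQuot_of_ne_zero _ hz0, norm_div, ← hnorm]
      exact (div_le_self (norm_nonneg _) hz).trans (norm_sin_le _)
    calc _ ≤ (2 * Real.exp (L b * ‖z‖)) * ∏ c ∈ Finset.univ.erase b, Real.exp (L c * ‖z‖) := by
          gcongr
      _ = 2 * Real.exp ((∑ b, L b) * ‖z‖) := by
          rw [mul_assoc, Finset.mul_prod_erase _ (fun b => Real.exp (L b * ‖z‖)) (Finset.mem_univ b),
            Finset.sum_mul, Real.exp_sum]
  refine (norm_sum_le_of_le _ hterm).trans_eq ?_
  rw [Finset.sum_const, Finset.card_univ, Fintype.card_fin, nsmul_eq_mul]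
  ring

/-! ### The imaginary axis -/

/-- The secular function on the imaginary axis. -/
theorem secular_mul_I {L : Fin B → ℝ} (hL : ∀ b, 0 < L b) (τ : Fin B → ℝ) {t : ℝ} (ht : 0 < t) :
    secular L τ (t * Complex.I) = (((∏ b, Real.sinh (L b * t) / t) *
      (t * ∑ b, (Real.cosh (L b * t) - τ b) / Real.sinh (L b * t)) : ℝ) : ℂ) := by
  have ht0 : (t : ℂ) ≠ 0 := by exact_mod_cast ht.ne'
  have hs : ∀ b, sineQuot (L b) (t * Complex.I) = ((Real.sinh (L b * t) / t : ℝ) : ℂ) := by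
    intro b
    rw [sineQuot_of_ne_zero _ (mul_ne_zero ht0 Complex.I_ne_zero), ← mul_assoc, Complex.sin_mul_I]
    push_cast
    field_simp [Complex.I_ne_zero]
  rw [secular, Finset.mul_sum, Finset.mul_sum]
  simp only [hs]
  rw [Complex.ofReal_sum]
  refine Finset.sum_congr rfl fun b _ => ?_
  rw [← mul_assoc, Complex.cos_mul_I, ← Finset.mul_prod_erase _ _ (Finset.mem_univ b)]
  have h1 : (Complex.sinh (L b * t) : ℂ) ≠ 0 := by
    have := (Real.sinh_pos_iff.2 (mul_pos (hL b) ht)).ne'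
    exact_mod_cast this
  push_cast
  field_simp

theorem ratio_pos {x τ : ℝ} (hx : 0 < x) (hτ : |τ| ≤ 1) : 0 < (Real.cosh x - τ) / Real.sinh x :=
  div_pos (by linarith [Real.one_lt_cosh.2 hx.ne', le_abs_self τ]) (Real.sinh_pos_iff.2 hx)

theorem log_one_add_isBigO {ℓ : ℝ} (hℓ : 0 < ℓ) {u : ℝ → ℝ}
    (hu : u =O[atTop] fun t => Real.exp (-ℓ * t)) :
    (fun t => Real.log (1 + u t)) =O[atTop] fun t => Real.exp (-ℓ * t) := by
  have h0 : Tendsto u atTop (𝓝 0) := by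
    refine hu.trans_tendsto (Real.tendsto_exp_atBot.comp ?_)
    exact tendsto_id.const_mul_atTop_of_neg (by linarith)
  have h1 : Tendsto (fun t => 1 + u t) atTop (𝓝 1) := by simpa using h0.const_add 1
  have h2 := ((Real.hasDerivAt_log one_ne_zero).isBigO_sub).comp_tendsto h1
  refine (h2.congr_left fun t => ?_).trans (hu.congr_left fun t => ?_)
  · simp
  · simp

theorem exp_neg_isBigO_rpow {ℓ : ℝ} (hℓ : 0 < ℓ) (N : ℝ) :
    (fun t : ℝ => Real.exp (-ℓ * t)) =O[atTop] fun t => t ^ (-N) :=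
  (isLittleO_exp_neg_mul_rpow_atTop hℓ _).isBigO

theorem log_sinh_isBigO {ℓ : ℝ} (hℓ : 0 < ℓ) (N : ℝ) :
    (fun t => Real.log (Real.sinh (ℓ * t)) - ℓ * t + Real.log 2) =O[atTop] fun t => t ^ (-N) := by
  have h1 : (fun t : ℝ => -Real.exp (-(2 * ℓ) * t)) =O[atTop] fun t => Real.exp (-(2 * ℓ) * t) :=
    (isBigO_refl _ _).neg_left
  refine ((log_one_add_isBigO (by linarith) h1).trans
    (exp_neg_isBigO_rpow (by linarith) N)).congr' ?_ EventuallyEq.rfl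
  filter_upwards [eventually_gt_atTop 0] with t ht
  have hs := Real.sinh_pos_iff.2 (mul_pos hℓ ht)
  -- `sinh x = exp x (1 - exp (-2 x)) / 2`, so the error is the logarithm of `1 - exp (-2 ℓ t)`.
  have h2 : 1 + -Real.exp (-(2 * ℓ) * t) =
      Real.sinh (ℓ * t) * Real.exp (-(ℓ * t)) * 2 := by
    rw [Real.sinh_eq, show -(2 * ℓ) * t = -(ℓ * t) + -(ℓ * t) by ring, Real.exp_add]
    have : Real.exp (ℓ * t) * Real.exp (-(ℓ * t)) = 1 := by rw [← Real.exp_add]; simp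
    linear_combination -this
  rw [h2, Real.log_mul (by positivity) (by norm_num), Real.log_mul hs.ne' (Real.exp_ne_zero _),
    Real.log_exp]
  ring

theorem ratio_sub_one_isBigO {ℓ τ : ℝ} (hℓ : 0 < ℓ) (hτ : |τ| ≤ 1) :
    (fun t => (Real.cosh (ℓ * t) - τ) / Real.sinh (ℓ * t) - 1) =O[atTop]
      fun t => Real.exp (-ℓ * t) := by
  -- The difference is `(exp (-x) - τ) / sinh x` with `x = ℓ t`. For `x ≥ 1` the numerator is at
  -- most `2` and `sinh x ≥ exp x / 4`, whence the constant `8`.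
  refine IsBigO.of_bound 8 ?_
  filter_upwards [eventually_ge_atTop ℓ⁻¹] with t ht
  set x := ℓ * t with hx
  have hx1 : 1 ≤ x := by
    rw [hx, ← mul_inv_cancel₀ hℓ.ne']
    gcongr
  have hexp : 0 < Real.exp x := Real.exp_pos _
  have he1 : Real.exp (-x) ≤ 1 := Real.exp_le_one_iff.2 (by linarith)
  have he2 : 2 ≤ Real.exp x := by linarith [Real.add_one_le_exp x]
  have hsinh : Real.exp x / 4 ≤ Real.sinh x := by
    rw [Real.sinh_eq]
    linarith
  have hs0 : 0 < Real.sinh x := by linarith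
  have h1 : (Real.cosh x - τ) / Real.sinh x - 1 = (Real.exp (-x) - τ) / Real.sinh x := by
    rw [← Real.cosh_sub_sinh]
    field_simp
    ring
  rw [h1, Real.norm_eq_abs, abs_div, abs_of_pos hs0, Real.norm_of_nonneg (Real.exp_pos _).le,
    show -ℓ * t = -x by rw [hx]; ring, div_le_iff₀ hs0]
  have h2 : |Real.exp (-x) - τ| ≤ 2 := by
    have := abs_sub (Real.exp (-x)) τ
    rw [abs_of_pos (Real.exp_pos _)] at this
    linarith
  have h3 : Real.exp (-x) * Real.exp x = 1 := by rw [← Real.exp_add]; simp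
  calc |Real.exp (-x) - τ| ≤ 8 * (Real.exp (-x) * Real.exp x) / 4 := by rw [h3]; linarith
    _ = 8 * Real.exp (-x) * (Real.exp x / 4) := by ring
    _ ≤ _ := by gcongr

theorem log_sum_ratio_isBigO [NeZero B] {L τ : Fin B → ℝ} (hL : ∀ b, 0 < L b)
    (hτ : ∀ b, |τ b| ≤ 1) (N : ℝ) :
    (fun t => Real.log (∑ b, (Real.cosh (L b * t) - τ b) / Real.sinh (L b * t)) - Real.log B)
      =O[atTop] fun t => t ^ (-N) := by
  have hB : (B : ℝ) ≠ 0 := Nat.cast_ne_zero.2 (NeZero.ne B)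
  -- Each of the `B` ratios tends to `1`, which produces `log B`. The shortest bond has the slowest
  -- decay and bounds all the errors.
  obtain ⟨b₀, -, hb₀⟩ := Finset.exists_min_image Finset.univ L Finset.univ_nonempty
  have hu : (fun t => (B : ℝ)⁻¹ * ∑ b, ((Real.cosh (L b * t) - τ b) / Real.sinh (L b * t) - 1))
      =O[atTop] fun t => Real.exp (-(L b₀) * t) := by
    refine IsBigO.const_mul_left (IsBigO.fun_sum fun b _ => ?_) _
    refine (ratio_sub_one_isBigO (hL b) (hτ b)).trans (IsBigO.of_bound 1 ?_)
    filter_upwards [eventually_ge_atTop 0] with t ht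
    rw [one_mul, Real.norm_of_nonneg (Real.exp_pos _).le, Real.norm_of_nonneg (Real.exp_pos _).le]
    refine Real.exp_le_exp.2 ?_
    nlinarith [hb₀ b (Finset.mem_univ b)]
  refine ((log_one_add_isBigO (hL b₀) hu).trans (exp_neg_isBigO_rpow (hL b₀) N)).congr' ?_
    EventuallyEq.rfl
  filter_upwards [eventually_gt_atTop 0] with t ht
  have hpos : 0 < ∑ b, (Real.cosh (L b * t) - τ b) / Real.sinh (L b * t) :=
    Finset.sum_pos (fun b _ => ratio_pos (mul_pos (hL b) ht) (hτ b)) Finset.univ_nonempty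
  rw [← Real.log_div hpos.ne' hB, Finset.sum_sub_distrib]
  congr 1
  rw [Finset.sum_const, Finset.card_univ, Fintype.card_fin, nsmul_eq_mul, mul_one]
  generalize ∑ b, (Real.cosh (L b * t) - τ b) / Real.sinh (L b * t) = S
  field_simp
  ring

/-- The asymptotics of the secular function on the imaginary axis. -/
theorem log_secular_isBigO [NeZero B] {L τ : Fin B → ℝ} (hL : ∀ b, 0 < L b)
    (hτ : ∀ b, |τ b| ≤ 1) (h0 : secular L τ 0 ≠ 0) (N : ℝ) :
    (fun t : ℝ => 2 * Real.log (‖secular L τ (t * Complex.I)‖ / ‖secular L τ 0‖) -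
      ((2 * ∑ b, L b) * t - (2 * (B - 1)) * Real.log t +
        2 * (Real.log B - B * Real.log 2 - Real.log ‖secular L τ 0‖))) =O[atTop]
      fun t => t ^ (-N) := by
  have h1 := ((IsBigO.fun_sum (s := Finset.univ) fun b _ => log_sinh_isBigO (hL b) N).add
    (log_sum_ratio_isBigO hL hτ N)).const_mul_left 2
  refine h1.congr' ?_ EventuallyEq.rfl
  filter_upwards [eventually_gt_atTop 0] with t ht
  have hpos : 0 < ∑ b, (Real.cosh (L b * t) - τ b) / Real.sinh (L b * t) :=
    Finset.sum_pos (fun b _ => ratio_pos (mul_pos (hL b) ht) (hτ b)) Finset.univ_nonempty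
  have hsinh : ∀ b, 0 < Real.sinh (L b * t) := fun b => Real.sinh_pos_iff.2 (mul_pos (hL b) ht)
  have hprod : 0 < ∏ b, Real.sinh (L b * t) / t :=
    Finset.prod_pos fun b _ => div_pos (hsinh b) ht
  rw [secular_mul_I hL τ ht, Complex.norm_real, Real.norm_of_nonneg (by positivity),
    Real.log_div (by positivity) (norm_ne_zero_iff.2 h0), Real.log_mul hprod.ne' (by positivity),
    Real.log_mul ht.ne' hpos.ne', Real.log_prod (fun b _ => (div_pos (hsinh b) ht).ne')]
  simp_rw [Real.log_div (hsinh _).ne' ht.ne']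
  simp only [Finset.sum_add_distrib, Finset.sum_sub_distrib, Finset.sum_const, Finset.card_univ,
    Fintype.card_fin, nsmul_eq_mul, ← Finset.sum_mul]
  ring

end DiracRose

end


/-! ### Orders of vanishing of the secular function at nonzero real points. -/

noncomputable section

namespace DiracRose

open Filter Topology

variable {B : ℕ}

open Classical in
/-- The bonds on which `sin (k x)` vanishes at both ends. -/
def nodalBonds (L : Fin B → ℝ) (k : ℂ) : Finset (Fin B) :=
  Finset.univ.filter fun b => Complex.sin (L b * k) = 0

theorem mem_nodalBonds {L : Fin B → ℝ} {k : ℂ} {b : Fin B} :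
    b ∈ nodalBonds L k ↔ Complex.sin (L b * k) = 0 := by
  simp [nodalBonds]

theorem cos_sq_of_mem_nodalBonds {L : Fin B → ℝ} {k : ℂ} {b : Fin B} (hb : b ∈ nodalBonds L k) :
    Complex.cos (L b * k) ^ 2 = 1 := by
  have := Complex.sin_sq_add_cos_sq (L b * k)
  rw [mem_nodalBonds.1 hb] at this
  simpa using this

theorem cos_ne_zero_of_mem_nodalBonds {L : Fin B → ℝ} {k : ℂ} {b : Fin B}
    (hb : b ∈ nodalBonds L k) : Complex.cos (L b * k) ≠ 0 := by
  intro h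
  have := cos_sq_of_mem_nodalBonds hb
  rw [h] at this
  norm_num at this

theorem analyticAt_of_differentiable {f : ℂ → ℂ} (hf : Differentiable ℂ f) (k : ℂ) :
    AnalyticAt ℂ f k := hf.analyticAt k

theorem hasDerivAt_sin_mul (ℓ k : ℂ) :
    HasDerivAt (fun z => Complex.sin (ℓ * z)) (ℓ * Complex.cos (ℓ * k)) k := by
  have h1 : HasDerivAt (fun s : ℂ => ℓ * s) ℓ k := by
    simpa using ((hasDerivAt_id k).const_mul ℓ)
  exact h1.csin.congr_deriv (mul_comm _ _)

theorem hasDerivAt_cos_mul (ℓ k : ℂ) :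
    HasDerivAt (fun z => Complex.cos (ℓ * z)) (-(ℓ * Complex.sin (ℓ * k))) k := by
  have h1 : HasDerivAt (fun s : ℂ => ℓ * s) ℓ k := by
    simpa using ((hasDerivAt_id k).const_mul ℓ)
  exact h1.ccos.congr_deriv (by ring)

theorem analyticOrderAt_prod_sin {L : Fin B → ℝ} (hL : ∀ b, 0 < L b) (k : ℂ) :
    analyticOrderAt (fun z => ∏ b, Complex.sin (L b * z)) k = (nodalBonds L k).card := by
  classical
  have key : ∀ T : Finset (Fin B), analyticOrderAt (fun z => ∏ b ∈ T, Complex.sin (L b * z)) k =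
      ((T.filter fun b => b ∈ nodalBonds L k).card : ℕ∞) := by
    intro T
    induction T using Finset.induction_on with
    | empty =>
      simp only [Finset.prod_empty, Finset.filter_empty, Finset.card_empty, Nat.cast_zero]
      exact (analyticAt_const).analyticOrderAt_eq_zero.2 one_ne_zero
    | insert b T hb ih =>
      have h1 : (fun z => ∏ b ∈ insert b T, Complex.sin (L b * z)) =
          (fun z => Complex.sin (L b * z)) * fun z => ∏ b ∈ T, Complex.sin (L b * z) := by
        ext z; simp [Finset.prod_insert hb]
      have ha : AnalyticAt ℂ (fun z => Complex.sin (L b * z)) k :=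
        analyticAt_of_differentiable (by fun_prop) k
      rw [h1, analyticOrderAt_mul ha
        (analyticAt_of_differentiable (by fun_prop) k), ih, Finset.filter_insert]
      split_ifs with hbk
      · rw [Finset.card_insert_of_notMem (fun h => hb (Finset.mem_filter.1 h).1),
          AnalyticAt.analyticOrderAt_eq_one_of_zero_deriv_ne_zero ha (mem_nodalBonds.1 hbk)]
        · push_cast; ring
        · rw [(hasDerivAt_sin_mul _ _).deriv]
          exact mul_ne_zero (by exact_mod_cast (hL b).ne') (cos_ne_zero_of_mem_nodalBonds hbk)
      · rw [ha.analyticOrderAt_eq_zero.2 (fun h => hbk (mem_nodalBonds.2 h)), zero_add]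
  rw [key]
  simp

/-- Away from the origin the factor `z ^ (B - 1)` does not vanish. The order can thus be computed on
`fullSecular`, which is a product of sines times a sum of ratios. -/
theorem analyticOrderAt_fullSecular (L τ : Fin B → ℝ) {k : ℂ} (hk : k ≠ 0) :
    analyticOrderAt (fullSecular L τ) k = analyticOrderAt (secular L τ) k := by
  have h1 : fullSecular L τ = (fun z => z ^ (B - 1)) * secular L τ :=
    funext fun z => fullSecular_eq L τ z
  have ha : AnalyticAt ℂ (fun z : ℂ => z ^ (B - 1)) k := analyticAt_of_differentiable (by fun_prop) k
  rw [h1, analyticOrderAt_mul ha ((differentiable_secular L τ).analyticAt k),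
    ha.analyticOrderAt_eq_zero.2 (pow_ne_zero _ hk), zero_add]

theorem analyticAt_fullSecular (L τ : Fin B → ℝ) (k : ℂ) : AnalyticAt ℂ (fullSecular L τ) k := by
  refine analyticAt_of_differentiable ?_ k
  unfold fullSecular
  fun_prop

/-- The secular function near a point, from its factorization on each bond. -/
theorem fullSecular_eventuallyEq {L τ : Fin B → ℝ} {k : ℂ} {φ : Fin B → ℂ → ℂ} {p : ℂ → ℂ}
    (h : ∀ b, ∀ᶠ z in 𝓝 k, p z * ((Complex.cos (L b * z) - τ b) *
      ∏ c ∈ Finset.univ.erase b, Complex.sin (L c * z)) =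
        (∏ c, Complex.sin (L c * z)) * φ b z) :
    p * fullSecular L τ =ᶠ[𝓝 k] (fun z => ∏ b, Complex.sin (L b * z)) * fun z => ∑ b, φ b z := by
  filter_upwards [eventually_all.2 h] with z hz
  simp only [Pi.mul_apply, fullSecular, Finset.mul_sum]
  exact Finset.sum_congr rfl fun b _ => hz b

theorem ofReal_cos_mul (ℓ x : ℝ) : Complex.cos (ℓ * x) = ((Real.cos (ℓ * x) : ℝ) : ℂ) := by
  push_cast; rfl

theorem ofReal_sin_mul (ℓ x : ℝ) : Complex.sin (ℓ * x) = ((Real.sin (ℓ * x) : ℝ) : ℂ) := by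
  push_cast; rfl

theorem mul_lt_one_of_ne {c τ : ℝ} (hc : c ^ 2 = 1) (hτ : |τ| ≤ 1) (hne : τ ≠ c) : c * τ < 1 := by
  obtain ⟨h1, h2⟩ := abs_le.1 hτ
  have h3 : (c - 1) * (c + 1) = 0 := by linear_combination hc
  rcases mul_eq_zero.1 h3 with h | h
  · obtain rfl : c = 1 := by linarith
    linarith [lt_of_le_of_ne h2 hne]
  · obtain rfl : c = -1 := by linarith
    linarith [lt_of_le_of_ne h1 hne.symm]

/-- The order of the secular function at a point where some nodal bond is not resonant. -/
theorem analyticOrderNatAt_secular_add_one {L τ : Fin B → ℝ} (hL : ∀ b, 0 < L b)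
    (hτ : ∀ b, |τ b| ≤ 1) {x : ℝ} (hx : x ≠ 0)
    (hex : ∃ b ∈ nodalBonds L x, (τ b : ℂ) ≠ Complex.cos (L b * x)) :
    analyticOrderNatAt (secular L τ) x + 1 = (nodalBonds L x).card := by
  classical
  set k : ℂ := (x : ℂ) with hk
  have hk0 : k ≠ 0 := by rw [hk]; exact_mod_cast hx
  set D : Fin B → ℂ → ℂ := fun b => dslope (fun z => Complex.sin (L b * z)) k with hD
  have hDd : ∀ b, Differentiable ℂ (D b) := fun b => differentiable_dslope (by fun_prop) k
  have hDk : ∀ b, D b k = L b * Complex.cos (L b * k) := fun b => by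
    rw [hD]; simp only [dslope_same]; exact (hasDerivAt_sin_mul _ _).deriv
  have hDz : ∀ b ∈ nodalBonds L k, ∀ z, Complex.sin (L b * z) = (z - k) * D b z := fun b hb z => by
    have := sub_smul_dslope (fun z => Complex.sin (L b * z)) k z
    rw [mem_nodalBonds.1 hb, sub_zero, smul_eq_mul] at this
    exact this.symm
  have hDk0 : ∀ b ∈ nodalBonds L k, D b k ≠ 0 := fun b hb => by
    rw [hDk]
    exact mul_ne_zero (by exact_mod_cast (hL b).ne') (cos_ne_zero_of_mem_nodalBonds hb)
  -- `φ b` is `(z - k) (cos (L b z) - τ b) / sin (L b z)` with the singularity removed. Its value at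
  -- `k` is the residue of the ratio on bond `b`.
  set φ : Fin B → ℂ → ℂ := fun b z => if b ∈ nodalBonds L k then (Complex.cos (L b * z) - τ b) / D b z
    else (z - k) * (Complex.cos (L b * z) - τ b) / Complex.sin (L b * z) with hφ
  have hφa : ∀ b, AnalyticAt ℂ (φ b) k := by
    intro b
    by_cases hb : b ∈ nodalBonds L k
    · simp only [hφ, hb, if_true]
      exact (analyticAt_of_differentiable (by fun_prop) k).div
        (analyticAt_of_differentiable (hDd b) k) (hDk0 b hb)
    · simp only [hφ, hb, if_false]
      exact (analyticAt_of_differentiable (by fun_prop) k).div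
        (analyticAt_of_differentiable (by fun_prop) k) (fun h => hb (mem_nodalBonds.2 h))
  have hev := fullSecular_eventuallyEq (L := L) (τ := τ) (k := k) (φ := φ) (p := fun z => z - k) (by
    intro b
    by_cases hb : b ∈ nodalBonds L k
    · filter_upwards [(hDd b).continuous.continuousAt.eventually_ne (hDk0 b hb)] with z hz
      simp only [hφ, hb, if_true]
      rw [← Finset.mul_prod_erase _ _ (Finset.mem_univ b), hDz b hb z]
      field_simp
    · have hc : ContinuousAt (fun z => Complex.sin (L b * z)) k := by fun_prop
      filter_upwards [hc.eventually_ne (fun h => hb (mem_nodalBonds.2 h))] with z hz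
      simp only [hφ, hb, if_false]
      rw [← Finset.mul_prod_erase _ _ (Finset.mem_univ b)]
      generalize Complex.sin (L b * z) = S at hz ⊢
      generalize ∏ c ∈ Finset.univ.erase b, Complex.sin (L c * z) = P
      field_simp)
  have hsum : AnalyticAt ℂ (fun z => ∑ b, φ b z) k :=
    Finset.analyticAt_fun_sum _ fun b _ => hφa b
  -- On a nodal bond `cos² = 1`, so the residue is `(1 - cos (L b x) τ b) / L b ≥ 0`, strictly
  -- positive when `τ b` differs from the cosine. Residues cannot cancel, and the sum of ratios has
  -- a genuine simple pole, which lowers the order by one.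
  have hval : ∑ b, φ b k ≠ 0 := by
    have h1 : ∑ b, φ b k = ((∑ b, if b ∈ nodalBonds L k then
        (1 - Real.cos (L b * x) * τ b) / L b else 0 : ℝ) : ℂ) := by
      rw [Complex.ofReal_sum]
      refine Finset.sum_congr rfl fun b _ => ?_
      by_cases hb : b ∈ nodalBonds L k
      · simp only [hφ, hb, if_true]
        have h2 := cos_sq_of_mem_nodalBonds hb
        have h3 := cos_ne_zero_of_mem_nodalBonds hb
        have h4 : (L b : ℂ) ≠ 0 := by exact_mod_cast (hL b).ne'
        rw [hDk]
        rw [hk, ofReal_cos_mul] at h2 h3 ⊢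
        push_cast at h2 h3 ⊢
        field_simp
        linear_combination (τ b : ℂ) * h2
      · simp [hφ, hb]
    rw [h1]
    have hcos : ∀ b ∈ nodalBonds L k, Real.cos (L b * x) ^ 2 = 1 := fun b hb => by
      have h2 := cos_sq_of_mem_nodalBonds hb
      rw [hk, ofReal_cos_mul] at h2
      exact_mod_cast h2
    obtain ⟨b₀, hb₀, hne⟩ := hex
    have hne' : τ b₀ ≠ Real.cos (L b₀ * x) := fun h => hne (by rw [h, hk, ofReal_cos_mul])
    refine Complex.ofReal_ne_zero.2 (Finset.sum_pos' (fun b _ => ?_) ⟨b₀, Finset.mem_univ _, ?_⟩).ne'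
    · split_ifs with hb
      · refine div_nonneg ?_ (hL b).le
        by_cases h : τ b = Real.cos (L b * x)
        · rw [h, ← sq, hcos b hb, sub_self]
        · linarith [mul_lt_one_of_ne (hcos b hb) (hτ b) h]
      · exact le_rfl
    · rw [if_pos hb₀]
      exact div_pos (by linarith [mul_lt_one_of_ne (hcos b₀ hb₀) (hτ b₀) hne']) (hL b₀)
  have ho := analyticOrderAt_congr hev
  rw [analyticOrderAt_mul (analyticAt_of_differentiable (by fun_prop) k)
    (analyticAt_fullSecular L τ k), analyticOrderAt_mul
    (analyticAt_of_differentiable (by fun_prop) k) hsum, analyticOrderAt_prod_sin hL,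
    hsum.analyticOrderAt_eq_zero.2 hval, analyticOrderAt_id_sub_const_self, add_zero,
    analyticOrderAt_fullSecular L τ hk0] at ho
  have hne : analyticOrderAt (secular L τ) k ≠ ⊤ := by
    intro h
    rw [h, add_top] at ho
    exact ENat.natCast_ne_top _ ho.symm
  rw [← Nat.cast_analyticOrderNatAt hne] at ho
  have : 1 + analyticOrderNatAt (secular L τ) k = (nodalBonds L k).card := by exact_mod_cast ho
  omega

/-- The order of the secular function at a point where all nodal bonds are resonant. -/
theorem analyticOrderNatAt_secular_of_resonant [NeZero B] {L τ : Fin B → ℝ} (hL : ∀ b, 0 < L b)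
    (hτ : ∀ b, |τ b| ≤ 1) {x : ℝ} (hx : x ≠ 0)
    (hall : ∀ b ∈ nodalBonds L x, (τ b : ℂ) = Complex.cos (L b * x)) :
    analyticOrderNatAt (secular L τ) x =
      (nodalBonds L x).card + if secularRatio L τ x = 0 then 1 else 0 := by
  classical
  set k : ℂ := (x : ℂ) with hk
  have hk0 : k ≠ 0 := by rw [hk]; exact_mod_cast hx
  -- When `τ b = cos (L b k)` and `sin (L b k) = 0`, the half-angle formulas give `(cos (L b z) - τ
  -- b) / sin (L b z) = -tan (L b (z - k) / 2)`, so the singularity is removable.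
  set φ : Fin B → ℂ → ℂ := fun b z => if b ∈ nodalBonds L k then
    -(Complex.sin ((L b / 2) * (z - k)) / Complex.cos ((L b / 2) * (z - k)))
    else (Complex.cos (L b * z) - τ b) / Complex.sin (L b * z) with hφ
  have hφa : ∀ b, AnalyticAt ℂ (φ b) k := by
    intro b
    by_cases hb : b ∈ nodalBonds L k
    · simp only [hφ, hb, if_true]
      exact ((analyticAt_of_differentiable (by fun_prop) k).div
        (analyticAt_of_differentiable (by fun_prop) k) (by simp)).neg
    · simp only [hφ, hb, if_false]
      exact (analyticAt_of_differentiable (by fun_prop) k).div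
        (analyticAt_of_differentiable (by fun_prop) k) (fun h => hb (mem_nodalBonds.2 h))
  have hev := fullSecular_eventuallyEq (L := L) (τ := τ) (k := k) (φ := φ) (p := 1) (by
    intro b
    by_cases hb : b ∈ nodalBonds L k
    · have hc : ContinuousAt (fun z => Complex.cos ((L b / 2) * (z - k))) k := by fun_prop
      filter_upwards [hc.eventually_ne (by simp : Complex.cos ((L b / 2) * (k - k)) ≠ 0)] with z hz
      simp only [hφ, hb, if_true]
      rw [← Finset.mul_prod_erase _ _ (Finset.mem_univ b), hall b hb, Pi.one_apply, one_mul]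
      have e1 : (L b : ℂ) * z = L b * k + 2 * ((L b / 2) * (z - k)) := by ring
      have e2 := mem_nodalBonds.1 hb
      rw [e1, Complex.cos_add, Complex.sin_add, e2, Complex.sin_two_mul, Complex.cos_two_mul']
      have e3 := Complex.sin_sq_add_cos_sq ((L b / 2) * (z - k))
      generalize Complex.sin ((L b / 2) * (z - k)) = S at e3 ⊢
      generalize Complex.cos ((L b / 2) * (z - k)) = C at e3 hz ⊢
      generalize ∏ c ∈ Finset.univ.erase b, Complex.sin (L c * z) = P
      field_simp
      linear_combination (P * Complex.cos (L b * k) * C) * e3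
    · have hc : ContinuousAt (fun z => Complex.sin (L b * z)) k := by fun_prop
      filter_upwards [hc.eventually_ne (fun h => hb (mem_nodalBonds.2 h))] with z hz
      simp only [hφ, hb, if_false]
      rw [← Finset.mul_prod_erase _ _ (Finset.mem_univ b), Pi.one_apply, one_mul]
      generalize Complex.sin (L b * z) = S at hz ⊢
      generalize ∏ c ∈ Finset.univ.erase b, Complex.sin (L c * z) = P
      field_simp)
  have hsum : AnalyticAt ℂ (fun z => ∑ b, φ b z) k :=
    Finset.analyticAt_fun_sum _ fun b _ => hφa b
  -- The convention `x / 0 = 0` makes the nodal terms of `secularRatio` vanish at `k`, in accordance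
  -- with the zero of the tangent there.
  have hval : ∑ b, φ b k = secularRatio L τ k := by
    rw [secularRatio]
    refine Finset.sum_congr rfl fun b _ => ?_
    by_cases hb : b ∈ nodalBonds L k
    · simp [hφ, hb, mem_nodalBonds.1 hb]
    · simp [hφ, hb]
  -- Every bond contributes a strictly negative real derivative, so the sum of ratios has at most a
  -- simple zero at `k`.
  have hderiv : deriv (fun z => ∑ b, φ b z) k ≠ 0 := by
    set d : Fin B → ℝ := fun b => if b ∈ nodalBonds L k then -(L b / 2)
      else -(L b * (1 - Real.cos (L b * x) * τ b) / Real.sin (L b * x) ^ 2) with hd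
    have h1 : ∀ b ∈ Finset.univ, HasDerivAt (φ b) (d b : ℂ) k := by
      intro b _
      by_cases hb : b ∈ nodalBonds L k
      · simp only [hφ, hd, hb, if_true]
        have u1 : HasDerivAt (fun z : ℂ => (L b / 2 : ℂ) * (z - k)) (L b / 2) k := by
          simpa using ((hasDerivAt_id k).sub_const k).const_mul (L b / 2 : ℂ)
        refine (u1.csin.div u1.ccos (by simp)).neg.congr_deriv ?_
        simp
      · simp only [hφ, hd, hb, if_false]
        have hs : Complex.sin (L b * k) ≠ 0 := fun h => hb (mem_nodalBonds.2 h)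
        refine (((hasDerivAt_cos_mul _ _).sub_const (τ b : ℂ)).div
          (hasDerivAt_sin_mul _ _) hs).congr_deriv ?_
        have e3 := Complex.sin_sq_add_cos_sq (L b * k)
        push_cast
        rw [← hk, ← neg_div]
        congr 1
        linear_combination (-(L b : ℂ)) * e3
    have h2 := (HasDerivAt.fun_sum h1).deriv
    rw [h2, ← Complex.ofReal_sum]
    refine Complex.ofReal_ne_zero.2 (Finset.sum_neg (fun b _ => ?_) Finset.univ_nonempty).ne
    by_cases hb : b ∈ nodalBonds L k
    · simp only [hd, hb, if_true]
      linarith [hL b]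
    · simp only [hd, hb, if_false]
      have hs : Real.sin (L b * x) ≠ 0 := fun h => hb (mem_nodalBonds.2 (by
        rw [hk, ofReal_sin_mul, h, Complex.ofReal_zero]))
      have hs2 : 0 < Real.sin (L b * x) ^ 2 := by positivity
      have h3 : Real.cos (L b * x) * τ b < 1 := by
        refine (le_abs_self _).trans_lt ?_
        rw [abs_mul]
        have h4 : |Real.cos (L b * x)| < 1 := by
          rw [← sq_lt_one_iff_abs_lt_one]
          linarith [Real.sin_sq_add_cos_sq (L b * x)]
        exact (mul_le_of_le_one_right (abs_nonneg _) (hτ b)).trans_lt h4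
      have := hL b
      exact neg_neg_of_pos (div_pos (mul_pos (hL b) (by linarith)) hs2)
  have ho := analyticOrderAt_congr hev
  rw [one_mul, analyticOrderAt_mul (analyticAt_of_differentiable (by fun_prop) k) hsum,
    analyticOrderAt_prod_sin hL, analyticOrderAt_fullSecular L τ hk0] at ho
  rw [analyticOrderNatAt, ho]
  split_ifs with h0
  · rw [AnalyticAt.analyticOrderAt_eq_one_of_zero_deriv_ne_zero hsum (hval.trans h0) hderiv]
    norm_cast
  · rw [hsum.analyticOrderAt_eq_zero.2 (by rwa [hval])]
    norm_cast

end DiracRose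

end


/-! ### Eigenfunctions on the bonds, and reduction to amplitudes at the vertex. -/

noncomputable section

namespace DiracRose

open Filter Topology

theorem negIAlpha_apply (p : Spinor) : negIAlpha p = !₂[-p 3, p 2, -p 1, p 0] := by
  have h : (negIAlpha p).ofLp = (-Complex.I • alphaMatrix).mulVec p.ofLp :=
    Matrix.ofLp_toEuclideanCLM _ _
  ext i
  rw [h]
  fin_cases i <;>
    simp [alphaMatrix, Matrix.mulVec, dotProduct, Fin.sum_univ_four]

theorem negIAlpha_negIAlpha (p : Spinor) : negIAlpha (negIAlpha p) = -p := by
  simp only [negIAlpha_apply]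
  ext i
  fin_cases i <;> simp

/-- Together with `wPart_negIAlpha`: `-i α` rotates the pair `(v, w)` by a quarter turn, so `flow k
x` rotates it by the angle `k x`. -/
theorem vPart_negIAlpha (p : Spinor) : vPart (negIAlpha p) = wPart p := by
  rw [negIAlpha_apply]
  ext i
  fin_cases i <;> simp [vPart, wPart]

theorem wPart_negIAlpha (p : Spinor) : wPart (negIAlpha p) = -vPart p := by
  rw [negIAlpha_apply]
  ext i
  fin_cases i <;> simp [vPart, wPart]

/-- The solution of `-i α ψ' = k ψ` with `ψ 0 = p`. -/
def flow (k : ℂ) (x : ℝ) (p : Spinor) : Spinor :=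
  Complex.cos (x * k) • p - Complex.sin (x * k) • negIAlpha p

theorem flow_zero (k : ℂ) (p : Spinor) : flow k 0 p = p := by simp [flow]

theorem flow_add (k : ℂ) (x : ℝ) (p q : Spinor) :
    flow k x (p + q) = flow k x p + flow k x q := by
  simp only [flow, map_add, smul_add]
  abel

theorem flow_smul (k : ℂ) (x : ℝ) (c : ℂ) (p : Spinor) :
    flow k x (c • p) = c • flow k x p := by
  simp only [flow, map_smul, smul_sub, smul_comm c]

theorem negIAlpha_flow (k : ℂ) (x : ℝ) (p : Spinor) :
    negIAlpha (flow k x p) = flow k x (negIAlpha p) := by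
  simp only [flow, map_sub, map_smul]

theorem vPart_flow (k : ℂ) (x : ℝ) (p : Spinor) :
    vPart (flow k x p) = Complex.cos (x * k) • vPart p - Complex.sin (x * k) • wPart p := by
  rw [flow, sub_eq_add_neg, ← neg_smul, vPart_add, vPart_smul, vPart_smul, vPart_negIAlpha,
    neg_smul, sub_eq_add_neg]

theorem wPart_flow (k : ℂ) (x : ℝ) (p : Spinor) :
    wPart (flow k x p) = Complex.cos (x * k) • wPart p + Complex.sin (x * k) • vPart p := by
  rw [flow, sub_eq_add_neg, ← neg_smul, wPart_add, wPart_smul, wPart_smul, wPart_negIAlpha,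
    smul_neg, neg_smul, neg_neg]

theorem hasDerivAt_flow (k : ℂ) (p : Spinor) (x : ℝ) :
    HasDerivAt (fun x => flow k x p) (-(k • negIAlpha (flow k x p))) x := by
  have h0 : HasDerivAt (fun x : ℝ => (x : ℂ) * k) k x := by
    simpa using (Complex.ofRealCLM.hasDerivAt (x := x)).mul_const k
  have h := ((((Complex.hasDerivAt_cos _).comp x h0).smul_const p).sub
    (((Complex.hasDerivAt_sin _).comp x h0).smul_const (negIAlpha p)))
  refine h.congr_deriv ?_
  simp only [flow, map_sub, map_smul, negIAlpha_negIAlpha]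
  module

theorem continuous_flow (k : ℂ) (p : Spinor) : Continuous fun x => flow k x p :=
  continuous_iff_continuousAt.2 fun x => (hasDerivAt_flow k p x).continuousAt

/-- A continuous function with the integral equation of `flow` on `[0, ℓ]` is a `flow`. -/
theorem eqOn_flow {ℓ : ℝ} {k : ℂ} {g : ℝ → Spinor} (hg : ContinuousOn g (Set.Icc 0 ℓ))
    (h : ∀ x ∈ Set.Icc 0 ℓ, g x = g 0 + ∫ t in (0 : ℝ)..x, -(k • negIAlpha (g t))) :
    Set.EqOn g (fun x => flow k x (g 0)) (Set.Icc 0 ℓ) := by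
  rcases lt_or_ge ℓ 0 with hℓ | hℓ
  · simp [Set.Icc_eq_empty_of_lt hℓ]
  -- A continuous extension to the whole line makes the primitive differentiable everywhere,
  -- including at the end points of the bond. ODE uniqueness then applies.
  set G : ℝ → Spinor := Set.IccExtend hℓ ((Set.Icc 0 ℓ).domRestrict g) with hG
  have hGc : Continuous G := (continuousOn_iff_continuous_domRestrict.1 hg).Icc_extend'
  have hGg : ∀ x ∈ Set.Icc 0 ℓ, G x = g x := fun x hx => by
    rw [hG, Set.IccExtend_of_mem hℓ _ hx]; rfl
  have hFc : Continuous fun t => -(k • negIAlpha (G t)) := by fun_prop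
  have hgi : ∀ x ∈ Set.Icc 0 ℓ, g x = g 0 + ∫ t in (0 : ℝ)..x, -(k • negIAlpha (G t)) := by
    intro x hx
    rw [h x hx]
    congr 1
    refine intervalIntegral.integral_congr fun t ht => ?_
    rw [Set.uIcc_of_le hx.1] at ht
    simp only [hGg t ⟨ht.1, ht.2.trans hx.2⟩]
  have hd : ∀ x, HasDerivAt (fun x => g 0 + ∫ t in (0 : ℝ)..x, -(k • negIAlpha (G t)))
      (-(k • negIAlpha (G x))) x := fun x =>
    (hFc.integral_hasStrictDerivAt 0 x).hasDerivAt.const_add (g 0)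
  have hEq := ODE_solution_unique (v := fun _ y => -(k • negIAlpha y)) (K := ‖-(k • negIAlpha)‖₊)
    (fun _ => (-(k • negIAlpha)).lipschitz) (a := 0) (b := ℓ)
    (f := fun x => g 0 + ∫ t in (0 : ℝ)..x, -(k • negIAlpha (G t)))
    (g := fun x => flow k x (g 0))
    (fun x _ => (hd x).continuousAt.continuousWithinAt)
    (fun x hx => by
      have hx' : x ∈ Set.Icc 0 ℓ := Set.Ico_subset_Icc_self hx
      rw [← hgi x hx', ← hGg x hx']
      exact (hd x).hasDerivWithinAt)
    (continuous_flow k (g 0)).continuousOn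
    (fun x _ => (hasDerivAt_flow k (g 0) x).hasDerivWithinAt)
    (by simp [flow_zero])
  intro x hx
  rw [hgi x hx]
  exact hEq hx

theorem memLp_flow (k : ℂ) (ℓ : ℝ) (p : Spinor) :
    MemLp (fun x => flow k x p) 2 (bondMeasure ℓ) := by
  obtain ⟨C, hC⟩ := isCompact_Icc.exists_bound_of_continuousOn
    (continuous_flow k p).continuousOn (s := Set.Icc 0 ℓ)
  refine MemLp.of_bound (continuous_flow k p).aestronglyMeasurable C ?_
  exact (ae_restrict_iff' measurableSet_Icc).2 (Eventually.of_forall hC)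

/-- The solution `flow k` on a bond as an `L²` function. -/
def bondWave (k : ℂ) (ℓ : ℝ) : Spinor →ₗ[ℂ] Lp Spinor 2 (bondMeasure ℓ) where
  toFun p := (memLp_flow k ℓ p).toLp
  map_add' p q := by
    rw [← MemLp.toLp_add]
    exact MemLp.toLp_congr _ _ (Eventually.of_forall fun x => flow_add k x p q)
  map_smul' c p := by
    rw [RingHom.id_apply, ← MemLp.toLp_const_smul]
    exact MemLp.toLp_congr _ _ (Eventually.of_forall fun x => flow_smul k x c p)

theorem coeFn_bondWave (k : ℂ) (ℓ : ℝ) (p : Spinor) :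
    (bondWave k ℓ p : ℝ → Spinor) =ᵐ[bondMeasure ℓ] fun x => flow k x p :=
  MemLp.coeFn_toLp (memLp_flow k ℓ p)

theorem bondWave_injective (k : ℂ) {ℓ : ℝ} (hℓ : 0 < ℓ) :
    Function.Injective (bondWave k ℓ) := by
  rw [← LinearMap.ker_eq_bot, LinearMap.ker_eq_bot']
  intro p hp
  have h1 : (fun x => flow k x p) =ᵐ[bondMeasure ℓ] fun _ => 0 := by
    refine (coeFn_bondWave k ℓ p).symm.trans ?_
    rw [hp]
    exact Lp.coeFn_zero _ _ _
  have h2 := Measure.eqOn_Icc_of_ae_eq volume hℓ.ne h1 (continuous_flow k p).continuousOn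
    continuousOn_const (Set.left_mem_Icc.2 hℓ.le)
  simpa [flow_zero] using h2

theorem compLp_bondWave (k : ℂ) (ℓ : ℝ) (p : Spinor) :
    negIAlpha.compLp (bondWave k ℓ p) = bondWave k ℓ (negIAlpha p) := by
  apply Lp.ext
  refine (ContinuousLinearMap.coeFn_compLp' negIAlpha _).trans ?_
  filter_upwards [coeFn_bondWave k ℓ p, coeFn_bondWave k ℓ (negIAlpha p)] with x h1 h2
  rw [h1, h2, negIAlpha_flow]

theorem isSobolevRep_bondWave (k : ℂ) (ℓ : ℝ) (p : Spinor) :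
    IsSobolevRep (bondWave k ℓ p) (bondWave k ℓ (-(k • negIAlpha p))) fun x => flow k x p := by
  refine ⟨coeFn_bondWave k ℓ p, fun x hx => ?_⟩
  rw [intervalIntegral_congr_coe hx (coeFn_bondWave k ℓ _),
    intervalIntegral.integral_eq_sub_of_hasDerivAt (f := fun x => flow k x p)]
  · simp
  · intro t _
    refine (hasDerivAt_flow k p t).congr_deriv ?_
    rw [negIAlpha_flow, ← flow_smul, ← neg_one_smul ℂ, ← flow_smul, neg_one_smul]
  · exact (continuous_flow k _).intervalIntegrable _ _

/-- An `H¹` solution is classical: since `(-i α)² = -1`, the weak equation says `dψ = -k (-i α) g`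
almost everywhere. Hence `g` satisfies the integral equation of the flow. -/
theorem IsSobolevRep.eqOn_flow {ℓ : ℝ} (hℓ : 0 < ℓ) {k : ℂ}
    {ψ dψ : Lp Spinor 2 (bondMeasure ℓ)} {g : ℝ → Spinor} (hg : IsSobolevRep ψ dψ g)
    (hN : negIAlpha.compLp dψ = k • ψ) :
    Set.EqOn g (fun x => flow k x (g 0)) (Set.Icc 0 ℓ) ∧ ψ = bondWave k ℓ (g 0) := by
  have hd : (dψ : ℝ → Spinor) =ᵐ[bondMeasure ℓ] fun t => -(k • negIAlpha (g t)) := by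
    have h2 := ContinuousLinearMap.coeFn_compLp negIAlpha dψ
    rw [hN] at h2
    filter_upwards [h2, Lp.coeFn_smul k ψ, hg.1] with t h3 h4 h5
    rw [h4, Pi.smul_apply, h5] at h3
    rw [← map_smul, h3, negIAlpha_negIAlpha, neg_neg]
  have hint := intervalIntegrable_coe (Set.right_mem_Icc.2 hℓ.le) dψ
  have hc : ContinuousOn g (Set.Icc 0 ℓ) := by
    have := intervalIntegral.continuousOn_primitive_interval' hint Set.left_mem_uIcc
    rw [Set.uIcc_of_le hℓ.le] at this
    exact (continuousOn_const.add this).congr hg.2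
  have key : Set.EqOn g (fun x => flow k x (g 0)) (Set.Icc 0 ℓ) := by
    refine DiracRose.eqOn_flow hc fun t ht => ?_
    rw [← intervalIntegral_congr_coe ht hd]
    exact hg.2 t ht
  refine ⟨key, Lp.ext (hg.1.trans (EventuallyEq.trans ?_ (coeFn_bondWave k ℓ (g 0)).symm))⟩
  exact (ae_restrict_iff' measurableSet_Icc).2 (Eventually.of_forall key)

variable {B : ℕ}

/-- The spinors at the origins of the bonds whose `flow k` satisfies the vertex conditions. -/
def amplitudes (L : Fin B → ℝ) (uo ut : Fin B → Matrix.specialUnitaryGroup (Fin 2) ℂ) (k : ℂ) :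
    Submodule ℂ (Fin B → Spinor) where
  carrier := {p | VertexConditions L uo ut fun b x => flow k x (p b)}
  zero_mem' := by
    have hv : vPart 0 = 0 := by ext i; fin_cases i <;> simp [vPart]
    have hw : wPart 0 = 0 := by ext i; fin_cases i <;> simp [wPart]
    exact ⟨⟨0, fun b => by simp [flow, hv]⟩, by simp [flow, hw]⟩
  add_mem' := by
    rintro p q ⟨⟨ξ, hξ⟩, hp⟩ ⟨⟨η, hη⟩, hq⟩
    refine ⟨⟨ξ + η, fun b => ⟨?_, ?_⟩⟩, ?_⟩
    · simp only [Pi.add_apply, flow_add, vPart_add, Matrix.mulVec_add, (hξ b).1, (hη b).1]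
    · simp only [Pi.add_apply, flow_add, vPart_add, Matrix.mulVec_add, (hξ b).2, (hη b).2]
    · simp only [Pi.add_apply, flow_add, wPart_add, Matrix.mulVec_add, Finset.sum_add_distrib]
      rw [add_sub_add_comm, hp, hq, add_zero]
  smul_mem' := by
    rintro c p ⟨⟨ξ, hξ⟩, hp⟩
    refine ⟨⟨c • ξ, fun b => ⟨?_, ?_⟩⟩, ?_⟩
    · simp only [Pi.smul_apply, flow_smul, vPart_smul, Matrix.mulVec_smul, (hξ b).1]
    · simp only [Pi.smul_apply, flow_smul, vPart_smul, Matrix.mulVec_smul, (hξ b).2]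
    · simp only [Pi.smul_apply, flow_smul, wPart_smul, Matrix.mulVec_smul, ← Finset.smul_sum]
      rw [← smul_sub, hp, smul_zero]

theorem mem_amplitudes {L : Fin B → ℝ} {uo ut : Fin B → Matrix.specialUnitaryGroup (Fin 2) ℂ}
    {k : ℂ} {p : Fin B → Spinor} :
    p ∈ amplitudes L uo ut k ↔ VertexConditions L uo ut fun b x => flow k x (p b) := Iff.rfl

/-- The solutions `flow k` on all bonds as an element of the Hilbert space. -/
def graphWave (L : Fin B → ℝ) (k : ℂ) : (Fin B → Spinor) →ₗ[ℂ] GraphSpace L where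
  toFun p := WithLp.toLp 2 fun b => bondWave k (L b) (p b)
  map_add' p q := by
    ext1 b
    exact map_add (bondWave k (L b)) _ _
  map_smul' c p := by
    ext1 b
    exact map_smul (bondWave k (L b)) _ _

theorem graphWave_apply (L : Fin B → ℝ) (k : ℂ) (p : Fin B → Spinor) (b : Fin B) :
    graphWave L k p b = bondWave k (L b) (p b) := rfl

theorem graphWave_injective {L : Fin B → ℝ} (hL : ∀ b, 0 < L b) (k : ℂ) :
    Function.Injective (graphWave L k) := fun p q h => by
  funext b
  exact bondWave_injective k (hL b) (congrArg (fun f : GraphSpace L => f b) h)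

theorem VertexConditions.congr {L : Fin B → ℝ}
    {uo ut : Fin B → Matrix.specialUnitaryGroup (Fin 2) ℂ} {g h : Fin B → ℝ → Spinor}
    (hg : VertexConditions L uo ut g) (h0 : ∀ b, g b 0 = h b 0) (h1 : ∀ b, g b (L b) = h b (L b)) :
    VertexConditions L uo ut h := by
  simpa only [VertexConditions, h0, h1] using hg

theorem eigenspace_diracOperator {L : Fin B → ℝ} (hL : ∀ b, 0 < L b)
    (uo ut : Fin B → Matrix.specialUnitaryGroup (Fin 2) ℂ) (k : ℂ) :
    eigenspace (diracOperator L uo ut) k = (amplitudes L uo ut k).map (graphWave L k) := by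
  ext x
  have hmem : x ∈ eigenspace (diracOperator L uo ut) k ↔ (x, k • x) ∈ diracGraph L uo ut := by
    rw [eigenspace, diracOperator_graph]
    rfl
  rw [hmem, Submodule.mem_map]
  constructor
  · rintro ⟨dψ, g, hg, hv, hN⟩
    have key := fun b => (hg b).eqOn_flow (hL b) (hN b).symm
    refine ⟨fun b => g b 0, ?_, PiLp.ext fun b => (key b).2.symm⟩
    rw [mem_amplitudes]
    exact hv.congr (fun b => (flow_zero k (g b 0)).symm)
      fun b => (key b).1 (Set.right_mem_Icc.2 (hL b).le)
  · rintro ⟨p, hp, rfl⟩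
    refine ⟨graphWave L k fun b => -(k • negIAlpha (p b)), fun b x => flow k x (p b),
      fun b => ?_, mem_amplitudes.1 hp, fun b => ?_⟩
    · exact isSobolevRep_bondWave k (L b) (p b)
    · change k • graphWave L k p b = _
      rw [graphWave_apply, graphWave_apply, compLp_bondWave, map_neg, map_smul,
        negIAlpha_negIAlpha, smul_neg, neg_neg, map_smul]

theorem finiteDimensional_eigenspace {L : Fin B → ℝ} (hL : ∀ b, 0 < L b)
    (uo ut : Fin B → Matrix.specialUnitaryGroup (Fin 2) ℂ) (k : ℂ) :
    FiniteDimensional ℂ (eigenspace (diracOperator L uo ut) k) := by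
  rw [eigenspace_diracOperator hL]
  infer_instance

theorem finrank_eigenspace {L : Fin B → ℝ} (hL : ∀ b, 0 < L b)
    (uo ut : Fin B → Matrix.specialUnitaryGroup (Fin 2) ℂ) (k : ℂ) :
    Module.finrank ℂ (eigenspace (diracOperator L uo ut) k) =
      Module.finrank ℂ (amplitudes L uo ut k) := by
  rw [eigenspace_diracOperator hL]
  exact (Submodule.equivMapOfInjective _ (graphWave_injective hL k) _).symm.finrank_eq

end DiracRose

end


/-! ### Dimension of the space of amplitudes. -/

noncomputable section

namespace DiracRose

open Filter Topology
open scoped Matrix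

section SpecialUnitary

variable (U : Matrix.specialUnitaryGroup (Fin 2) ℂ)

theorem mul_inv_coe : (U : Matrix (Fin 2) (Fin 2) ℂ) * (U⁻¹ : Matrix.specialUnitaryGroup (Fin 2) ℂ) = 1 := by
  rw [← Submonoid.coe_mul, mul_inv_cancel, Submonoid.coe_one]

theorem inv_mul_coe : ((U⁻¹ : Matrix.specialUnitaryGroup (Fin 2) ℂ) : Matrix (Fin 2) (Fin 2) ℂ) * U = 1 := by
  rw [← Submonoid.coe_mul, inv_mul_cancel, Submonoid.coe_one]

theorem mulVec_inv_mulVec (ξ : Fin 2 → ℂ) :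
    (U : Matrix (Fin 2) (Fin 2) ℂ) *ᵥ
      ((U⁻¹ : Matrix.specialUnitaryGroup (Fin 2) ℂ) : Matrix (Fin 2) (Fin 2) ℂ) *ᵥ ξ = ξ := by
  rw [Matrix.mulVec_mulVec, mul_inv_coe, Matrix.one_mulVec]

theorem inv_mulVec_mulVec (ξ : Fin 2 → ℂ) :
    ((U⁻¹ : Matrix.specialUnitaryGroup (Fin 2) ℂ) : Matrix (Fin 2) (Fin 2) ℂ) *ᵥ
      (U : Matrix (Fin 2) (Fin 2) ℂ) *ᵥ ξ = ξ := by
  rw [Matrix.mulVec_mulVec, inv_mul_coe, Matrix.one_mulVec]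

/-- Cayley-Hamilton in `SU(2)`. -/
theorem add_inv_coe : (U : Matrix (Fin 2) (Fin 2) ℂ) + (U⁻¹ : Matrix.specialUnitaryGroup (Fin 2) ℂ) =
    (U : Matrix (Fin 2) (Fin 2) ℂ).trace • (1 : Matrix (Fin 2) (Fin 2) ℂ) := by
  have hdet : (U : Matrix (Fin 2) (Fin 2) ℂ).det = 1 :=
    (Matrix.mem_specialUnitaryGroup_iff.1 U.2).2
  have h : ((U⁻¹ : Matrix.specialUnitaryGroup (Fin 2) ℂ) : Matrix (Fin 2) (Fin 2) ℂ) =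
      (U : Matrix (Fin 2) (Fin 2) ℂ).adjugate := by
    have h1 := Matrix.mul_adjugate (U : Matrix (Fin 2) (Fin 2) ℂ)
    rw [hdet, one_smul] at h1
    calc _ = ((U⁻¹ : Matrix.specialUnitaryGroup (Fin 2) ℂ) : Matrix (Fin 2) (Fin 2) ℂ) *
          ((U : Matrix (Fin 2) (Fin 2) ℂ) * (U : Matrix (Fin 2) (Fin 2) ℂ).adjugate) := by
          rw [h1, mul_one]
      _ = _ := by rw [← mul_assoc, inv_mul_coe, one_mul]
  rw [h, Matrix.adjugate_fin_two]
  ext i j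
  fin_cases i <;> fin_cases j <;> simp [Matrix.trace_fin_two, add_comm]

variable {U}

theorem mulVec_add_inv_mulVec {τ : ℂ} (hτ : (U : Matrix (Fin 2) (Fin 2) ℂ).trace = 2 * τ)
    (ξ : Fin 2 → ℂ) :
    (U : Matrix (Fin 2) (Fin 2) ℂ) *ᵥ ξ +
      ((U⁻¹ : Matrix.specialUnitaryGroup (Fin 2) ℂ) : Matrix (Fin 2) (Fin 2) ℂ) *ᵥ ξ =
      (2 * τ) • ξ := by
  rw [← Matrix.add_mulVec, add_inv_coe, hτ, Matrix.smul_mulVec, Matrix.one_mulVec]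

/-- This is `(1 - c U⁻¹) (1 - c U) = (2 - 2 c τ) • 1`, from `U + U⁻¹ = 2 τ`. For `τ ≠ c` it serves
twice: it makes `1 - c U` injective and exhibits a right inverse of `1 - c U⁻¹`. -/
theorem sub_smul_inv_mulVec {τ c : ℂ} (hτ : (U : Matrix (Fin 2) (Fin 2) ℂ).trace = 2 * τ)
    (hc : c ^ 2 = 1) (ξ : Fin 2 → ℂ) :
    (ξ - c • (U : Matrix (Fin 2) (Fin 2) ℂ) *ᵥ ξ) -
      c • ((U⁻¹ : Matrix.specialUnitaryGroup (Fin 2) ℂ) : Matrix (Fin 2) (Fin 2) ℂ) *ᵥ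
        (ξ - c • (U : Matrix (Fin 2) (Fin 2) ℂ) *ᵥ ξ) = (2 - 2 * (c * τ)) • ξ := by
  have h := mulVec_add_inv_mulVec hτ ξ
  rw [Matrix.mulVec_sub, Matrix.mulVec_smul, inv_mulVec_mulVec]
  rw [eq_sub_of_add_eq' h]
  linear_combination (norm := module) hc • ξ

theorem eq_zero_of_mulVec_eq_smul {τ c : ℂ} (hτ : (U : Matrix (Fin 2) (Fin 2) ℂ).trace = 2 * τ)
    (hc : c ^ 2 = 1) (hne : τ ≠ c) {ξ : Fin 2 → ℂ}
    (h : (U : Matrix (Fin 2) (Fin 2) ℂ) *ᵥ ξ = c • ξ) : ξ = 0 := by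
  have h1 := sub_smul_inv_mulVec hτ hc ξ
  rw [h, smul_smul, ← sq, hc, one_smul, sub_self, Matrix.mulVec_zero, smul_zero, sub_zero] at h1
  refine (smul_eq_zero.1 h1.symm).resolve_left fun h2 => hne ?_
  linear_combination (-c / 2) * h2 + (-τ) * hc

-- For `c = ±1`, `(U - c) (U - c)ᴴ = 1 - c (U + U⁻¹) + c² = 0`, which forces `U = c`. Unitarity is
-- essential, since trace and determinant alone would allow a Jordan block.
open scoped ComplexOrder in
theorem mulVec_eq_smul_of_trace {c : ℂ} (hτ : (U : Matrix (Fin 2) (Fin 2) ℂ).trace = 2 * c)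
    (hc : c ^ 2 = 1) (ξ : Fin 2 → ℂ) :
    (U : Matrix (Fin 2) (Fin 2) ℂ) *ᵥ ξ = c • ξ := by
  have hstar : star c = c := by
    rcases eq_or_eq_neg_of_sq_eq_sq c 1 (by rw [hc, one_pow]) with h | h <;> simp [h]
  have h1 : ((U⁻¹ : Matrix.specialUnitaryGroup (Fin 2) ℂ) : Matrix (Fin 2) (Fin 2) ℂ) =
      (U : Matrix (Fin 2) (Fin 2) ℂ)ᴴ := rfl
  have h2 := add_inv_coe U
  have h3 := mul_inv_coe U
  rw [h1] at h2 h3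
  have h4 : ((U : Matrix (Fin 2) (Fin 2) ℂ) - c • 1) *
      ((U : Matrix (Fin 2) (Fin 2) ℂ) - c • 1)ᴴ = 0 := by
    rw [Matrix.conjTranspose_sub, Matrix.conjTranspose_smul, Matrix.conjTranspose_one, hstar,
      sub_mul, mul_sub, mul_sub, h3, smul_mul_assoc, smul_mul_assoc, mul_smul_comm, mul_one,
      one_mul, one_mul, eq_sub_of_add_eq' h2, hτ]
    rw [← sub_eq_zero]
    trans (1 - c ^ 2) • (1 : Matrix (Fin 2) (Fin 2) ℂ)
    · module
    · rw [hc, sub_self, zero_smul]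
  have h5 := sub_eq_zero.1 (Matrix.self_mul_conjTranspose_eq_zero.1 h4)
  rw [h5, Matrix.smul_mulVec, Matrix.one_mulVec]

end SpecialUnitary

/-- The spinor with given `vPart` and `wPart`. -/
def spinorOfParts : (Fin 2 → ℂ) × (Fin 2 → ℂ) →ₗ[ℂ] Spinor where
  toFun q := !₂[q.1 0, q.1 1, q.2 1, -q.2 0]
  map_add' q r := by ext i; fin_cases i <;> simp [add_comm]
  map_smul' c q := by ext i; fin_cases i <;> simp

theorem vPart_spinorOfParts (q : (Fin 2 → ℂ) × (Fin 2 → ℂ)) : vPart (spinorOfParts q) = q.1 := by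
  ext i; fin_cases i <;> simp [vPart, spinorOfParts]

theorem wPart_spinorOfParts (q : (Fin 2 → ℂ) × (Fin 2 → ℂ)) : wPart (spinorOfParts q) = q.2 := by
  ext i; fin_cases i <;> simp [wPart, spinorOfParts]

theorem spinorOfParts_parts (p : Spinor) : spinorOfParts (vPart p, wPart p) = p := by
  ext i; fin_cases i <;> simp [vPart, wPart, spinorOfParts]

variable {B : ℕ}

/-- The vertex conditions in terms of the rotated amplitudes at the origins of the bonds. -/
theorem mem_amplitudes_iff {L : Fin B → ℝ} {uo ut : Fin B → Matrix.specialUnitaryGroup (Fin 2) ℂ}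
    {U : Fin B → Matrix.specialUnitaryGroup (Fin 2) ℂ} (hU : ∀ b, U b = uo b * (ut b)⁻¹)
    {k : ℂ} {p : Fin B → Spinor} {x y : Fin B → Fin 2 → ℂ}
    (hx : ∀ b, (uo b : Matrix (Fin 2) (Fin 2) ℂ) *ᵥ vPart (p b) = x b)
    (hy : ∀ b, (uo b : Matrix (Fin 2) (Fin 2) ℂ) *ᵥ wPart (p b) = y b) :
    p ∈ amplitudes L uo ut k ↔
      (∃ ξ, ∀ b, x b = ξ ∧ Complex.sin (L b * k) • y b =
        Complex.cos (L b * k) • ξ - (U b : Matrix (Fin 2) (Fin 2) ℂ) *ᵥ ξ) ∧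
      ∑ b, (y b - (((U b)⁻¹ : Matrix.specialUnitaryGroup (Fin 2) ℂ) : Matrix (Fin 2) (Fin 2) ℂ) *ᵥ
        (Complex.cos (L b * k) • y b + Complex.sin (L b * k) • x b)) = 0 := by
  have hut : ∀ b (q : Fin 2 → ℂ), (ut b : Matrix (Fin 2) (Fin 2) ℂ) *ᵥ q =
      (((U b)⁻¹ : Matrix.specialUnitaryGroup (Fin 2) ℂ) : Matrix (Fin 2) (Fin 2) ℂ) *ᵥ
        (uo b : Matrix (Fin 2) (Fin 2) ℂ) *ᵥ q := by
    intro b q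
    rw [Matrix.mulVec_mulVec, ← Submonoid.coe_mul, hU]
    simp
  rw [mem_amplitudes, VertexConditions, ← Finset.sum_sub_distrib]
  simp only [flow_zero, vPart_flow, wPart_flow, hut, Matrix.mulVec_sub, Matrix.mulVec_add,
    Matrix.mulVec_smul, hx, hy]
  refine and_congr_left fun _ => exists_congr fun ξ => forall_congr' fun b =>
    and_congr_right fun hξ => ?_
  rw [hξ, ← Matrix.mulVec_smul, ← Matrix.mulVec_smul, ← Matrix.mulVec_sub]
  constructor
  · intro h
    have h1 := congrArg ((U b : Matrix (Fin 2) (Fin 2) ℂ) *ᵥ ·) h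
    simp only [mulVec_inv_mulVec] at h1
    rw [← h1, sub_sub_cancel]
  · intro h
    rw [h, sub_sub_cancel, inv_mulVec_mulVec]

/-- Extension by zero of amplitudes on the nodal bonds. -/
def extendNodal (L : Fin B → ℝ) (k : ℂ) :
    (nodalBonds L k → Fin 2 → ℂ) →ₗ[ℂ] Fin B → Fin 2 → ℂ :=
  open Classical in
  LinearMap.pi fun b => if h : b ∈ nodalBonds L k then LinearMap.proj ⟨b, h⟩ else 0

theorem extendNodal_of_mem {L : Fin B → ℝ} {k : ℂ} (y : nodalBonds L k → Fin 2 → ℂ)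
    (b : nodalBonds L k) : extendNodal L k y b = y b := by
  simp [extendNodal]

theorem extendNodal_of_notMem {L : Fin B → ℝ} {k : ℂ} (y : nodalBonds L k → Fin 2 → ℂ)
    {b : Fin B} (hb : b ∉ nodalBonds L k) : extendNodal L k y b = 0 := by
  simp [extendNodal, hb]

/-- The amplitude `w` (rotated to the vertex) determined by the value `ξ` of the spinor at the
vertex and the free amplitudes on the nodal bonds. -/
def vertexAmplitude (L : Fin B → ℝ) (U : Fin B → Matrix.specialUnitaryGroup (Fin 2) ℂ) (k : ℂ)
    (b : Fin B) : (Fin 2 → ℂ) × (nodalBonds L k → Fin 2 → ℂ) →ₗ[ℂ] Fin 2 → ℂ :=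
  (LinearMap.proj b ∘ₗ extendNodal L k) ∘ₗ LinearMap.snd ℂ _ _ +
    (Complex.sin (L b * k))⁻¹ • (Complex.cos (L b * k) • LinearMap.id -
      (U b : Matrix (Fin 2) (Fin 2) ℂ).mulVecLin) ∘ₗ LinearMap.fst ℂ _ _

/-- Exactly one summand survives on each bond: the free amplitude on a nodal bond, where `(sin)⁻¹ =
0⁻¹ = 0`, and the amplitude forced by `q.1` on any other bond. -/
theorem vertexAmplitude_apply (L : Fin B → ℝ) (U : Fin B → Matrix.specialUnitaryGroup (Fin 2) ℂ)
    (k : ℂ) (b : Fin B) (q : (Fin 2 → ℂ) × (nodalBonds L k → Fin 2 → ℂ)) :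
    vertexAmplitude L U k b q = extendNodal L k q.2 b + (Complex.sin (L b * k))⁻¹ •
      (Complex.cos (L b * k) • q.1 - (U b : Matrix (Fin 2) (Fin 2) ℂ) *ᵥ q.1) := rfl

/-- The spinors at the origins of the bonds determined by the value of the spinor at the vertex and
the free amplitudes on the nodal bonds. -/
def amplitudeMap (L : Fin B → ℝ) (uo U : Fin B → Matrix.specialUnitaryGroup (Fin 2) ℂ) (k : ℂ) :
    (Fin 2 → ℂ) × (nodalBonds L k → Fin 2 → ℂ) →ₗ[ℂ] Fin B → Spinor :=
  LinearMap.pi fun b => spinorOfParts ∘ₗ LinearMap.prodMap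
    (((uo b)⁻¹ : Matrix.specialUnitaryGroup (Fin 2) ℂ) : Matrix (Fin 2) (Fin 2) ℂ).mulVecLin
    (((uo b)⁻¹ : Matrix.specialUnitaryGroup (Fin 2) ℂ) : Matrix (Fin 2) (Fin 2) ℂ).mulVecLin ∘ₗ
    (LinearMap.fst ℂ _ _).prod (vertexAmplitude L U k b)

theorem amplitudeMap_apply (L : Fin B → ℝ) (uo U : Fin B → Matrix.specialUnitaryGroup (Fin 2) ℂ)
    (k : ℂ) (q : (Fin 2 → ℂ) × (nodalBonds L k → Fin 2 → ℂ)) (b : Fin B) :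
    amplitudeMap L uo U k q b = spinorOfParts
      ((((uo b)⁻¹ : Matrix.specialUnitaryGroup (Fin 2) ℂ) : Matrix (Fin 2) (Fin 2) ℂ) *ᵥ q.1,
        (((uo b)⁻¹ : Matrix.specialUnitaryGroup (Fin 2) ℂ) : Matrix (Fin 2) (Fin 2) ℂ) *ᵥ
          vertexAmplitude L U k b q) := rfl

theorem mulVec_vPart_amplitudeMap (L : Fin B → ℝ)
    (uo U : Fin B → Matrix.specialUnitaryGroup (Fin 2) ℂ)
    (k : ℂ) (q : (Fin 2 → ℂ) × (nodalBonds L k → Fin 2 → ℂ)) (b : Fin B) :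
    (uo b : Matrix (Fin 2) (Fin 2) ℂ) *ᵥ vPart (amplitudeMap L uo U k q b) = q.1 := by
  rw [amplitudeMap_apply, vPart_spinorOfParts, mulVec_inv_mulVec]

theorem mulVec_wPart_amplitudeMap (L : Fin B → ℝ)
    (uo U : Fin B → Matrix.specialUnitaryGroup (Fin 2) ℂ)
    (k : ℂ) (q : (Fin 2 → ℂ) × (nodalBonds L k → Fin 2 → ℂ)) (b : Fin B) :
    (uo b : Matrix (Fin 2) (Fin 2) ℂ) *ᵥ wPart (amplitudeMap L uo U k q b) =
      vertexAmplitude L U k b q := by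
  rw [amplitudeMap_apply, wPart_spinorOfParts, mulVec_inv_mulVec]

/-- The vertex value is read off on bond `0`, so at least one bond is needed. -/
theorem amplitudeMap_injective [NeZero B] (L : Fin B → ℝ)
    (uo U : Fin B → Matrix.specialUnitaryGroup (Fin 2) ℂ) (k : ℂ) :
    Function.Injective (amplitudeMap L uo U k) := by
  rw [← LinearMap.ker_eq_bot, LinearMap.ker_eq_bot']
  intro q hq
  have hv0 : vPart 0 = 0 := by ext i; fin_cases i <;> simp [vPart]
  have hw0 : wPart 0 = 0 := by ext i; fin_cases i <;> simp [wPart]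
  have h1 : q.1 = 0 := by
    rw [← mulVec_vPart_amplitudeMap L uo U k q 0, hq, Pi.zero_apply, hv0, Matrix.mulVec_zero]
  refine Prod.ext h1 (funext fun b => ?_)
  have h2 := mulVec_wPart_amplitudeMap L uo U k q b
  rw [hq, Pi.zero_apply, hw0, Matrix.mulVec_zero, vertexAmplitude_apply, h1, Matrix.mulVec_zero,
    smul_zero, sub_zero, smul_zero, add_zero, extendNodal_of_mem] at h2
  exact h2.symm

/-- The total current into the vertex of the free amplitudes on the nodal bonds. -/
def nodalCurrent (L : Fin B → ℝ) (U : Fin B → Matrix.specialUnitaryGroup (Fin 2) ℂ) (k : ℂ) :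
    (nodalBonds L k → Fin 2 → ℂ) →ₗ[ℂ] Fin 2 → ℂ :=
  ∑ b, (LinearMap.id - Complex.cos (L b * k) •
    (((U b)⁻¹ : Matrix.specialUnitaryGroup (Fin 2) ℂ) : Matrix (Fin 2) (Fin 2) ℂ).mulVecLin) ∘ₗ
    LinearMap.proj b ∘ₗ extendNodal L k

theorem nodalCurrent_apply (L : Fin B → ℝ) (U : Fin B → Matrix.specialUnitaryGroup (Fin 2) ℂ)
    (k : ℂ) (y : nodalBonds L k → Fin 2 → ℂ) :
    nodalCurrent L U k y = ∑ b, (extendNodal L k y b - Complex.cos (L b * k) •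
      (((U b)⁻¹ : Matrix.specialUnitaryGroup (Fin 2) ℂ) : Matrix (Fin 2) (Fin 2) ℂ) *ᵥ
        extendNodal L k y b) := by
  simp [nodalCurrent]

/-- A bond with `s = sin ≠ 0` contributes `s⁻¹ (2 c - U - U⁻¹) ξ = 2 ((c - τ) / s) ξ` to the
current, where `c = cos`. The spin structure collapses to a scalar acting on `ξ ∈ ℂ²`, which is why
multiplicities are twice the orders of zeros. -/
theorem amplitudeMap_mem_iff {L τ : Fin B → ℝ}
    {uo ut U : Fin B → Matrix.specialUnitaryGroup (Fin 2) ℂ} (hU : ∀ b, U b = uo b * (ut b)⁻¹)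
    (hτ : ∀ b, (U b : Matrix (Fin 2) (Fin 2) ℂ).trace = 2 * τ b) {k : ℂ}
    (q : (Fin 2 → ℂ) × (nodalBonds L k → Fin 2 → ℂ)) :
    amplitudeMap L uo U k q ∈ amplitudes L uo ut k ↔
      (∀ b ∈ nodalBonds L k,
        (U b : Matrix (Fin 2) (Fin 2) ℂ) *ᵥ q.1 = Complex.cos (L b * k) • q.1) ∧
      nodalCurrent L U k q.2 + (2 * secularRatio L τ k) • q.1 = 0 := by
  rw [mem_amplitudes_iff hU (mulVec_vPart_amplitudeMap L uo U k q)
    (mulVec_wPart_amplitudeMap L uo U k q)]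
  have hs : ∀ b, Complex.sin (L b * k) • vertexAmplitude L U k b q =
      if b ∈ nodalBonds L k then 0
        else Complex.cos (L b * k) • q.1 - (U b : Matrix (Fin 2) (Fin 2) ℂ) *ᵥ q.1 := by
    intro b
    split_ifs with hb
    · rw [mem_nodalBonds.1 hb, zero_smul]
    · rw [vertexAmplitude_apply, extendNodal_of_notMem _ hb, zero_add,
        smul_inv_smul₀ (fun h => hb (mem_nodalBonds.2 h))]
  have hsum : ∑ b, (vertexAmplitude L U k b q -
      (((U b)⁻¹ : Matrix.specialUnitaryGroup (Fin 2) ℂ) : Matrix (Fin 2) (Fin 2) ℂ) *ᵥ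
        (Complex.cos (L b * k) • vertexAmplitude L U k b q + Complex.sin (L b * k) • q.1)) =
      nodalCurrent L U k q.2 + (2 * secularRatio L τ k) • q.1 := by
    rw [nodalCurrent_apply, secularRatio, Finset.mul_sum, Finset.sum_smul,
      ← Finset.sum_add_distrib]
    refine Finset.sum_congr rfl fun b _ => ?_
    rw [vertexAmplitude_apply]
    by_cases hb : b ∈ nodalBonds L k
    · rw [mem_nodalBonds.1 hb]
      simp [Matrix.mulVec_smul]
    · have hs0 : Complex.sin (L b * k) ≠ 0 := fun h => hb (mem_nodalBonds.2 h)
      have hcs := Complex.sin_sq_add_cos_sq (L b * k)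
      rw [extendNodal_of_notMem _ hb]
      generalize Complex.sin (L b * k) = s at hs0 hcs ⊢
      generalize Complex.cos (L b * k) = c at hcs ⊢
      have h := mulVec_add_inv_mulVec (hτ b) q.1
      simp only [zero_add, Matrix.mulVec_zero, smul_zero, sub_zero, Matrix.mulVec_add,
        Matrix.mulVec_smul, Matrix.mulVec_sub, inv_mulVec_mulVec]
      rw [eq_sub_of_add_eq h]
      set w := (((U b)⁻¹ : Matrix.specialUnitaryGroup (Fin 2) ℂ) : Matrix (Fin 2) (Fin 2) ℂ) *ᵥ q.1
      have e1 : s⁻¹ * c * c + s = s⁻¹ := by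
        field_simp
        linear_combination hcs
      linear_combination (norm := module) (-e1) • w
  rw [hsum]
  refine and_congr_left fun _ => ⟨?_, fun h => ⟨q.1, fun b => ⟨rfl, ?_⟩⟩⟩
  · rintro ⟨ξ, hξ⟩ b hb
    have h1 := (hξ b).2
    rw [hs, if_pos hb, ← (hξ b).1] at h1
    exact (sub_eq_zero.1 h1.symm).symm
  · rw [hs]
    split_ifs with hb
    · rw [h b hb, sub_self]
    · rfl

theorem amplitudes_le_range {L : Fin B → ℝ}
    {uo ut U : Fin B → Matrix.specialUnitaryGroup (Fin 2) ℂ} (hU : ∀ b, U b = uo b * (ut b)⁻¹)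
    (k : ℂ) : amplitudes L uo ut k ≤ LinearMap.range (amplitudeMap L uo U k) := by
  intro p hp
  obtain ⟨⟨ξ, hξ⟩, -⟩ := (mem_amplitudes_iff hU (fun b => rfl) (fun b => rfl)).1 hp
  refine ⟨(ξ, fun b => (uo b : Matrix (Fin 2) (Fin 2) ℂ) *ᵥ wPart (p b)), funext fun b => ?_⟩
  rw [amplitudeMap_apply]
  refine Eq.trans (congrArg spinorOfParts (Prod.ext ?_ ?_)) (spinorOfParts_parts (p b))
  · simp only [← (hξ b).1, inv_mulVec_mulVec]
  · simp only [vertexAmplitude_apply, ← (hξ b).2]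
    by_cases hb : b ∈ nodalBonds L k
    · rw [mem_nodalBonds.1 hb, inv_zero, zero_smul, add_zero, extendNodal_of_mem _ ⟨b, hb⟩,
        inv_mulVec_mulVec]
    · rw [extendNodal_of_notMem _ hb, zero_add,
        inv_smul_smul₀ (fun h => hb (mem_nodalBonds.2 h)), inv_mulVec_mulVec]

/-- A non-resonant nodal bond forces `ξ = 0` and makes the nodal current surjective onto `ℂ²`. What
remains is its kernel, of dimension two less than that of the free nodal amplitudes. -/
theorem finrank_amplitudes_add_two [NeZero B] {L τ : Fin B → ℝ}
    {uo ut U : Fin B → Matrix.specialUnitaryGroup (Fin 2) ℂ} (hU : ∀ b, U b = uo b * (ut b)⁻¹)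
    (hτ : ∀ b, (U b : Matrix (Fin 2) (Fin 2) ℂ).trace = 2 * τ b) {k : ℂ}
    (hex : ∃ b ∈ nodalBonds L k, (τ b : ℂ) ≠ Complex.cos (L b * k)) :
    Module.finrank ℂ (amplitudes L uo ut k) + 2 = 2 * (nodalBonds L k).card := by
  obtain ⟨b₀, hb₀, hne⟩ := hex
  have hc := cos_sq_of_mem_nodalBonds hb₀
  have hsurj : LinearMap.range (nodalCurrent L U k) = ⊤ := by
    rw [LinearMap.range_eq_top]
    intro η
    classical
    set c := Complex.cos (L b₀ * k) with hcdef
    have hd : 2 - 2 * (c * τ b₀) ≠ 0 := fun h => hne (by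
      linear_combination (-c / 2) * h + (-(τ b₀ : ℂ)) * hc)
    set y₀ : Fin 2 → ℂ := (2 - 2 * (c * τ b₀))⁻¹ • η with hy₀
    refine ⟨Pi.single ⟨b₀, hb₀⟩ (y₀ - c • (U b₀ : Matrix (Fin 2) (Fin 2) ℂ) *ᵥ y₀), ?_⟩
    rw [nodalCurrent_apply, Finset.sum_eq_single b₀]
    · rw [extendNodal_of_mem _ ⟨b₀, hb₀⟩, Pi.single_eq_same, ← hcdef,
        sub_smul_inv_mulVec (hτ b₀) hc, hy₀, smul_inv_smul₀ hd]
    · intro b _ hb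
      have : extendNodal L k (Pi.single ⟨b₀, hb₀⟩
          (y₀ - c • (U b₀ : Matrix (Fin 2) (Fin 2) ℂ) *ᵥ y₀)) b = 0 := by
        by_cases hbS : b ∈ nodalBonds L k
        · rw [extendNodal_of_mem _ ⟨b, hbS⟩]
          exact Pi.single_eq_of_ne (fun h => hb (congrArg Subtype.val h)) _
        · exact extendNodal_of_notMem _ hbS
      rw [this, Matrix.mulVec_zero, smul_zero, sub_zero]
    · simp
  have hrank := LinearMap.finrank_range_add_finrank_ker (nodalCurrent L U k)
  rw [hsurj, finrank_top, Module.finrank_fin_fun, Module.finrank_pi_fintype] at hrank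
  simp only [Module.finrank_fin_fun, Finset.sum_const, Finset.card_univ, Fintype.card_coe,
    smul_eq_mul] at hrank
  have hmap : amplitudes L uo ut k = (LinearMap.ker (nodalCurrent L U k)).map
      (amplitudeMap L uo U k ∘ₗ LinearMap.inr ℂ _ _) := by
    ext p
    constructor
    · intro hp
      obtain ⟨q, rfl⟩ := amplitudes_le_range hU k hp
      obtain ⟨h1, h2⟩ := (amplitudeMap_mem_iff hU hτ q).1 hp
      have h0 := eq_zero_of_mulVec_eq_smul (hτ b₀) hc hne (h1 b₀ hb₀)
      rw [h0, smul_zero, add_zero] at h2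
      exact ⟨q.2, h2, by rw [LinearMap.comp_apply, LinearMap.inr_apply, ← h0]⟩
    · rintro ⟨y, hy, rfl⟩
      refine (amplitudeMap_mem_iff hU hτ (0, y)).2 ⟨fun b _ => by simp, ?_⟩
      rw [smul_zero, add_zero]
      exact hy
  have hinj : Function.Injective (amplitudeMap L uo U k ∘ₗ
      LinearMap.inr ℂ (Fin 2 → ℂ) (nodalBonds L k → Fin 2 → ℂ)) :=
    (amplitudeMap_injective L uo U k).comp LinearMap.inr_injective
  rw [hmap, (Submodule.equivMapOfInjective _ hinj _).symm.finrank_eq]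
  omega

/-- On every nodal bond `U` is the scalar `cos = ±1`, so a nodal wave returns unchanged and carries
no net current. All nodal amplitudes are free, and `ξ` is free as well exactly when `secularRatio`
vanishes. -/
theorem finrank_amplitudes_of_resonant [NeZero B] {L τ : Fin B → ℝ}
    {uo ut U : Fin B → Matrix.specialUnitaryGroup (Fin 2) ℂ} (hU : ∀ b, U b = uo b * (ut b)⁻¹)
    (hτ : ∀ b, (U b : Matrix (Fin 2) (Fin 2) ℂ).trace = 2 * τ b) {k : ℂ}
    (hall : ∀ b ∈ nodalBonds L k, (τ b : ℂ) = Complex.cos (L b * k)) :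
    Module.finrank ℂ (amplitudes L uo ut k) =
      2 * ((nodalBonds L k).card + if secularRatio L τ k = 0 then 1 else 0) := by
  have hUc : ∀ b ∈ nodalBonds L k, ∀ ξ : Fin 2 → ℂ,
      (U b : Matrix (Fin 2) (Fin 2) ℂ) *ᵥ ξ = Complex.cos (L b * k) • ξ := fun b hb ξ =>
    mulVec_eq_smul_of_trace (by rw [hτ b, hall b hb]) (cos_sq_of_mem_nodalBonds hb) ξ
  have hcur : ∀ y, nodalCurrent L U k y = 0 := by
    intro y
    rw [nodalCurrent_apply]
    refine Finset.sum_eq_zero fun b _ => ?_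
    by_cases hb : b ∈ nodalBonds L k
    · have h := inv_mulVec_mulVec (U b) (extendNodal L k y b)
      rw [hUc b hb, Matrix.mulVec_smul] at h
      rw [h, sub_self]
    · rw [extendNodal_of_notMem _ hb, Matrix.mulVec_zero, smul_zero, sub_zero]
  have hmem : ∀ q, amplitudeMap L uo U k q ∈ amplitudes L uo ut k ↔
      (2 * secularRatio L τ k) • q.1 = 0 := by
    intro q
    rw [amplitudeMap_mem_iff hU hτ, hcur, zero_add]
    exact and_iff_right fun b hb => hUc b hb q.1
  split_ifs with hR
  · have hmap : amplitudes L uo ut k = LinearMap.range (amplitudeMap L uo U k) := by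
      refine le_antisymm (amplitudes_le_range hU k) ?_
      rintro _ ⟨q, rfl⟩
      rw [hmem, hR, mul_zero, zero_smul]
    rw [hmap, LinearMap.finrank_range_of_inj (amplitudeMap_injective L uo U k),
      Module.finrank_prod, Module.finrank_fin_fun, Module.finrank_pi_fintype]
    simp only [Module.finrank_fin_fun, Finset.sum_const, Finset.card_univ, Fintype.card_coe,
      smul_eq_mul]
    ring
  · have hinj : Function.Injective (amplitudeMap L uo U k ∘ₗ
        LinearMap.inr ℂ (Fin 2 → ℂ) (nodalBonds L k → Fin 2 → ℂ)) :=
      (amplitudeMap_injective L uo U k).comp LinearMap.inr_injective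
    have hmap : amplitudes L uo ut k = LinearMap.range (amplitudeMap L uo U k ∘ₗ
        LinearMap.inr ℂ (Fin 2 → ℂ) (nodalBonds L k → Fin 2 → ℂ)) := by
      ext p
      constructor
      · intro hp
        obtain ⟨q, rfl⟩ := amplitudes_le_range hU k hp
        have h0 := (smul_eq_zero.1 ((hmem q).1 hp)).resolve_left (mul_ne_zero two_ne_zero hR)
        exact ⟨q.2, by rw [LinearMap.comp_apply, LinearMap.inr_apply, ← h0]⟩
      · rintro ⟨y, rfl⟩
        exact (hmem (0, y)).2 (smul_zero _)
    rw [hmap, LinearMap.finrank_range_of_inj hinj, Module.finrank_pi_fintype]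
    simp only [Module.finrank_fin_fun, Finset.sum_const, Finset.card_univ, Fintype.card_coe,
      smul_eq_mul]
    ring

/-- The multiplicity of a nonzero real eigenvalue is twice the order of the secular function. -/
theorem finrank_eigenspace_ofReal [NeZero B] {L τ : Fin B → ℝ} (hL : ∀ b, 0 < L b)
    (hτ1 : ∀ b, |τ b| ≤ 1) {uo ut : Fin B → Matrix.specialUnitaryGroup (Fin 2) ℂ}
    (hτ : ∀ b, ((uo b * (ut b)⁻¹ : Matrix.specialUnitaryGroup (Fin 2) ℂ) :
      Matrix (Fin 2) (Fin 2) ℂ).trace = 2 * τ b) {x : ℝ} (hx : x ≠ 0) :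
    Module.finrank ℂ (eigenspace (diracOperator L uo ut) x) =
      2 * analyticOrderNatAt (secular L τ) x := by
  rw [finrank_eigenspace hL]
  by_cases h : ∃ b ∈ nodalBonds L x, (τ b : ℂ) ≠ Complex.cos (L b * x)
  · have h1 := finrank_amplitudes_add_two (fun b => rfl) hτ h
    have h2 := analyticOrderNatAt_secular_add_one hL hτ1 hx h
    omega
  · push Not at h
    rw [finrank_amplitudes_of_resonant (fun b => rfl) hτ h,
      analyticOrderNatAt_secular_of_resonant hL hτ1 hx h]

theorem finrank_eigenspace_of_im_ne_zero [NeZero B] {L τ : Fin B → ℝ} (hL : ∀ b, 0 < L b)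
    (hτ1 : ∀ b, |τ b| ≤ 1) {uo ut : Fin B → Matrix.specialUnitaryGroup (Fin 2) ℂ}
    (hτ : ∀ b, ((uo b * (ut b)⁻¹ : Matrix.specialUnitaryGroup (Fin 2) ℂ) :
      Matrix (Fin 2) (Fin 2) ℂ).trace = 2 * τ b) {k : ℂ} (hk : k.im ≠ 0) :
    Module.finrank ℂ (eigenspace (diracOperator L uo ut) k) = 0 := by
  have hS : nodalBonds L k = ∅ := Finset.eq_empty_of_forall_notMem fun b hb =>
    sin_ne_zero_bond hL hk b (mem_nodalBonds.1 hb)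
  rw [finrank_eigenspace hL, finrank_amplitudes_of_resonant (fun b => rfl) hτ (by simp [hS]),
    if_neg (secularRatio_ne_zero hL hτ1 hk), hS]
  rfl

end DiracRose

end


/-! ### Assembly: the zero counting of the secular function and the value of the determinant. -/

noncomputable section

namespace DiracRose

open Filter Topology

variable {B : ℕ}

theorem analyticOrderNatAt_neg_of_even {f : ℂ → ℂ} (heven : ∀ z, f (-z) = f z) (z : ℂ) :
    analyticOrderNatAt f (-z) = analyticOrderNatAt f z := by
  have h := analyticOrderAt_comp_of_deriv_ne_zero (f := f) (g := fun w : ℂ => -w) (z₀ := z)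
    (by fun_prop) (by simp)
  rw [analyticOrderNatAt, ← h, show f ∘ (fun w : ℂ => -w) = f from funext heven]
  rfl

theorem analyticOrderNatAt_eq_zero_of_ne {f : ℂ → ℂ} (hf : Differentiable ℂ f) {z : ℂ}
    (h : f z ≠ 0) : analyticOrderNatAt f z = 0 := by
  rw [analyticOrderNatAt, (hf.analyticAt z).analyticOrderAt_eq_zero.2 h]
  rfl

theorem isZeroCounting_secular [NeZero B] {L τ : Fin B → ℝ} (hL : ∀ b, 0 < L b)
    (hτ : ∀ b, |τ b| ≤ 1) (h0 : secular L τ 0 ≠ 0) :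
    IsZeroCounting (fun k : ℝ => analyticOrderNatAt (secular L τ) k)
      (fun t => 2 * Real.log (‖secular L τ (t * Complex.I)‖ / ‖secular L τ 0‖))
      (2 * ∑ b, L b) (2 * (B - 1))
      (2 * (Real.log B - B * Real.log 2 - Real.log ‖secular L τ 0‖)) where
  zero := by
    rw [Complex.ofReal_zero]
    exact analyticOrderNatAt_eq_zero_of_ne (differentiable_secular L τ) h0
  exists_gap := by
    obtain ⟨δ, hδ, h⟩ := Metric.eventually_nhds_iff.1
      ((differentiable_secular L τ).continuous.continuousAt.eventually_ne h0)
    refine ⟨δ, hδ, fun k hk => ?_⟩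
    by_contra! hlt
    refine hk (analyticOrderNatAt_eq_zero_of_ne (differentiable_secular L τ) (h ?_))
    simpa using hlt
  hasSum t := by
    have hΛ : 0 ≤ ∑ b, L b := Finset.sum_nonneg fun b _ => (hL b).le
    have hB : (0 : ℝ) < B := by exact_mod_cast NeZero.pos B
    refine hasSum_log_of_even (C := 2 * B + ∑ b, L b) (differentiable_secular L τ)
      (secular_neg L τ) h0 (fun z => im_eq_zero_of_secular_eq_zero hL hτ) (by linarith)
      (fun z hz => (norm_secular_le hL hτ hz).trans ?_) t
    gcongr <;> linarith
  continuousOn := by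
    intro t ht
    have h1 : ContinuousAt (fun t : ℝ => secular L τ (t * Complex.I)) t :=
      ((differentiable_secular L τ).continuous.comp (by fun_prop)).continuousAt
    have h2 : secular L τ (t * Complex.I) ≠ 0 := fun h => by
      have := im_eq_zero_of_secular_eq_zero hL hτ h
      rw [Set.mem_Ioi] at ht
      simp at this
      exact ht.ne' this
    have h3 : ‖secular L τ (t * Complex.I)‖ / ‖secular L τ 0‖ ≠ 0 :=
      div_ne_zero (norm_ne_zero_iff.2 h2) (norm_ne_zero_iff.2 h0)
    exact (((h1.norm.div_const _).log h3).const_mul 2).continuousWithinAt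
  isBigO N := log_secular_isBigO hL hτ h0 N

/-- The integer multiple `B - 1` of `± i π` gives the same sign in both cases, so the determinant
does not depend on the cut. -/
theorem exp_neg_branchSign_mul (a : ℝ) (hB : B ≠ 0) :
    Complex.exp (-(branchSign a * Real.pi * Complex.I * (B - 1))) = (-1) ^ (B + 1) := by
  obtain ⟨m, rfl⟩ := Nat.exists_eq_succ_of_ne_zero hB
  have hm : ∀ ε : ℂ, Complex.exp (ε * Real.pi * Complex.I) = -1 →
      Complex.exp (ε * Real.pi * Complex.I * m) = (-1) ^ (m + 1 + 1) := by
    intro ε h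
    rw [mul_comm, Complex.exp_nat_mul, h]
    ring
  push_cast
  rw [add_sub_cancel_right, ← neg_mul, ← neg_mul, ← neg_mul]
  refine hm _ ?_
  rw [branchSign]
  split_ifs
  · simp [Complex.exp_neg]
  · simp

/-- The value of the regularized determinant computed from the derivative of the zeta function. -/
theorem exp_neg_deriv_zeta {L τ : Fin B → ℝ} (hL : ∀ b, 0 < L b) (hB : B ≠ 0)
    (h0 : ∑ b, (τ b - 1) / L b ≠ 0) (a : ℝ) :
    Complex.exp (-(((2 * (Real.log B - B * Real.log 2 - Real.log ‖secular L τ 0‖) : ℝ) : ℂ) +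
      branchSign a * Real.pi * Complex.I * (((2 * (B - 1) : ℝ) : ℂ) / 2))) =
      (((-1 : ℝ) ^ (B + 1) / (B : ℝ) ^ 2 * (∑ b, (τ b - 1) / L b) ^ 2 *
          ∏ b, (2 * L b) ^ 2 : ℝ) : ℂ) := by
  set σ := ∑ b, (τ b - 1) / L b with hσ
  have hP : 0 < ∏ b, L b := Finset.prod_pos fun b _ => hL b
  have hBpos : (0 : ℝ) < B := by exact_mod_cast Nat.pos_of_ne_zero hB
  have hnorm : ‖secular L τ 0‖ = |σ| * ∏ b, L b := by
    rw [secular_zero hL, Complex.norm_real, Real.norm_eq_abs, abs_mul, abs_neg, abs_of_pos hP]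
  have hpos : 0 < |σ| * ∏ b, L b := mul_pos (abs_pos.2 h0) hP
  have hre : Real.exp (-(2 * (Real.log B - B * Real.log 2 - Real.log ‖secular L τ 0‖))) =
      1 / (B : ℝ) ^ 2 * σ ^ 2 * ∏ b, (2 * L b) ^ 2 := by
    -- The argument of the logarithm is `(2 ^ B |f 0| / B)²`, with `|f 0| = |σ| ∏ b, L b` and `f =
    -- secular L τ`.
    have e1 : -(2 * (Real.log B - B * Real.log 2 - Real.log ‖secular L τ 0‖)) =
        Real.log ((2 ^ B * (|σ| * ∏ b, L b) / B) ^ 2) := by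
      rw [Real.log_pow, Real.log_div (by positivity) hBpos.ne', Real.log_mul (by positivity)
        hpos.ne', Real.log_pow, hnorm]
      push_cast
      ring
    rw [e1, Real.exp_log (by positivity), Finset.prod_pow, Finset.prod_mul_distrib,
      Finset.prod_const, Finset.card_univ, Fintype.card_fin, ← sq_abs σ]
    ring
  have e2 : (((2 * (B - 1) : ℝ) : ℂ) / 2) = B - 1 := by push_cast; ring
  rw [neg_add, Complex.exp_add, e2, exp_neg_branchSign_mul a hB, ← Complex.ofReal_neg,
    ← Complex.ofReal_exp, hre]
  push_cast
  ring

end DiracRose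

end

theorem mainTheorem4 {B : ℕ} (L : Fin B → ℝ) (hL : ∀ b, 0 < L b)
    (uo ut : Fin B → Matrix.specialUnitaryGroup (Fin 2) ℂ)
    (θ : Fin B → ℝ)
    (hθ : ∀ b, (Real.cos (θ b) : ℂ) =
      1 / 2 * (((uo b * (ut b)⁻¹ : Matrix.specialUnitaryGroup (Fin 2) ℂ) :
        Matrix (Fin 2) (Fin 2) ℂ)).trace)
    (hf0 : ∑ b, (Real.cos (θ b) - 1) / L b ≠ 0)
    (a : ℝ) (ha0 : 0 < a) (ha2 : a < 2 * Real.pi) (ha : a ≠ Real.pi) :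
    (∀ k : ℂ, k ≠ 0 → FiniteDimensional ℂ
      (DiracRose.eigenspace (DiracRose.diracOperator L uo ut) k)) ∧
    (∃ ζ : ℂ → ℂ, DiracRose.IsSpectralZeta (DiracRose.diracOperator L uo ut) a ζ) ∧
    ∀ ζ : ℂ → ℂ, DiracRose.IsSpectralZeta (DiracRose.diracOperator L uo ut) a ζ →
      Complex.exp (-deriv ζ 0) =
        (((-1 : ℝ) ^ (B + 1) / (B : ℝ) ^ 2 * (∑ b, (Real.cos (θ b) - 1) / L b) ^ 2 *
          ∏ b, (2 * L b) ^ 2 : ℝ) : ℂ) := by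
  -- Without bonds the sum in `hf0` is empty, hence zero.
  have hB : B ≠ 0 := by
    rintro rfl
    simp at hf0
  have : NeZero B := ⟨hB⟩
  have hτ1 : ∀ b, |Real.cos (θ b)| ≤ 1 := fun b => Real.abs_cos_le_one _
  have hτ : ∀ b, ((uo b * (ut b)⁻¹ : Matrix.specialUnitaryGroup (Fin 2) ℂ) :
      Matrix (Fin 2) (Fin 2) ℂ).trace = 2 * ((Real.cos (θ b) : ℝ) : ℂ) := fun b => by
    rw [hθ b]
    ring
  have h0 : DiracRose.secular L (fun b => Real.cos (θ b)) 0 ≠ 0 := by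
    rw [DiracRose.secular_zero hL]
    exact Complex.ofReal_ne_zero.2
      (mul_ne_zero (neg_ne_zero.2 hf0) (Finset.prod_pos fun b _ => hL b).ne')
  obtain ⟨ζ, hζ, hd⟩ := DiracRose.exists_isSpectralZeta
    (DiracRose.isZeroCounting_secular hL hτ1 h0)
    (fun k => by
      rw [Complex.ofReal_neg]
      exact DiracRose.analyticOrderNatAt_neg_of_even (DiracRose.secular_neg L _) k)
    (fun k hk => DiracRose.finrank_eigenspace_ofReal hL hτ1 hτ hk)
    (fun k hk => DiracRose.finrank_eigenspace_of_im_ne_zero hL hτ1 hτ hk) ha0 ha2 ha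
  refine ⟨fun k _ => DiracRose.finiteDimensional_eigenspace hL uo ut k, ⟨ζ, hζ⟩, fun ξ hξ => ?_⟩
  rw [hξ.unique hζ, hd]
  exact DiracRose.exp_neg_deriv_zeta hL hB hf0 a
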